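/- Let $L,a,\hbar,c,g,\tau>0$ and let $\Omega_{L,a}=(\mathbb R/L\mathbb Z)^2\times[0,a]$. Let $H_0(\mathrm{curl})$ be the closure, in the norm $(\|E\|_{L^2}^2+\|\nabla\times E\|_{L^2}^2)^{1/2}$ of $H(\mathrm{curl})=\{E\in L^2(\Omega_{L,a};\mathbb C^3):\nabla\times E\in L^2\}$, of the smooth laterally periodic fields with $E_x=E_y=0$ at $z=0,a$. Let $V_{\mathrm{PEC}}=\{E\in H_0(\mathrm{curl}):\nabla\cdot E=0 \text{ in the sense of distributions}\}$, let $H_{\mathrm{PEC}}$ be its $L^2$-closure, $h_0=(L^2a)^{-1/2}e_z$, $H_{\mathrm{phys}}=H_{\mathrm{PEC}}\ominus\mathrm{span}\{h_0\}$ and $V_{\mathrm{phys}}=V_{\mathrm{PEC}}\cap H_{\mathrm{phys}}$. Let $\mathcal L_{\mathrm{Mx}}$ be the operator on $H_{\mathrm{phys}}$ associated with the form $q[E,F]=\int_{\Omega_{L,a}}(\nabla\times E)\cdot\overline{(\nabla\times F)}\,dx$ on $V_{\mathrm{phys}}$: its domain consists of the $E\in V_{\mathrm{phys}}$ for which there is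 $G\in H_{\mathrm{phys}}$ with $q[E,F]=\langle G,F\rangle$ for all $F\in V_{\mathrm{phys}}$, and then $\mathcal L_{\mathrm{Mx}}E=G$. Let $(\xi_j)_{j\ge1}$ be jointly Gaussian centered complex random variables on a probability space $(\Omega,P)$ with $\mathbb E[\xi_i\overline{\xi_j}]=\delta_{ij}$ (for example circular ones, $\mathbb E[\xi_i\xi_j]=0$, or real standard ones). Then $\mathcal L_{\mathrm{Mx}}$ has an orthonormal eigenbasis $(u_j)_{j\ge1}$ of $H_{\mathrm{phys}}$. For every such basis, with $\mathcal L_{\mathrm{Mx}}u_j=\lambda_ju_j$ and $\lambda_j\in\mathbb R$, one has $\lambda_j>0$ for all $j$, and the series $$\Sigma_\tau=\Big(\frac{\hbar c}{g}\Big)^{1/2}\sum_{j\ge1}\lambda_j^{3/4}e^{-\tau\lambda_j/2}\,\xi_j\,u_j$$ converges in $L^2(\Omega;H_{\mathrm{phys}})$. Its sum $\Sigma_\tau$ is a centered $H_{\mathrm{phys}}$-valued Gaussian random variable (every continuous real-linear functional of it is real Gaussian), and if $\mathbb E[\xi_i\xi_j]=0$ for all $i,j$ it is circular: $\mathbb E[\langle\Sigma_\tau,x\rangle\langle\Sigma_\tau,y\rangle]=0$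 for all $x,y\in H_{\mathrm{phys}}$. Its covariance operator is $$C_\tau=\mathbb E[\Sigma_\tau\otimes\Sigma_\tau^*]=\frac{\hbar c}{g}\,\mathcal L_{\mathrm{Mx}}^{3/2}e^{-\tau\mathcal L_{\mathrm{Mx}}},$$ where the right side is defined by the spectral calculus of $\mathcal L_{\mathrm{Mx}}$; in particular $C_\tau$ is positive and trace class. -/

import Mathlib

open MeasureTheory ProbabilityTheory Filter Topology
open scoped ContDiff

/-! ### The slab `T²_L × (0,a)` and its `L²` space

Points are `x = (x 0, x 1, x 2)`; `x 0, x 1` are the lateral variables, of period `L`, and `x 2` is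
the plate variable.  Functions on the slab are functions on the period cell
`(0,L) × (0,L) × (0,a)`, which has full measure; smooth functions on `T²_L × [0,a]` are smooth functions on `ℝ³` that are
`L`-periodic in the lateral variables, restricted to the slab. -/

/-- Coordinates on the slab. -/
abbrev Pt : Type := Fin 3 → ℝ

/-- Values of the fields, with the Hermitian norm. -/
abbrev C3 : Type := EuclideanSpace ℂ (Fin 3)

/-- The open period cell `(0,L) × (0,L) × (0,a)`. -/
def slab (L a : ℝ) : Set Pt :=
  {x | (0 < x 0 ∧ x 0 < L) ∧ (0 < x 1 ∧ x 1 < L) ∧ (0 < x 2 ∧ x 2 < a)}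

/-- Lebesgue measure on the slab. -/
noncomputable def slabMeasure (L a : ℝ) : Measure Pt := volume.restrict (slab L a)

/-- The Hilbert space `L²(T²_L × (0,a); ℂ³)`. -/
abbrev L2Field (L a : ℝ) : Type := Lp C3 2 (slabMeasure L a)

/-- Periodicity of period `L` in the two lateral variables. -/
def LateralPeriodic {V : Type*} (L : ℝ) (φ : Pt → V) : Prop :=
  ∀ x : Pt, φ (x + Pi.single 0 L) = φ x ∧ φ (x + Pi.single 1 L) = φ x

/-- The support in the plate variable is a compact subset of the open interval `(0,a)`. -/
def CompactInPlates {V : Type*} [Zero V] (a : ℝ) (φ : Pt → V) : Prop :=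
  ∃ δ : ℝ, 0 < δ ∧ ∀ x : Pt, φ x ≠ 0 → δ ≤ x 2 ∧ x 2 ≤ a - δ

/-- `∂ᵢ φⱼ` for a classical vector field. -/
noncomputable def pd (i j : Fin 3) (φ : Pt → C3) (x : Pt) : ℂ :=
  (fderiv ℝ φ x (Pi.single i 1)) j

/-- The classical curl. -/
noncomputable def curl (φ : Pt → C3) (x : Pt) : C3 :=
  !₂[pd 1 2 φ x - pd 2 1 φ x, pd 2 0 φ x - pd 0 2 φ x, pd 0 1 φ x - pd 1 0 φ x]

/-- The classical gradient of a scalar function. -/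
noncomputable def grad (φ : Pt → ℂ) (x : Pt) : C3 :=
  !₂[fderiv ℝ φ x (Pi.single 0 1), fderiv ℝ φ x (Pi.single 1 1), fderiv ℝ φ x (Pi.single 2 1)]

theorem slab_subset_Icc (L a : ℝ) : slab L a ⊆ Set.Icc (0 : Pt) ![L, L, a] := by
  rintro x ⟨⟨h0, h0'⟩, ⟨h1, h1'⟩, ⟨h2, h2'⟩⟩
  refine ⟨fun i => ?_, fun i => ?_⟩ <;> fin_cases i <;> simp <;> linarith

theorem measurableSet_slab (L a : ℝ) : MeasurableSet (slab L a) := by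
  unfold slab
  measurability

theorem isFiniteMeasure_slab (L a : ℝ) : IsFiniteMeasure (slabMeasure L a) :=
  ⟨by simpa [slabMeasure] using
    (measure_mono (slab_subset_Icc L a)).trans_lt isCompact_Icc.measure_lt_top⟩

theorem memLp_of_continuous (L a : ℝ) {φ : Pt → C3} (hφ : Continuous φ) :
    MemLp φ 2 (slabMeasure L a) := by
  have hK : IsCompact (Set.Icc (0 : Pt) ![L, L, a]) := isCompact_Icc
  obtain ⟨C, hC⟩ := hK.exists_bound_of_continuousOn hφ.continuousOn
  have := isFiniteMeasure_slab L a
  refine MemLp.of_bound hφ.aestronglyMeasurable C ?_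
  exact (ae_restrict_iff' (measurableSet_slab L a)).2
    (Eventually.of_forall fun x hx => hC x (slab_subset_Icc L a hx))

theorem continuous_pd (i j : Fin 3) {φ : Pt → C3} (hφ : ContDiff ℝ ∞ φ) :
    Continuous (pd i j φ) := by
  have h : Continuous (fun x => fderiv ℝ φ x (Pi.single i 1)) :=
    (hφ.continuous_fderiv (by simp)).clm_apply continuous_const
  exact (EuclideanSpace.proj (𝕜 := ℂ) j).continuous.comp h

theorem continuous_curl {φ : Pt → C3} (hφ : ContDiff ℝ ∞ φ) : Continuous (curl φ) := by
  refine (PiLp.continuous_toLp 2 _).comp (continuous_pi fun i => ?_)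
  fin_cases i
  · exact (continuous_pd 1 2 hφ).sub (continuous_pd 2 1 hφ)
  · exact (continuous_pd 2 0 hφ).sub (continuous_pd 0 2 hφ)
  · exact (continuous_pd 0 1 hφ).sub (continuous_pd 1 0 hφ)

theorem continuous_grad {φ : Pt → ℂ} (hφ : ContDiff ℝ ∞ φ) : Continuous (grad φ) := by
  have h : ∀ i, Continuous (fun x => fderiv ℝ φ x (Pi.single i 1)) := fun i =>
    (hφ.continuous_fderiv (by simp)).clm_apply continuous_const
  refine (PiLp.continuous_toLp 2 _).comp (continuous_pi fun i => ?_)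
  fin_cases i
  · exact h 0
  · exact h 1
  · exact h 2

/-- The class in `L²` of a continuous field. -/
noncomputable def toL2 (L a : ℝ) (φ : Pt → C3) (hφ : Continuous φ) : L2Field L a :=
  (memLp_of_continuous L a hφ).toLp φ

/-! ### Test functions and the weak curl -/

/-- Smooth periodic test functions (scalar or vector valued), compactly supported in the open
interval `(0,a)` in the plate variable. -/
structure IsTest {V : Type*} [NormedAddCommGroup V] [NormedSpace ℝ V] (L a : ℝ)
    (φ : Pt → V) : Prop where
  smooth : ContDiff ℝ ∞ φ
  periodic : LateralPeriodic L φ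
  compact : CompactInPlates a φ

/-- `∇ × E = G` in the sense of periodic distributions on the slab:
`∫ E · conj (∇ × φ) = ∫ G · conj φ` for all test fields `φ`. -/
def IsWeakCurl {L a : ℝ} (E G : L2Field L a) : Prop :=
  ∀ (φ : Pt → C3) (h : IsTest L a φ),
    inner ℂ (toL2 L a (curl φ) (continuous_curl h.smooth)) E =
      inner ℂ (toL2 L a φ h.smooth.continuous) G

/-- `∇ · E = 0` in the sense of periodic distributions on the slab:
`∫ E · conj (∇ φ) = 0` for all scalar test functions `φ`. -/
def IsDivFree {L a : ℝ} (E : L2Field L a) : Prop :=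
  ∀ (φ : Pt → ℂ) (h : IsTest L a φ),
    inner ℂ (toL2 L a (grad φ) (continuous_grad h.smooth)) E = 0

/-- The periodization in the coordinate `i` of a function living on `0 < x i < L`. -/
noncomputable def periodize (L : ℝ) (i : Fin 3) (g : Pt → ℝ) (x : Pt) : ℝ :=
  g (x - Pi.single i (L * ⌊x i / L⌋))

theorem periodize_periodic {L : ℝ} (hL : 0 < L) (i : Fin 3) (g : Pt → ℝ) (x : Pt) :
    periodize L i g (x + Pi.single i L) = periodize L i g x := by
  unfold periodize
  congr 1
  have h : (x + Pi.single i L : Pt) i / L = x i / L + 1 := by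
    simp [add_div, hL.ne']
  rw [h, Int.floor_add_one]
  ext j
  by_cases hj : j = i
  · subst hj
    simp
    ring
  · simp [hj]

theorem periodize_other {L M : ℝ} {i j : Fin 3} (hij : j ≠ i) {g : Pt → ℝ}
    (hg : ∀ x, g (x + Pi.single j M) = g x) (x : Pt) :
    periodize L i g (x + Pi.single j M) = periodize L i g x := by
  unfold periodize
  have h : (x + Pi.single j M : Pt) i = x i := by simp [hij.symm]
  rw [h, ← hg (x - _)]
  congr 1
  abel

theorem periodize_eq {L : ℝ} (hL : 0 < L) {i : Fin 3} {g : Pt → ℝ} {x : Pt}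
    (h0 : 0 ≤ x i) (h1 : x i < L) : periodize L i g x = g x := by
  unfold periodize
  have : ⌊x i / L⌋ = 0 := by
    rw [Int.floor_eq_zero_iff]
    exact ⟨by positivity, (div_lt_one hL).2 h1⟩
  simp [this]

theorem periodize_smooth {L : ℝ} (hL : 0 < L) {i : Fin 3} {g : Pt → ℝ} (hg : ContDiff ℝ ∞ g)
    (hs : ∀ x, g x ≠ 0 → 0 < x i ∧ x i < L) : ContDiff ℝ ∞ (periodize L i g) := by
  rw [contDiff_iff_contDiffAt]
  intro x
  set k : ℤ := ⌊x i / L⌋ with hk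
  have h0 : L * k ≤ x i := by
    have := Int.floor_le (x i / L)
    rw [le_div_iff₀ hL] at this
    linarith
  have h1 : x i < L * (k + 1) := by
    have := Int.lt_floor_add_one (x i / L)
    rw [div_lt_iff₀ hL] at this
    linarith
  have hloc : periodize L i g =ᶠ[𝓝 x]
      fun y => g (y - Pi.single i (L * (k - 1 : ℝ))) + g (y - Pi.single i (L * (k : ℝ))) := by
    have hc : ContinuousAt (fun y : Pt => y i) x := (continuous_apply i).continuousAt
    filter_upwards [hc.eventually (lt_mem_nhds (show L * (k - 1 : ℝ) < x i by nlinarith)),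
      hc.eventually (gt_mem_nhds h1)] with y hy0 hy1
    unfold periodize
    rcases lt_or_ge (y i) (L * k) with hy | hy
    · have hf : ⌊y i / L⌋ = k - 1 := by
        rw [Int.floor_eq_iff]
        push_cast
        rw [le_div_iff₀ hL, div_lt_iff₀ hL]
        constructor <;> nlinarith
      have hz : g (y - Pi.single i (L * (k : ℝ))) = 0 := by
        by_contra hne
        have := (hs _ hne).1
        simp at this
        linarith
      rw [hf, hz]
      push_cast
      simp
    · have hf : ⌊y i / L⌋ = k := by
        rw [Int.floor_eq_iff, le_div_iff₀ hL, div_lt_iff₀ hL]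
        constructor <;> nlinarith
      have hz : g (y - Pi.single i (L * (k - 1 : ℝ))) = 0 := by
        by_contra hne
        have := (hs _ hne).2
        simp at this
        nlinarith
      rw [hf, hz]
      simp
  refine ContDiffAt.congr_of_eventuallyEq ?_ hloc
  exact ((hg.comp (contDiff_id.sub contDiff_const)).add
    (hg.comp (contDiff_id.sub contDiff_const))).contDiffAt

/-- A smooth function supported in the open cell extends to a periodic test function. -/
theorem exists_test {L a : ℝ} (hL : 0 < L) {g : Pt → ℝ} (hg : ContDiff ℝ ∞ g) {δ : ℝ}
    (hδ : 0 < δ)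
    (hs : ∀ x, g x ≠ 0 → (0 < x 0 ∧ x 0 < L) ∧ (0 < x 1 ∧ x 1 < L) ∧ (δ ≤ x 2 ∧ x 2 ≤ a - δ)) :
    ∃ p : Pt → ℝ, IsTest L a p ∧ ∀ x ∈ slab L a, p x = g x := by
  have hs' : ∀ x, periodize L 0 g x ≠ 0 →
      (0 < x 1 ∧ x 1 < L) ∧ (δ ≤ x 2 ∧ x 2 ≤ a - δ) := by
    intro x hx
    simpa using (hs _ hx).2
  have hs'' : ∀ x, periodize L 1 (periodize L 0 g) x ≠ 0 → δ ≤ x 2 ∧ x 2 ≤ a - δ := by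
    intro x hx
    simpa using (hs' _ hx).2
  have h1 := periodize_smooth hL hg (fun x hx => (hs x hx).1)
  refine ⟨periodize L 1 (periodize L 0 g),
    ⟨periodize_smooth hL h1 (fun x hx => (hs' x hx).1), fun x => ⟨?_, ?_⟩, δ, hδ, hs''⟩, ?_⟩
  · exact periodize_other (by decide) (periodize_periodic hL 0 g) x
  · exact periodize_periodic hL 1 _ x
  · rintro x ⟨⟨h0, h0'⟩, ⟨h1, h1'⟩, -⟩
    rw [periodize_eq hL h1.le h1', periodize_eq hL h0.le h0']

theorem isOpen_slab (L a : ℝ) : IsOpen (slab L a) := by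
  have h : ∀ i : Fin 3, Continuous fun x : Pt => x i := continuous_apply
  have hc : ∀ (i : Fin 3) (c : ℝ), IsOpen {x : Pt | 0 < x i ∧ x i < c} := fun i c =>
    (isOpen_lt continuous_const (h i)).inter (isOpen_lt (h i) continuous_const)
  exact (hc 0 L).inter ((hc 1 L).inter (hc 2 a))

/-- Test fields are total in `L²`, so that a weak curl is unique. -/
theorem eq_zero_of_forall_test {L a : ℝ} (G : L2Field L a)
    (h : ∀ (φ : Pt → C3) (hφ : IsTest L a φ),
      inner ℂ (toL2 L a φ hφ.smooth.continuous) G = 0) : G = 0 := by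
  have := isFiniteMeasure_slab L a
  have hint : Integrable G (slabMeasure L a) := (Lp.memLp G).integrable (by norm_num)
  have key : ∀ j : Fin 3, ∀ᵐ x ∂(slabMeasure L a), x ∈ slab L a → G x j = 0 := by
    intro j
    have hj : Integrable (fun x => G x j) (slabMeasure L a) :=
      (EuclideanSpace.proj (𝕜 := ℂ) j).integrable_comp hint
    refine (isOpen_slab L a).ae_eq_zero_of_integral_contDiff_smul_eq_zero
      (hj.locallyIntegrable.locallyIntegrableOn _) ?_
    intro g hg hgc hgs
    obtain ⟨δ, hδ, hδ'⟩ : ∃ δ : ℝ, 0 < δ ∧ ∀ x ∈ tsupport g, δ ≤ min (x 2) (a - x 2) := by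
      refine hgc.isCompact.exists_forall_le' (by fun_prop) fun x hx => ?_
      obtain ⟨-, -, h2, h2'⟩ := hgs hx
      exact lt_min h2 (by linarith)
    by_cases hL : 0 < L
    swap
    · have hz : g = 0 := by
        funext x
        by_contra hne
        obtain ⟨⟨h0, h0'⟩, -⟩ := hgs (subset_tsupport g hne)
        exact hL (h0.trans h0')
      simp [hz]
    obtain ⟨p, hp, hpg⟩ := exists_test (a := a) hL hg hδ (fun x hx => by
      have hx' := subset_tsupport g hx
      obtain ⟨h0, h1, -⟩ := hgs hx'
      have := le_min_iff.1 (hδ' x hx')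
      exact ⟨h0, h1, this.1, by linarith [this.2]⟩)
    have hφ : IsTest L a (fun x => p x • (EuclideanSpace.single j 1 : C3)) := by
      refine ⟨?_, fun x => ⟨?_, ?_⟩, ?_⟩
      · exact hp.smooth.smul contDiff_const
      · simp only [(hp.periodic x).1]
      · simp only [(hp.periodic x).2]
      · obtain ⟨ε, hε, hs⟩ := hp.compact
        exact ⟨ε, hε, fun x hx => hs x fun h0 => hx (by simp [h0])⟩
    have h1 := h _ hφ
    rw [L2.inner_def] at h1
    rw [← h1]
    refine integral_congr_ae ?_
    have hae := MemLp.coeFn_toLp (memLp_of_continuous L a hφ.smooth.continuous)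
    filter_upwards [hae, (ae_restrict_mem (measurableSet_slab L a) :
      ∀ᵐ x ∂(slabMeasure L a), x ∈ slab L a)] with x hx hxs
    unfold toL2
    have hsm : p x • (EuclideanSpace.single j 1 : C3) = EuclideanSpace.single j (p x : ℂ) := by
      ext k
      by_cases hk : k = j <;> simp [hk]
    rw [hx, hsm, EuclideanSpace.inner_single_left]
    simp [hpg x hxs]
  apply Lp.ext
  filter_upwards [key 0, key 1, key 2, (ae_restrict_mem (measurableSet_slab L a) :
      ∀ᵐ x ∂(slabMeasure L a), x ∈ slab L a), Lp.coeFn_zero C3 2 (slabMeasure L a)]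
    with x h0 h1 h2 hx hz
  rw [hz]
  ext j
  fin_cases j
  · exact h0 hx
  · exact h1 hx
  · exact h2 hx

/-! ### The spaces `H(curl)`, `H₀(curl)`, `V_PEC`, `H_PEC`, `H_phys`, `V_phys` -/

/-- The graph of the distributional curl in `L² × L²`. -/
noncomputable def curlGraph (L a : ℝ) : Submodule ℂ (L2Field L a × L2Field L a) where
  carrier := {p | IsWeakCurl p.1 p.2}
  add_mem' := by
    intro p q hp hq φ h
    simp only [Prod.fst_add, Prod.snd_add, inner_add_right]
    rw [hp φ h, hq φ h]
  zero_mem' := by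
    intro φ h
    simp
  smul_mem' := by
    intro c p hp φ h
    simp only [Prod.smul_fst, Prod.smul_snd, inner_smul_right]
    rw [hp φ h]

theorem curlGraph_singleValued {L a : ℝ} (p : L2Field L a × L2Field L a)
    (hp : p ∈ curlGraph L a) (h0 : p.1 = 0) : p.2 = 0 := by
  refine eq_zero_of_forall_test p.2 fun φ h => ?_
  rw [← hp φ h, h0, inner_zero_right]

/-- The distributional curl as an unbounded operator on `L²`; its domain is `H(curl)`. -/
noncomputable def weakCurl (L a : ℝ) : L2Field L a →ₗ.[ℂ] L2Field L a :=
  (curlGraph L a).toLinearPMap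

theorem weakCurl_graph (L a : ℝ) : (weakCurl L a).graph = curlGraph L a :=
  Submodule.toLinearPMap_graph_eq _ fun p hp h0 => curlGraph_singleValued p hp h0

/-- `H(curl) = {E ∈ L² : ∇ × E ∈ L²}`. -/
noncomputable def Hcurl (L a : ℝ) : Submodule ℂ (L2Field L a) := (weakCurl L a).domain

/-- Smooth lateral-periodic fields on the closed slab whose tangential components vanish on the
plates. -/
structure IsSmoothPEC (L a : ℝ) (φ : Pt → C3) : Prop where
  smooth : ContDiff ℝ ∞ φ
  periodic : LateralPeriodic L φ
  tangential : ∀ x : Pt, x 2 = 0 ∨ x 2 = a → φ x 0 = 0 ∧ φ x 1 = 0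

theorem pd_add (i j : Fin 3) {φ ψ : Pt → C3} (hφ : ContDiff ℝ ∞ φ) (hψ : ContDiff ℝ ∞ ψ) (x : Pt) :
    pd i j (φ + ψ) x = pd i j φ x + pd i j ψ x := by
  unfold pd
  rw [fderiv_add (hφ.differentiable (by simp) x) (hψ.differentiable (by simp) x)]
  simp

theorem pd_smul (i j : Fin 3) (c : ℂ) {φ : Pt → C3} (hφ : ContDiff ℝ ∞ φ) (x : Pt) :
    pd i j (c • φ) x = c * pd i j φ x := by
  unfold pd
  rw [fderiv_const_smul (hφ.differentiable (by simp) x)]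
  simp

theorem curl_add {φ ψ : Pt → C3} (hφ : ContDiff ℝ ∞ φ) (hψ : ContDiff ℝ ∞ ψ) :
    curl (φ + ψ) = curl φ + curl ψ := by
  funext x
  ext k
  fin_cases k <;> simp [curl, pd_add _ _ hφ hψ] <;> ring

theorem curl_smul (c : ℂ) {φ : Pt → C3} (hφ : ContDiff ℝ ∞ φ) : curl (c • φ) = c • curl φ := by
  funext x
  ext k
  fin_cases k <;> simp [curl, pd_smul _ _ c hφ] <;> ring

/-- The pairs `(φ, ∇ × φ)` with `φ` a smooth periodic field of vanishing tangential trace. -/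
noncomputable def smoothCurlGraph (L a : ℝ) : Submodule ℂ (L2Field L a × L2Field L a) where
  carrier := {p | ∃ (φ : Pt → C3) (h : IsSmoothPEC L a φ),
    p = (toL2 L a φ h.smooth.continuous, toL2 L a (curl φ) (continuous_curl h.smooth))}
  add_mem' := by
    rintro _ _ ⟨φ, hφ, rfl⟩ ⟨ψ, hψ, rfl⟩
    refine ⟨φ + ψ, ⟨hφ.smooth.add hψ.smooth, fun x => ⟨?_, ?_⟩, fun x hx => ⟨?_, ?_⟩⟩, ?_⟩
    · simp [(hφ.periodic x).1, (hψ.periodic x).1]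
    · simp [(hφ.periodic x).2, (hψ.periodic x).2]
    · simp [(hφ.tangential x hx).1, (hψ.tangential x hx).1]
    · simp [(hφ.tangential x hx).2, (hψ.tangential x hx).2]
    · simp only [curl_add hφ.smooth hψ.smooth]
      rfl
  zero_mem' := by
    have hc : curl (0 : Pt → C3) = 0 := by
      funext x
      ext k
      fin_cases k <;> simp [curl, pd]
    refine ⟨0, ⟨contDiff_const, fun x => ⟨rfl, rfl⟩, fun x hx => ⟨rfl, rfl⟩⟩, ?_⟩
    simp only [hc]
    rfl
  smul_mem' := by
    rintro c _ ⟨φ, hφ, rfl⟩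
    refine ⟨c • φ, ⟨hφ.smooth.const_smul c, fun x => ⟨?_, ?_⟩, fun x hx => ⟨?_, ?_⟩⟩, ?_⟩
    · simp [(hφ.periodic x).1]
    · simp [(hφ.periodic x).2]
    · simp [(hφ.tangential x hx).1]
    · simp [(hφ.tangential x hx).2]
    · simp only [curl_smul c hφ.smooth]
      rfl

/-- `H₀(curl)`: the closure, in the graph norm of `H(curl)`, of the smooth periodic fields of
vanishing tangential trace; i.e. those `E ∈ H(curl)` for which `(E, ∇ × E)` is a limit in
`L² × L²` of pairs `(φ, ∇ × φ)`. -/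
noncomputable def Hzcurl (L a : ℝ) : Submodule ℂ (L2Field L a) :=
  (curlGraph L a ⊓ (smoothCurlGraph L a).topologicalClosure).map
    (LinearMap.fst ℂ (L2Field L a) (L2Field L a))

/-- The fields in `L²` of zero distributional divergence. -/
noncomputable def divFree (L a : ℝ) : Submodule ℂ (L2Field L a) where
  carrier := {E | IsDivFree E}
  add_mem' := by
    intro E F hE hF φ h
    rw [inner_add_right, hE φ h, hF φ h, add_zero]
  zero_mem' := by
    intro φ h
    simp
  smul_mem' := by
    intro c E hE φ h
    rw [inner_smul_right, hE φ h, mul_zero]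

/-- The form domain `V_PEC = {E ∈ H₀(curl) : ∇ · E = 0}`. -/
noncomputable def VPEC (L a : ℝ) : Submodule ℂ (L2Field L a) := Hzcurl L a ⊓ divFree L a

/-- `H_PEC`, the `L²`-closure of `V_PEC`. -/
noncomputable def HPEC (L a : ℝ) : Submodule ℂ (L2Field L a) := (VPEC L a).topologicalClosure

/-- The static normal mode `h₀ = (L² a)^{-1/2} e_z`. -/
noncomputable def hzero (L a : ℝ) : L2Field L a :=
  toL2 L a (fun _ => !₂[0, 0, (((L ^ 2 * a) ^ (-(1 / 2) : ℝ) : ℝ) : ℂ)]) continuous_const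

/-- The physical space `H_phys = H_PEC ⊖ span {h₀}`. -/
noncomputable def Hphys (L a : ℝ) : Submodule ℂ (L2Field L a) :=
  HPEC L a ⊓ (Submodule.span ℂ {hzero L a})ᗮ

theorem isClosed_Hphys (L a : ℝ) : IsClosed (Hphys L a : Set (L2Field L a)) :=
  (VPEC L a).isClosed_topologicalClosure.inter (Submodule.isClosed_orthogonal _)

noncomputable instance instCompleteHphys (L a : ℝ) : CompleteSpace (Hphys L a) :=
  (isClosed_Hphys L a).completeSpace_coe

noncomputable instance instMeasurableSpaceHphys (L a : ℝ) : MeasurableSpace (Hphys L a) :=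
  borel (Hphys L a)

instance instBorelSpaceHphys (L a : ℝ) : BorelSpace (Hphys L a) := ⟨rfl⟩

/-- `V_phys = V_PEC ∩ H_phys`, as a subspace of `H_phys`. -/
noncomputable def Vphys (L a : ℝ) : Submodule ℂ (Hphys L a) := (VPEC L a).comap (Hphys L a).subtype

theorem VPEC_le_Hcurl (L a : ℝ) : VPEC L a ≤ Hcurl L a := by
  rintro E ⟨⟨p, ⟨hp, -⟩, rfl⟩, -⟩
  exact ⟨p, hp, rfl⟩

/-- The curl on `V_phys`. -/
noncomputable def curlPhys (L a : ℝ) : Vphys L a →ₗ[ℂ] L2Field L a where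
  toFun E := weakCurl L a ⟨((E : Hphys L a) : L2Field L a), VPEC_le_Hcurl L a E.2⟩
  map_add' E F := (weakCurl L a).map_add ⟨_, VPEC_le_Hcurl L a E.2⟩ ⟨_, VPEC_le_Hcurl L a F.2⟩
  map_smul' c E := (weakCurl L a).map_smul c ⟨_, VPEC_le_Hcurl L a E.2⟩

/-- The Maxwell form `q[E,F] = ∫ (∇ × E) · conj (∇ × F)` on `V_phys`.
(Mathlib's inner product is linear in its second argument.) -/
noncomputable def maxwellForm {L a : ℝ} (E F : Vphys L a) : ℂ :=
  inner ℂ (curlPhys L a F) (curlPhys L a E)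

/-! ### Density of `V_phys` in `H_phys` -/

theorem slab_ae_eq_Icc (L a : ℝ) :
    slab L a =ᵐ[volume] Set.Icc (0 : Pt) ![L, L, a] := by
  have h : slab L a = Set.pi Set.univ fun i => Set.Ioo ((0 : Pt) i) ((![L, L, a] : Pt) i) := by
    ext x
    simp [slab, Fin.forall_fin_succ]
  rw [h]
  exact Measure.univ_pi_Ioo_ae_eq_Icc

theorem integral_deriv_test {L a : ℝ} {φ : Pt → ℂ} (h : IsTest L a φ) (i : Fin 3) :
    ∫ x, fderiv ℝ φ x (Pi.single i 1) ∂(slabMeasure L a) = 0 := by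
  unfold slabMeasure
  rw [setIntegral_congr_set (slab_ae_eq_Icc L a)]
  by_cases hle : (0 : Pt) ≤ ![L, L, a]
  swap
  · rw [Set.Icc_eq_empty hle]
    simp
  obtain ⟨δ, hδ, hs⟩ := h.compact
  have hb : ∀ x : Pt, x 2 = 0 ∨ x 2 = a → φ x = 0 := by
    intro x hx
    by_contra hne
    have := hs x hne
    rcases hx with hx | hx <;> rw [hx] at this <;> linarith
  have hface : ∀ y : Fin 2 → ℝ, φ (i.insertNth ((![L, L, a] : Pt) i) y) =
      φ (i.insertNth ((0 : Pt) i) y) := by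
    intro y
    have hper : ∀ k : Fin 3, (k.insertNth L y : Pt) = k.insertNth 0 y + Pi.single k L := by
      intro k
      ext m
      refine Fin.succAboveCases k ?_ (fun m => ?_) m <;> simp
    fin_cases i
    · change φ ((0 : Fin 3).insertNth L y) = φ ((0 : Fin 3).insertNth 0 y)
      rw [hper, (h.periodic _).1]
    · change φ ((1 : Fin 3).insertNth L y) = φ ((1 : Fin 3).insertNth 0 y)
      rw [hper, (h.periodic _).2]
    · change φ ((2 : Fin 3).insertNth a y) = φ ((2 : Fin 3).insertNth 0 y)
      rw [hb _ (Or.inr (Fin.insertNth_apply_same _ _ _)),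
        hb _ (Or.inl (Fin.insertNth_apply_same _ _ _))]
  have hcont : Continuous fun x => fderiv ℝ φ x (Pi.single i 1) :=
    (h.smooth.continuous_fderiv (by simp)).clm_apply continuous_const
  have hsum : ∀ x : Pt, ∑ k : Fin 3,
      (if k = i then fderiv ℝ φ else 0 : Pt → Pt →L[ℝ] ℂ) x (Pi.single k 1) =
        fderiv ℝ φ x (Pi.single i 1) := by
    intro x
    rw [Finset.sum_eq_single i]
    · simp
    · intro k _ hk
      simp [hk]
    · simp
  have key := integral_divergence_of_hasFDerivAt_off_countable' (E := ℂ) (0 : Pt) ![L, L, a] hle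
    (fun k => if k = i then φ else 0) (fun k => if k = i then fderiv ℝ φ else 0) ∅
    Set.countable_empty
    (fun k => by
      split_ifs
      · exact h.smooth.continuous.continuousOn
      · exact continuousOn_const)
    (fun x _ k => by
      split_ifs
      · exact (h.smooth.differentiable (by simp) x).hasFDerivAt
      · exact hasFDerivAt_const _ _)
    (by
      simp only [hsum]
      exact hcont.continuousOn.integrableOn_compact isCompact_Icc)
  simp only [hsum] at key
  rw [key]
  refine Finset.sum_eq_zero fun k _ => ?_
  by_cases hk : k = i
  · subst hk
    simp only [if_true, hface, sub_self]
  · simp [hk]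

theorem isTest_component {L a : ℝ} {φ : Pt → C3} (h : IsTest L a φ) (j : Fin 3) :
    IsTest L a (fun x => φ x j) := by
  refine ⟨((EuclideanSpace.proj (𝕜 := ℂ) j).restrictScalars ℝ).contDiff.comp h.smooth,
    fun x => ⟨?_, ?_⟩, ?_⟩
  · simp only [(h.periodic x).1]
  · simp only [(h.periodic x).2]
  · obtain ⟨δ, hδ, hs⟩ := h.compact
    exact ⟨δ, hδ, fun x hx => hs x fun h0 => hx (by simp [h0])⟩

theorem integral_pd {L a : ℝ} {φ : Pt → C3} (h : IsTest L a φ) (i j : Fin 3) :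
    ∫ x, star (pd i j φ x) ∂(slabMeasure L a) = 0 := by
  have h0 := integral_deriv_test (isTest_component h j) i
  have h1 : ∀ x, fderiv ℝ (fun x => φ x j) x (Pi.single i 1) = pd i j φ x := by
    intro x
    have := (((EuclideanSpace.proj (𝕜 := ℂ) j).restrictScalars ℝ).hasFDerivAt.comp x
      (h.smooth.differentiable (by simp) x).hasFDerivAt).fderiv
    unfold pd
    change fderiv ℝ (⇑((EuclideanSpace.proj (𝕜 := ℂ) j).restrictScalars ℝ) ∘ φ) x _ = _
    rw [this]
    rfl
  simp only [h1] at h0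
  have h2 := integral_conj (𝕜 := ℂ) (μ := slabMeasure L a) (f := fun x => pd i j φ x)
  rw [h0, map_zero] at h2
  exact h2

theorem integrable_pd (L a : ℝ) {φ : Pt → C3} (h : ContDiff ℝ ∞ φ) (i j : Fin 3) :
    Integrable (fun x => star (pd i j φ x)) (slabMeasure L a) :=
  ((continuous_star.comp (continuous_pd i j h)).continuousOn.integrableOn_compact
    isCompact_Icc).mono_set (slab_subset_Icc L a)

theorem hzero_mem_VPEC (L a : ℝ) : hzero L a ∈ VPEC L a := by
  have hcurl : ∀ v : C3, curl (fun _ => v) = 0 := by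
    intro v
    funext x
    ext k
    fin_cases k <;> simp [curl, pd]
  have hdiv : IsDivFree (hzero L a) := by
    intro φ h
    rw [L2.inner_def]
    have hcong : ∫ x, inner ℂ (toL2 L a (grad φ) (continuous_grad h.smooth) x) (hzero L a x)
        ∂(slabMeasure L a) =
        ∫ x, (((L ^ 2 * a) ^ (-(1 / 2) : ℝ) : ℝ) : ℂ) *
          star (fderiv ℝ φ x (Pi.single 2 1)) ∂(slabMeasure L a) := by
      refine integral_congr_ae ?_
      filter_upwards [MemLp.coeFn_toLp (memLp_of_continuous L a (continuous_grad h.smooth)),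
        MemLp.coeFn_toLp (memLp_of_continuous L a (φ := fun _ =>
          !₂[0, 0, (((L ^ 2 * a) ^ (-(1 / 2) : ℝ) : ℝ) : ℂ)]) continuous_const)] with x h1 h2
      unfold hzero toL2
      rw [h1, h2]
      simp [grad, PiLp.inner_apply, Fin.sum_univ_three]
    rw [hcong, integral_const_mul]
    have : ∫ x, star (fderiv ℝ φ x (Pi.single 2 1)) ∂(slabMeasure L a) = 0 := by
      have h0 := integral_deriv_test h 2
      have h1 := integral_conj (𝕜 := ℂ) (μ := slabMeasure L a)
        (f := fun x => fderiv ℝ φ x (Pi.single 2 1))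
      rw [h0, map_zero] at h1
      exact h1
    rw [this, mul_zero]
  refine ⟨⟨(hzero L a, 0), ⟨?_, ?_⟩, rfl⟩, hdiv⟩
  · intro φ h
    rw [inner_zero_right, L2.inner_def]
    have hcong : ∫ x, inner ℂ (toL2 L a (curl φ) (continuous_curl h.smooth) x) (hzero L a x)
        ∂(slabMeasure L a) =
        ∫ x, (((L ^ 2 * a) ^ (-(1 / 2) : ℝ) : ℝ) : ℂ) *
          (star (pd 0 1 φ x) - star (pd 1 0 φ x)) ∂(slabMeasure L a) := by
      refine integral_congr_ae ?_
      filter_upwards [MemLp.coeFn_toLp (memLp_of_continuous L a (continuous_curl h.smooth)),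
        MemLp.coeFn_toLp (memLp_of_continuous L a (φ := fun _ =>
          !₂[0, 0, (((L ^ 2 * a) ^ (-(1 / 2) : ℝ) : ℝ) : ℂ)]) continuous_const)] with x h1 h2
      unfold hzero toL2
      rw [h1, h2]
      simp [curl, PiLp.inner_apply, Fin.sum_univ_three]
    rw [hcong, integral_const_mul, integral_sub (integrable_pd L a h.smooth 0 1)
      (integrable_pd L a h.smooth 1 0), integral_pd h, integral_pd h, sub_zero, mul_zero]
  · refine Submodule.le_topologicalClosure _
      ⟨fun _ => !₂[0, 0, (((L ^ 2 * a) ^ (-(1 / 2) : ℝ) : ℝ) : ℂ)], ⟨contDiff_const, fun x => ⟨rfl, rfl⟩,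
      fun x _ => ⟨by simp, by simp⟩⟩, ?_⟩
    simp only [hcurl]
    rfl

theorem dense_Vphys (L a : ℝ) : Dense (Vphys L a : Set (Hphys L a)) := by
  have hK : Submodule.span ℂ {hzero L a} ≤ VPEC L a := by
    rw [Submodule.span_singleton_le_iff_mem]
    exact hzero_mem_VPEC L a
  set K := Submodule.span ℂ {hzero L a} with hKdef
  intro F
  have hF : (F : L2Field L a) ∈ closure (VPEC L a : Set (L2Field L a)) := F.2.1
  rw [Metric.mem_closure_iff] at hF ⊢
  intro ε hε
  obtain ⟨E, hE, hd⟩ := hF ε hε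
  have hEV : E - K.starProjection E ∈ VPEC L a :=
    (VPEC L a).sub_mem hE (hK (K.starProjection_apply_mem E))
  have hEo : E - K.starProjection E ∈ Kᗮ := K.sub_starProjection_mem_orthogonal E
  refine ⟨⟨E - K.starProjection E, (VPEC L a).le_topologicalClosure hEV, hEo⟩, hEV, ?_⟩
  refine lt_of_le_of_lt ?_ hd
  have hF0 : K.starProjection (F : L2Field L a) = 0 :=
    K.starProjection_apply_eq_zero_iff.2 F.2.2
  have heq : (F : L2Field L a) - (E - K.starProjection E) =
      Kᗮ.starProjection ((F : L2Field L a) - E) := by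
    rw [K.starProjection_orthogonal_val, map_sub, hF0]
    abel
  rw [Subtype.dist_eq, dist_eq_norm, dist_eq_norm]
  change ‖(F : L2Field L a) - (E - K.starProjection E)‖ ≤ _
  rw [heq]
  exact Kᗮ.norm_starProjection_apply_le _

/-! ### The reduced Maxwell operator -/

/-- The graph of the operator associated with the Maxwell form: pairs `(E, G)` with `E ∈ V_phys`,
`G ∈ H_phys` and `q[E,F] = ⟨G, F⟩` for all `F ∈ V_phys`. -/
noncomputable def maxwellGraph (L a : ℝ) : Submodule ℂ (Hphys L a × Hphys L a) where
  carrier := {p | ∃ E : Vphys L a, (E : Hphys L a) = p.1 ∧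
    ∀ F : Vphys L a, maxwellForm E F = inner ℂ (F : Hphys L a) p.2}
  add_mem' := by
    rintro p q ⟨E, hE, hE'⟩ ⟨F, hF, hF'⟩
    refine ⟨E + F, by simp [hE, hF], fun K => ?_⟩
    have hE2 := hE' K
    have hF2 := hF' K
    unfold maxwellForm at *
    rw [map_add, inner_add_right, hE2, hF2, Prod.snd_add, inner_add_right]
  zero_mem' := ⟨0, rfl, fun F => by simp [maxwellForm]⟩
  smul_mem' := by
    rintro c p ⟨E, hE, hE'⟩
    refine ⟨c • E, by simp [hE], fun K => ?_⟩
    have hE2 := hE' K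
    unfold maxwellForm at *
    rw [map_smul, inner_smul_right, hE2, Prod.smul_snd, inner_smul_right]

theorem maxwellGraph_singleValued {L a : ℝ} (p : Hphys L a × Hphys L a)
    (hp : p ∈ maxwellGraph L a) (h0 : p.1 = 0) : p.2 = 0 := by
  obtain ⟨E, hE, hE'⟩ := hp
  have hE0 : E = 0 := Subtype.ext (hE.trans h0)
  subst hE0
  refine (dense_Vphys L a).eq_zero_of_inner_right ℂ fun F hF => ?_
  rw [← hE' ⟨F, hF⟩]
  simp [maxwellForm]

/-- The reduced Maxwell operator `L_Mx` on `H_phys`, associated with the Maxwell form: its domain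
consists of the `E ∈ V_phys` for which there is `G ∈ H_phys` with `q[E,F] = ⟨G, F⟩` for all
`F ∈ V_phys`, and then `L_Mx E = G`. -/
noncomputable def LMx (L a : ℝ) : Hphys L a →ₗ.[ℂ] Hphys L a := (maxwellGraph L a).toLinearPMap

theorem LMx_graph (L a : ℝ) : (LMx L a).graph = maxwellGraph L a :=
  Submodule.toLinearPMap_graph_eq _ fun p hp h0 => maxwellGraph_singleValued p hp h0

/-! ### Functions of an operator with pure point spectrum; trace class -/

section OperatorTheory

universe u

variable {H : Type u} [NormedAddCommGroup H] [InnerProductSpace ℂ H] [CompleteSpace H]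

/-- The eigenspace of an unbounded operator `A` at the real number `μ`. -/
def eigenspaceAt (A : H →ₗ.[ℂ] H) (μ : ℝ) : Submodule ℂ H where
  carrier := {x | ∃ y : A.domain, (y : H) = x ∧ A y = (μ : ℂ) • x}
  add_mem' := by
    rintro _ _ ⟨y, rfl, hy⟩ ⟨z, rfl, hz⟩
    exact ⟨y + z, rfl, by rw [A.map_add, hy, hz, smul_add]⟩
  zero_mem' := ⟨0, rfl, by simp⟩
  smul_mem' := by
    rintro c _ ⟨y, rfl, hy⟩
    exact ⟨c • y, rfl, by rw [A.map_smul, hy, smul_comm]⟩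

/-- The spectral projection of `A` at the real number `μ`: the orthogonal projection onto the
eigenspace (which is closed if `A` is closed; in general we take its closure). -/
noncomputable def spectralProj (A : H →ₗ.[ℂ] H) (μ : ℝ) : H →L[ℂ] H :=
  haveI : CompleteSpace (eigenspaceAt A μ).topologicalClosure :=
    (eigenspaceAt A μ).isClosed_topologicalClosure.completeSpace_coe
  (eigenspaceAt A μ).topologicalClosure.starProjection

/-- `f(A) = ∑_μ f(μ) P_μ`, the sum over the eigenvalues `μ` of `A` with spectral projections `P_μ`,
for a self-adjoint operator `A` whose eigenvectors span a dense subspace (e.g. one of compact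
resolvent); the domain is the set of `x` for which `∑_μ f(μ) P_μ x` converges. -/
noncomputable def spectralFunction (A : H →ₗ.[ℂ] H) (f : ℝ → ℝ) : H →ₗ.[ℂ] H where
  domain :=
    { carrier := {x | Summable fun μ : ℝ => (f μ : ℂ) • spectralProj A μ x}
      add_mem' := by
        intro x y hx hy
        simpa [smul_add] using hx.add hy
      zero_mem' := by simp
      smul_mem' := by
        intro c x hx
        simpa [smul_comm _ c] using hx.const_smul c }
  toFun :=
    { toFun := fun x => ∑' μ : ℝ, (f μ : ℂ) • spectralProj A μ (x : H)
      map_add' := by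
        intro x y
        simpa [smul_add] using x.2.tsum_add y.2
      map_smul' := by
        intro c x
        simpa [smul_comm _ c] using x.2.tsum_const_smul c }

/-- Trace class: `∑ ⟨|T| e_i, e_i⟩ < ∞` for one (equivalently, every) orthonormal basis `(e_i)`,
where `|T| = (T* T)^{1/2}`. -/
def IsTraceClass (T : H →L[ℂ] H) : Prop :=
  ∃ (ι : Type u) (e : HilbertBasis ι ℂ H),
    Summable fun i => (inner ℂ (e i) (CFC.abs T (e i))).re

/-- `C = E[X ⊗ X*]`, where `(X ⊗ X*) y = ⟨y, X⟩ X`; the expectation is a Bochner integral in the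
Banach space of bounded operators. -/
def HasCovarianceOperator {Ω : Type*} [MeasurableSpace Ω] (X : Ω → H) (P : Measure Ω)
    (C : H →L[ℂ] H) : Prop :=
  Integrable (fun w => InnerProductSpace.rankOne ℂ (X w) (X w)) P ∧
    ∫ w, InnerProductSpace.rankOne ℂ (X w) (X w) ∂P = C

end OperatorTheory

/-! ### Eigenbases and Gaussian coefficients -/

/-- `(u_j)` is an orthonormal basis of `H_phys` of eigenvectors of `L_Mx`, with
`L_Mx u_j = λ_j u_j`. -/
def IsMaxwellEigenbasis {L a : ℝ} (u : HilbertBasis ℕ ℂ (Hphys L a)) (lam : ℕ → ℝ) : Prop :=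
  ∀ j, ∃ h : u j ∈ (LMx L a).domain, LMx L a ⟨u j, h⟩ = (lam j : ℂ) • u j

/-- The coefficients of a cylindrical white noise: a jointly Gaussian sequence of centered
complex random variables with `E[ξ_i conj ξ_j] = δ_ij`.  This comprises the circular complex
Gaussians, for which `E[ξ_i ξ_j] = 0` in addition, and the real standard Gaussians. -/
structure IsWhiteNoise {Ω : Type*} [MeasurableSpace Ω] (P : Measure Ω) (ξ : ℕ → Ω → ℂ) :
    Prop where
  gaussian : IsGaussianProcess ξ P
  centered : ∀ i, ∫ w, ξ i w ∂P = 0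
  covariance : ∀ i j, ∫ w, ξ i w * star (ξ j w) ∂P = if i = j then 1 else 0

/-- The `j`-th term `(ħc/g)^{1/2} λ_j^{3/4} e^{-τ λ_j / 2} ξ_j u_j` of the source. -/
noncomputable def sourceTerm {L a : ℝ} {Ω : Type*} (hbar c g τ : ℝ)
    (u : HilbertBasis ℕ ℂ (Hphys L a)) (lam : ℕ → ℝ) (ξ : ℕ → Ω → ℂ) (j : ℕ) (w : Ω) : Hphys L a :=
  (((hbar * c / g) ^ (1 / 2 : ℝ) * lam j ^ (3 / 4 : ℝ) * Real.exp (-τ * lam j / 2) : ℝ) : ℂ) •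
    ξ j w • u j

/-! The Maxwell operator is diagonalized by hand, and the probabilistic statements are then limits
of finite-dimensional ones.

Let S and C be a lateral plane wave times sin(k₂z) and cos(k₂z). The fields (v₀S, v₁S, v₂C) have
vanishing tangential trace; the curl maps them to fields (w₀C, w₁C, w₂S) and back, and for
transverse amplitudes the double curl is multiplication by |k|². Such a field is an eigenvector of
the form operator because curls of functions in V_phys can be integrated by parts against any smooth
periodic field (`inner_curlPhys`): the boundary condition of the test field is enough.

Completeness (`eq_zero_of_forall_cavityMode`) has three ingredients. Without transversality the
fields are total, since reflection in a plate doubles the slab to a torus, whose characters split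
into even cosine and odd sine waves (`eq_zero_of_forall_electricMode`). The longitudinal amplitude
belongs to the gradient of S, and every divergence-free field is orthogonal to it. This gradient is
not that of a compactly supported function, so a cutoff is needed, and it works because S vanishes
linearly at the plates (`IsDivFree.inner_grad_sinWave`). Finally, for k₂ = 0 only the vertical
amplitude survives, and for k = 0 it gives h₀, which H_phys excludes. The eigenvalues |k|² are
positive and, by comparison with geometric series, have a finite heat trace.

An arbitrary eigenbasis is compared with the explicit one. The operator is symmetric, so
eigenvectors of distinct eigenvalues are orthogonal, and a Parseval double sum shows that the sum of
f(λ_j) over an eigenbasis does not depend on the basis (`IsSymmetricPMap.tsum_eigenvalues_eq`).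
Summability thus transfers; positivity does because every eigenvalue occurs in the explicit basis.

Summability of λ_j^{3/4} e^{-τλ_j/2} makes the series absolutely convergent in L²(Ω; H_phys).
Covariance and circularity are expectations of bounded bilinear maps, the mean and the
characteristic functional expectations of Lipschitz maps; both kinds pass to L² limits
(`tendsto_integral_bilin`, `tendsto_integral_lipschitz`). The limit covariance is diagonal in the
eigenbasis, and `IsSymmetricPMap.spectralFunction_eq` identifies it with the spectral expression. -/

/-! ### Symmetric operators with an orthonormal eigenbasis -/

section OperatorTheory

variable {H : Type*} [NormedAddCommGroup H] [InnerProductSpace ℂ H] {ι κ : Type*}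

/-- Symmetry of an unbounded operator. -/
def IsSymmetricPMap (A : H →ₗ.[ℂ] H) : Prop :=
  ∀ x y : A.domain, inner ℂ (A x) (y : H) = inner ℂ (x : H) (A y)

theorem IsSymmetricPMap.inner_eq_zero {A : H →ₗ.[ℂ] H} (hA : IsSymmetricPMap A) {μ ν : ℝ}
    (h : μ ≠ ν) {x y : H} (hx : x ∈ eigenspaceAt A μ) (hy : y ∈ eigenspaceAt A ν) :
    inner ℂ x y = 0 := by
  obtain ⟨x, rfl, hx⟩ := hx
  obtain ⟨y, rfl, hy⟩ := hy
  have := hA x y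
  rw [hx, hy, inner_smul_left, inner_smul_right, Complex.conj_ofReal, ← sub_eq_zero,
    ← sub_mul] at this
  exact (mul_eq_zero.1 this).resolve_left
    (sub_ne_zero.2 (by exact_mod_cast h))

/-- Parseval's identity for a unit vector. -/
theorem HilbertBasis.tsum_ofReal_norm_inner_sq (b : HilbertBasis ι ℂ H) {x : H} (hx : ‖x‖ = 1) :
    ∑' i, ENNReal.ofReal (‖inner ℂ (b i) x‖ ^ 2) = 1 := by
  have h' : HasSum (fun i => ‖inner ℂ (b i) x‖ ^ 2) 1 := by
    have h2 := Complex.hasSum_re (b.hasSum_inner_mul_inner x x)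
    have : (inner ℂ x x : ℂ).re = 1 := by
      have := inner_self_eq_norm_sq (𝕜 := ℂ) x
      rw [hx] at this
      simpa using this
    rw [this] at h2
    refine h2.congr_fun fun i => ?_
    have := inner_mul_symm_re_eq_norm (𝕜 := ℂ) x (b i)
    rw [norm_mul, norm_inner_symm x, ← sq] at this
    exact this.symm
  rw [← ENNReal.ofReal_tsum_of_nonneg (fun i => by positivity) h'.summable, h'.tsum_eq]
  simp

/-- Two orthonormal eigenbases give the same value to `∑ f(λ_j)`. -/
theorem IsSymmetricPMap.tsum_eigenvalues_eq [CompleteSpace H] {A : H →ₗ.[ℂ] H}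
    (hA : IsSymmetricPMap A)
    (u : HilbertBasis ι ℂ H) (v : HilbertBasis κ ℂ H) {lam : ι → ℝ} {mu : κ → ℝ}
    (hu : ∀ j, u j ∈ eigenspaceAt A (lam j)) (hv : ∀ k, v k ∈ eigenspaceAt A (mu k))
    (f : ℝ → ENNReal) : ∑' j, f (lam j) = ∑' k, f (mu k) := by
  calc ∑' j, f (lam j)
      = ∑' j, ∑' k, f (lam j) * ENNReal.ofReal (‖inner ℂ (v k) (u j)‖ ^ 2) := by
        refine tsum_congr fun j => ?_
        rw [ENNReal.tsum_mul_left, v.tsum_ofReal_norm_inner_sq (u.orthonormal.1 j), mul_one]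
    -- The weight |⟨v_k, u_j⟩|² is zero unless `lam j = mu k`, so f may be evaluated at either
    -- eigenvalue. In `ENNReal` the sums can then be exchanged freely.
    _ = ∑' j, ∑' k, f (mu k) * ENNReal.ofReal (‖inner ℂ (u j) (v k)‖ ^ 2) := by
        refine tsum_congr fun j => tsum_congr fun k => ?_
        by_cases h : lam j = mu k
        · rw [h, norm_inner_symm]
        · rw [hA.inner_eq_zero h (hu j) (hv k), hA.inner_eq_zero (Ne.symm h) (hv k) (hu j)]
          simp
    _ = ∑' k, ∑' j, f (mu k) * ENNReal.ofReal (‖inner ℂ (u j) (v k)‖ ^ 2) := ENNReal.tsum_comm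
    _ = ∑' k, f (mu k) := by
        refine tsum_congr fun k => ?_
        rw [ENNReal.tsum_mul_left, u.tsum_ofReal_norm_inner_sq (v.orthonormal.1 k), mul_one]

/-- The eigenvalue of any eigenvector occurs in each orthonormal eigenbasis. -/
theorem IsSymmetricPMap.exists_eigenvalue_eq {A : H →ₗ.[ℂ] H}
    (hA : IsSymmetricPMap A) (v : HilbertBasis κ ℂ H) {mu : κ → ℝ}
    (hv : ∀ k, v k ∈ eigenspaceAt A (mu k)) {x : H} (hx : x ≠ 0) {μ : ℝ}
    (hxμ : x ∈ eigenspaceAt A μ) : ∃ k, mu k = μ := by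
  by_contra! h
  refine hx (v.repr.injective ?_)
  rw [map_zero]
  ext k
  rw [v.repr_apply_apply, hA.inner_eq_zero (h k) (hv k) hxμ]
  rfl

theorem HilbertBasis.clm_ext {F : Type*} [NormedAddCommGroup F] [NormedSpace ℂ F]
    (u : HilbertBasis ι ℂ H) {S T : H →L[ℂ] F} (h : ∀ j, S (u j) = T (u j)) : S = T := by
  refine ContinuousLinearMap.ext_on
    ((Submodule.dense_iff_topologicalClosure_eq_top).2 u.dense_span) ?_
  rintro _ ⟨j, rfl⟩
  exact h j

theorem hasSum_clm_apply {F : ι → H →L[ℂ] H} {T : H →L[ℂ] H} (h : HasSum F T) (x : H) :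
    HasSum (fun i => F i x) (T x) :=
  (ContinuousLinearMap.apply ℂ H x).hasSum h

variable [CompleteSpace H]

theorem spectralProj_apply_self {A : H →ₗ.[ℂ] H} {μ : ℝ} {x : H} (hx : x ∈ eigenspaceAt A μ) :
    spectralProj A μ x = x := by
  have : CompleteSpace (eigenspaceAt A μ).topologicalClosure :=
    (eigenspaceAt A μ).isClosed_topologicalClosure.completeSpace_coe
  exact Submodule.starProjection_eq_self_iff.2 ((eigenspaceAt A μ).le_topologicalClosure hx)

theorem IsSymmetricPMap.spectralProj_apply_of_ne {A : H →ₗ.[ℂ] H} (hA : IsSymmetricPMap A)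
    {μ ν : ℝ} (h : μ ≠ ν) {x : H} (hx : x ∈ eigenspaceAt A ν) : spectralProj A μ x = 0 := by
  have : CompleteSpace (eigenspaceAt A μ).topologicalClosure :=
    (eigenspaceAt A μ).isClosed_topologicalClosure.completeSpace_coe
  refine (Submodule.starProjection_apply_eq_zero_iff _).2 ?_
  rw [Submodule.orthogonal_closure]
  exact fun y hy => hA.inner_eq_zero h hy hx

theorem norm_spectralProj_le (A : H →ₗ.[ℂ] H) (μ : ℝ) : ‖spectralProj A μ‖ ≤ 1 := by
  have : CompleteSpace (eigenspaceAt A μ).topologicalClosure :=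
    (eigenspaceAt A μ).isClosed_topologicalClosure.completeSpace_coe
  exact Submodule.starProjection_norm_le _

/-- The index set is all of ℝ, but the projections vanish off the range of `lam` and have norm at
most 1. Picking one index per eigenvalue by `rangeSplitting` bounds the operator norms by a
subfamily of |f(λ_j)|, whatever the multiplicities. -/
theorem IsSymmetricPMap.summable_spectralProj {A : H →ₗ.[ℂ] H} (hA : IsSymmetricPMap A)
    (u : HilbertBasis ι ℂ H) {lam : ι → ℝ} (hu : ∀ j, u j ∈ eigenspaceAt A (lam j)) {f : ℝ → ℝ}
    (hf : Summable fun j => f (lam j)) :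
    Summable fun μ : ℝ => (f μ : ℂ) • spectralProj A μ := by
  have hzero : ∀ μ, μ ∉ Set.range lam → spectralProj A μ = 0 := by
    intro μ hμ
    refine u.clm_ext fun j => ?_
    rw [hA.spectralProj_apply_of_ne (fun h => hμ ⟨j, h.symm⟩) (hu j), zero_apply]
  refine Summable.of_norm ?_
  have h1 : Summable fun μ : Set.range lam => |f μ| := by
    have := hf.abs.comp_injective (Set.rangeSplitting_injective lam)
    refine this.congr fun μ => ?_
    simp [Set.apply_rangeSplitting]
  have h2 : Summable ((Set.range lam).indicator fun μ => |f μ|) :=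
    summable_subtype_iff_indicator.1 h1
  refine h2.of_nonneg_of_le (fun _ => norm_nonneg _) fun μ => ?_
  by_cases hμ : μ ∈ Set.range lam
  · rw [Set.indicator_of_mem hμ, norm_smul, Complex.norm_real, Real.norm_eq_abs]
    exact mul_le_of_le_one_right (abs_nonneg _) (norm_spectralProj_le A μ)
  · rw [Set.indicator_of_notMem hμ, hzero μ hμ, smul_zero, norm_zero]

/-- The sum converges in operator norm, so its limit and T are bounded operators that need comparing
only on the basis. At u_j the single term μ = λ_j survives. -/
theorem IsSymmetricPMap.hasSum_spectralProj {A : H →ₗ.[ℂ] H} (hA : IsSymmetricPMap A)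
    (u : HilbertBasis ι ℂ H) {lam : ι → ℝ} (hu : ∀ j, u j ∈ eigenspaceAt A (lam j)) {f : ℝ → ℝ}
    (hf : Summable fun j => f (lam j)) {T : H →L[ℂ] H}
    (hT : ∀ j, T (u j) = (f (lam j) : ℂ) • u j) (x : H) :
    HasSum (fun μ : ℝ => (f μ : ℂ) • spectralProj A μ x) (T x) := by
  have hsum := hA.summable_spectralProj u hu hf
  have hTeq : ∑' μ : ℝ, (f μ : ℂ) • spectralProj A μ = T := by
    refine u.clm_ext fun j => ?_
    rw [← (hasSum_clm_apply hsum.hasSum (u j)).tsum_eq, hT, tsum_eq_single (lam j)]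
    · rw [smul_apply, spectralProj_apply_self (hu j)]
    intro μ hμ
    rw [smul_apply, hA.spectralProj_apply_of_ne hμ (hu j), smul_zero]
  rw [← hTeq]
  exact hasSum_clm_apply hsum.hasSum x

/-- The functional calculus of a symmetric operator with an orthonormal eigenbasis, when the values
`f(λ_j)` are summable. -/
theorem IsSymmetricPMap.spectralFunction_eq {A : H →ₗ.[ℂ] H} (hA : IsSymmetricPMap A)
    (u : HilbertBasis ι ℂ H) {lam : ι → ℝ} (hu : ∀ j, u j ∈ eigenspaceAt A (lam j)) {f : ℝ → ℝ}
    (hf : Summable fun j => f (lam j)) {T : H →L[ℂ] H}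
    (hT : ∀ j, T (u j) = (f (lam j) : ℂ) • u j) :
    spectralFunction A f = (T : H →ₗ[ℂ] H).toPMap ⊤ := by
  have happ := hA.hasSum_spectralProj u hu hf hT
  refine LinearPMap.ext ?_ ?_
  · ext x
    exact ⟨fun _ => trivial, fun _ => (happ x).summable⟩
  · intro x hx hx'
    exact (happ x).tsum_eq

/-- Positivity gives |T| = T, so u itself serves as the witnessing basis and the diagonal entries
are the c_j. -/
theorem isTraceClass_of_diagonal {H : Type} [NormedAddCommGroup H] [InnerProductSpace ℂ H]
    [CompleteSpace H] {ι : Type} (u : HilbertBasis ι ℂ H) {T : H →L[ℂ] H} (hT : T.IsPositive)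
    {c : ι → ℝ} (hc : Summable c) (h : ∀ j, T (u j) = (c j : ℂ) • u j) : IsTraceClass T := by
  refine ⟨ι, u, ?_⟩
  rw [CFC.abs_of_nonneg T ((ContinuousLinearMap.nonneg_iff_isPositive T).2 hT)]
  refine hc.congr fun j => ?_
  rw [h, inner_smul_right, inner_self_eq_norm_sq_to_K, u.orthonormal.1 j]
  simp

end OperatorTheory

/-! ### Passage to the limit in L² of random variables -/

section L2Limits

variable {Ω : Type*} [MeasurableSpace Ω] {P : Measure Ω}

/-- Integrals of a bounded bilinear map pass to the limit under `L²` convergence. -/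
theorem tendsto_integral_bilin {E F G : Type*} [NormedAddCommGroup E] [NormedSpace ℝ E]
    [NormedAddCommGroup F] [NormedSpace ℝ F] [NormedAddCommGroup G] [NormedSpace ℝ G]
    [CompleteSpace G] (B : E →L[ℝ] F →L[ℝ] G) {X : ℕ → Ω → E} {X' : Ω → E} {Y : ℕ → Ω → F}
    {Y' : Ω → F} (hX : ∀ n, MemLp (X n) 2 P) (hX' : MemLp X' 2 P) (hY : ∀ n, MemLp (Y n) 2 P)
    (hY' : MemLp Y' 2 P)
    (hXl : Tendsto (fun n => eLpNorm (fun w => X n w - X' w) 2 P) atTop (𝓝 0))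
    (hYl : Tendsto (fun n => eLpNorm (fun w => Y n w - Y' w) 2 P) atTop (𝓝 0)) :
    Tendsto (fun n => ∫ w, B (X n w) (Y n w) ∂P) atTop (𝓝 (∫ w, B (X' w) (Y' w) ∂P)) := by
  have h1 : Tendsto (fun n => (hX n).toLp (X n)) atTop (𝓝 (hX'.toLp X')) :=
    (Lp.tendsto_Lp_iff_tendsto_eLpNorm'' X hX X' hX').2 hXl
  have h2 : Tendsto (fun n => (hY n).toLp (Y n)) atTop (𝓝 (hY'.toLp Y')) :=
    (Lp.tendsto_Lp_iff_tendsto_eLpNorm'' Y hY Y' hY').2 hYl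
  have key : ∀ {x : Ω → E} {y : Ω → F} (hx : MemLp x 2 P) (hy : MemLp y 2 P),
      B.lpPairing P 2 2 (hx.toLp x) (hy.toLp y) = ∫ w, B (x w) (y w) ∂P := by
    intro x y hx hy
    rw [B.lpPairing_eq_integral]
    refine integral_congr_ae ?_
    filter_upwards [hx.coeFn_toLp, hy.coeFn_toLp] with w h1 h2
    rw [h1, h2]
  have hc : Continuous fun p : Lp E 2 P × Lp F 2 P => B.lpPairing P 2 2 p.1 p.2 := by fun_prop
  have := (hc.tendsto (hX'.toLp X', hY'.toLp Y')).comp (h1.prodMk_nhds h2)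
  simpa only [Function.comp_def, key] using this

theorem integrable_bilin {E F G : Type*} [NormedAddCommGroup E] [NormedSpace ℝ E]
    [NormedAddCommGroup F] [NormedSpace ℝ F] [NormedAddCommGroup G] [NormedSpace ℝ G]
    (B : E →L[ℝ] F →L[ℝ] G) {X : Ω → E} {Y : Ω → F}
    (hX : MemLp X 2 P) (hY : MemLp Y 2 P) : Integrable (fun w => B (X w) (Y w)) P := by
  exact memLp_one_iff_integrable.1 (B.memLp_of_bilin 1 hX hY)

/-- Integrals of a Lipschitz function pass to the limit under `L²` convergence. -/
theorem tendsto_integral_lipschitz [IsProbabilityMeasure P] {E G : Type*} [NormedAddCommGroup E]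
    [NormedAddCommGroup G] [NormedSpace ℝ G] {φ : E → G} {K : ℝ}
    (hφ : ∀ x y, ‖φ x - φ y‖ ≤ K * ‖x - y‖) {X : ℕ → Ω → E} {X' : Ω → E}
    (hX : ∀ n, MemLp (X n) 2 P) (hX' : MemLp X' 2 P)
    (hXl : Tendsto (fun n => eLpNorm (fun w => X n w - X' w) 2 P) atTop (𝓝 0)) :
    Tendsto (fun n => ∫ w, φ (X n w) ∂P) atTop (𝓝 (∫ w, φ (X' w) ∂P)) := by
  have hc : Continuous φ := by
    refine (LipschitzWith.of_dist_le' (K := K) fun x y => ?_).continuous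
    simpa [dist_eq_norm] using hφ x y
  have hint : ∀ x : Ω → E, MemLp x 2 P → Integrable (fun w => φ (x w)) P := by
    intro x hx
    have h1 : Integrable (fun w => K * ‖x w - 0‖ + ‖φ 0‖) P := by
      simp only [sub_zero]
      exact ((hx.integrable (by norm_num)).norm.const_mul K).add (integrable_const _)
    refine h1.mono' (hc.comp_aestronglyMeasurable hx.1) (Eventually.of_forall fun w => ?_)
    have := norm_le_norm_add_norm_sub' (φ (x w)) (φ 0)
    linarith [hφ (x w) 0]
  refine tendsto_integral_of_L1' _ (hint _ hX').1 (Eventually.of_forall fun n => hint _ (hX n)) ?_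
  -- On a probability space the L¹ norm is at most the L² norm, so the Lipschitz bound turns L²
  -- convergence of X into L¹ convergence of φ(X).
  have hb : ∀ n, eLpNorm ((fun w => φ (X n w)) - fun w => φ (X' w)) 1 P ≤
      ENNReal.ofReal K * eLpNorm (fun w => X n w - X' w) 2 P := by
    intro n
    refine (eLpNorm_le_mul_eLpNorm_of_ae_le_mul (g := fun w => X n w - X' w) (c := K)
      (Eventually.of_forall fun w => hφ _ _) 1).trans ?_
    gcongr
    exact eLpNorm_le_eLpNorm_of_exponent_le (by norm_num) ((hX n).1.sub hX'.1)
  refine tendsto_of_tendsto_of_tendsto_of_le_of_le tendsto_const_nhds ?_ (fun _ => zero_le) hb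
  simpa using ENNReal.Tendsto.const_mul hXl (Or.inr ENNReal.ofReal_ne_top)

/-- An `L²` limit of Gaussian random variables is Gaussian. -/
theorem hasGaussianLaw_of_tendsto [IsProbabilityMeasure P] {E : Type*} [NormedAddCommGroup E]
    [NormedSpace ℝ E] [MeasurableSpace E] [BorelSpace E] {X : ℕ → Ω → E} {X' : Ω → E}
    (hG : ∀ n, HasGaussianLaw (X n) P)
    (hX : ∀ n, MemLp (X n) 2 P) (hX' : MemLp X' 2 P)
    (hXl : Tendsto (fun n => eLpNorm (fun w => X n w - X' w) 2 P) atTop (𝓝 0)) :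
    HasGaussianLaw X' P := by
  have hm' : AEMeasurable X' P := hX'.1.aemeasurable
  -- For each real functional L the law must have characteristic functional exp(i·mean −
  -- variance/2). Mean, second moment and characteristic functional all converge, so the identity
  -- for X n passes to the limit.
  refine (hasGaussianLaw_iff_charFunDual_map_eq hm').2 fun L => ?_
  have hchar : ∀ {x : Ω → E}, AEMeasurable x P →
      charFunDual (P.map x) L = ∫ w, Complex.exp (L (x w) * Complex.I) ∂P := by
    intro x hx
    rw [charFunDual_apply, integral_map hx]
    exact Continuous.aestronglyMeasurable (by fun_prop)
  have hL2 : ∀ {x : Ω → E}, MemLp x 2 P → MemLp (L ∘ x) 2 P := fun hx => L.comp_memLp' hx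
  have hvar : ∀ {x : Ω → E}, MemLp x 2 P →
      Var[L ∘ x; P] = ∫ w, L (x w) * L (x w) ∂P - (∫ w, L (x w) ∂P) ^ 2 := by
    intro x hx
    rw [variance_eq_sub (hL2 hx)]
    simp [sq]
  have hmean : Tendsto (fun n => ∫ w, L (X n w) ∂P) atTop (𝓝 (∫ w, L (X' w) ∂P)) :=
    tendsto_integral_lipschitz (fun x y => by rw [← map_sub]; exact L.le_opNorm _) hX hX' hXl
  have hsq : Tendsto (fun n => ∫ w, L (X n w) * L (X n w) ∂P) atTop
      (𝓝 (∫ w, L (X' w) * L (X' w) ∂P)) :=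
    tendsto_integral_bilin ((ContinuousLinearMap.mul ℝ ℝ).bilinearComp L L) hX hX' hX hX' hXl hXl
  have hexp : Tendsto (fun n => ∫ w, Complex.exp (L (X n w) * Complex.I) ∂P) atTop
      (𝓝 (∫ w, Complex.exp (L (X' w) * Complex.I) ∂P)) := by
    -- The map x ↦ e^{iL(x)} has Lipschitz constant ‖L‖, since |e^{it} − 1| ≤ |t|.
    refine tendsto_integral_lipschitz (φ := fun x => Complex.exp (L x * Complex.I)) (K := ‖L‖)
      (fun x y => ?_) hX hX' hXl
    refine le_trans ?_ (L.le_opNorm (x - y))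
    have h1 : Complex.exp (L x * Complex.I) - Complex.exp (L y * Complex.I) =
        Complex.exp (L y * Complex.I) * (Complex.exp (Complex.I * (L (x - y) : ℝ)) - 1) := by
      rw [mul_sub, ← Complex.exp_add, map_sub]
      push_cast
      ring_nf
    rw [h1, norm_mul, Complex.norm_exp_ofReal_mul_I, one_mul]
    exact Real.norm_exp_I_mul_ofReal_sub_one_le
  rw [hchar hm', hvar hX']
  refine tendsto_nhds_unique hexp ?_
  have hlim : Tendsto (fun n => Complex.exp (((∫ w, L (X n w) ∂P : ℝ) : ℂ) * Complex.I -
      ((∫ w, L (X n w) * L (X n w) ∂P - (∫ w, L (X n w) ∂P) ^ 2 : ℝ) : ℂ) / 2)) atTop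
      (𝓝 (Complex.exp (((∫ w, L (X' w) ∂P : ℝ) : ℂ) * Complex.I -
      ((∫ w, L (X' w) * L (X' w) ∂P - (∫ w, L (X' w) ∂P) ^ 2 : ℝ) : ℂ) / 2))) := by
    refine (Complex.continuous_exp.tendsto _).comp ?_
    refine Tendsto.sub (Tendsto.mul_const _ ?_) (Tendsto.div_const ?_ _)
    · exact (Complex.continuous_ofReal.tendsto _).comp hmean
    · exact (Complex.continuous_ofReal.tendsto _).comp (hsq.sub (hmean.pow 2))
  refine hlim.congr fun n => ?_
  rw [← hchar (hX n).1.aemeasurable, (hG n).charFunDual_map_eq, hvar (hX n)]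
  rfl

end L2Limits

/-! ### Random series with Gaussian coefficients -/

section GaussianSeries

variable {Ω : Type*} [MeasurableSpace Ω] {P : Measure Ω} {ξ : ℕ → Ω → ℂ}

theorem IsWhiteNoise.memLp (hξ : IsWhiteNoise P ξ) (j : ℕ) : MemLp (ξ j) 2 P :=
  (hξ.gaussian.hasGaussianLaw_eval j).memLp_two

theorem IsWhiteNoise.eLpNorm_eq_one (hξ : IsWhiteNoise P ξ) (j : ℕ) : eLpNorm (ξ j) 2 P = 1 := by
  have h1 : (inner ℂ ((hξ.memLp j).toLp (ξ j)) ((hξ.memLp j).toLp (ξ j)) : ℂ) = 1 := by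
    rw [L2.inner_def]
    have := hξ.covariance j j
    rw [if_pos rfl] at this
    rw [← this]
    refine integral_congr_ae ?_
    filter_upwards [(hξ.memLp j).coeFn_toLp] with w hw
    rw [hw]
    rfl
  rw [inner_self_eq_norm_sq_to_K, Lp.norm_toLp] at h1
  have h2 : (eLpNorm (ξ j) 2 P).toReal ^ 2 = 1 := Complex.ofReal_injective (by simpa using h1)
  have h3 : (eLpNorm (ξ j) 2 P).toReal = 1 :=
    (pow_eq_one_iff_of_nonneg ENNReal.toReal_nonneg two_ne_zero).1 h2
  rw [← ENNReal.ofReal_toReal (hξ.memLp j).2.ne, h3, ENNReal.ofReal_one]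

/-- The term `c_j ξ_j u_j` of a random series. -/
noncomputable def randomTerm {H : Type*} [NormedAddCommGroup H] [InnerProductSpace ℂ H]
    (c : ℕ → ℝ) (ξ : ℕ → Ω → ℂ) (u : ℕ → H) (j : ℕ) (w : Ω) : H :=
  (c j : ℂ) • ξ j w • u j

variable {H : Type*} [NormedAddCommGroup H] [InnerProductSpace ℂ H] {c : ℕ → ℝ} {u : ℕ → H}

theorem memLp_randomTerm (hξ : IsWhiteNoise P ξ) (j : ℕ) : MemLp (randomTerm c ξ u j) 2 P :=
  ((ContinuousLinearMap.toSpanSingleton ℂ (u j)).comp_memLp' (hξ.memLp j)).const_smul (c j : ℂ)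

theorem norm_toLp_randomTerm_le (hξ : IsWhiteNoise P ξ) (hu : ∀ j, ‖u j‖ = 1) (j : ℕ) :
    ‖(memLp_randomTerm (c := c) (u := u) hξ j).toLp (randomTerm c ξ u j)‖ ≤ |c j| := by
  rw [Lp.norm_toLp]
  have h := eLpNorm_le_mul_eLpNorm_of_ae_le_mul (μ := P) (f := randomTerm c ξ u j) (g := ξ j)
    (c := |c j|) (Eventually.of_forall fun w => by
      simp [randomTerm, norm_smul, hu]) 2
  rw [hξ.eLpNorm_eq_one, mul_one] at h
  exact ENNReal.toReal_le_of_le_ofReal (abs_nonneg _) h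

/-- Each term has L² norm at most |c_j|, so the series converges absolutely in the Banach space
L²(Ω; H). Orthogonality of the u_j would allow square-summable c, but the rapidly decaying
coefficients make this refinement unnecessary. -/
theorem exists_sum_randomTerm [CompleteSpace H] (hξ : IsWhiteNoise P ξ) (hu : ∀ j, ‖u j‖ = 1)
    (hc : Summable fun j => |c j|) :
    ∃ S : Ω → H, MemLp S 2 P ∧ Tendsto
      (fun N : ℕ => eLpNorm (fun w => (∑ j ∈ Finset.range N, randomTerm c ξ u j w) - S w) 2 P)
      atTop (𝓝 0) := by
  have hs : Summable fun j => (memLp_randomTerm (c := c) (u := u) hξ j).toLp :=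
    Summable.of_norm (hc.of_nonneg_of_le (fun _ => norm_nonneg _)
      (norm_toLp_randomTerm_le hξ hu))
  refine ⟨_, Lp.memLp (∑' j, (memLp_randomTerm (c := c) (u := u) hξ j).toLp), ?_⟩
  refine ((Lp.tendsto_Lp_iff_tendsto_eLpNorm' _ _).1 hs.hasSum.tendsto_sum_nat).congr fun N => ?_
  refine eLpNorm_congr_ae ?_
  have h1 : ∀ᵐ w ∂P, ∀ j,
      (memLp_randomTerm (c := c) (u := u) hξ j).toLp (randomTerm c ξ u j) w = randomTerm c ξ u j w :=
    ae_all_iff.2 fun j => MemLp.coeFn_toLp _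
  filter_upwards [h1, Lp.coeFn_finsetSum (Finset.range N)
    fun j => (memLp_randomTerm (c := c) (u := u) hξ j).toLp] with w hw hw'
  rw [Pi.sub_apply, hw']
  simp [hw]

theorem memLp_sum_randomTerm (hξ : IsWhiteNoise P ξ) (N : ℕ) :
    MemLp (fun w => ∑ j ∈ Finset.range N, randomTerm c ξ u j w) 2 P :=
  memLp_finsetSum _ fun j _ => memLp_randomTerm hξ j

theorem integral_bilin_sum {G : Type*} [NormedAddCommGroup G] [NormedSpace ℝ G]
    (B : H →L[ℝ] H →L[ℝ] G) (hξ : IsWhiteNoise P ξ) (N : ℕ) :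
    ∫ w, B (∑ j ∈ Finset.range N, randomTerm c ξ u j w)
      (∑ j ∈ Finset.range N, randomTerm c ξ u j w) ∂P =
    ∑ i ∈ Finset.range N, ∑ j ∈ Finset.range N,
      ∫ w, B (randomTerm c ξ u i w) (randomTerm c ξ u j w) ∂P := by
  have hint : ∀ i j, Integrable (fun w => B (randomTerm c ξ u i w) (randomTerm c ξ u j w)) P :=
    fun i j => integrable_bilin B (memLp_randomTerm hξ i) (memLp_randomTerm hξ j)
  simp only [map_sum, sum_apply]
  rw [Finset.sum_comm, integral_finsetSum _ fun i _ => integrable_finsetSum _ fun j _ => hint j i]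
  exact Finset.sum_congr rfl fun i _ => integral_finsetSum _ fun j _ => hint j i

/-- `E[⟨x, S⟩ ⟨y, S⟩] = 0` for the sum `S` of a series with circular coefficients. -/
theorem circular_of_tendsto (hξ : IsWhiteNoise P ξ) {S : Ω → H} (hS : MemLp S 2 P)
    (hl : Tendsto (fun N : ℕ =>
      eLpNorm (fun w => (∑ j ∈ Finset.range N, randomTerm c ξ u j w) - S w) 2 P) atTop (𝓝 0))
    (h0 : ∀ i j, ∫ w, ξ i w * ξ j w ∂P = 0) (x y : H) :
    ∫ w, inner ℂ x (S w) * inner ℂ y (S w) ∂P = 0 := by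
  -- Both pairings are linear in S without conjugation, so the expectation involves E[ξ_i ξ_j]
  -- rather than E[ξ_i conj ξ_j].
  let B : H →L[ℝ] H →L[ℝ] ℂ := (ContinuousLinearMap.mul ℝ ℂ).bilinearComp
    ((innerSL ℂ x).restrictScalars ℝ) ((innerSL ℂ y).restrictScalars ℝ)
  have h1 := tendsto_integral_bilin B (memLp_sum_randomTerm hξ) hS (memLp_sum_randomTerm hξ) hS
    hl hl
  refine tendsto_nhds_unique h1 (tendsto_const_nhds.congr fun N => ?_)
  rw [integral_bilin_sum B hξ]
  refine (Finset.sum_eq_zero fun i _ => Finset.sum_eq_zero fun j _ => ?_).symm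
  have h2 : ∀ w, B (randomTerm c ξ u i w) (randomTerm c ξ u j w) =
      (c i * c j * inner ℂ x (u i) * inner ℂ y (u j)) * (ξ i w * ξ j w) := by
    intro w
    simp only [B, randomTerm, ContinuousLinearMap.bilinearComp_apply,
      ContinuousLinearMap.coe_restrictScalars', innerSL_apply_apply, inner_smul_right,
      ContinuousLinearMap.mul_apply']
    ring
  simp only [h2, integral_const_mul, h0, mul_zero]

/-- `x ↦ y ↦ x ⊗ y*` as a real bilinear map. -/
noncomputable def rankOneReal (H : Type*) [NormedAddCommGroup H] [InnerProductSpace ℂ H] :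
    H →L[ℝ] H →L[ℝ] H →L[ℂ] H :=
  -- Conjugate-linearity in y rules out a complex bilinear map; over ℝ the conjugation is invisible.
  (LinearMap.mk₂ ℝ (fun x y : H => InnerProductSpace.rankOne ℂ x y)
    (fun x x' y => by rw [map_add, add_apply]) (fun r x y => by
      rw [← Complex.coe_smul r x, map_smul, smul_apply, Complex.coe_smul])
    (fun x y y' => by rw [map_add]) (fun r x y => by
      rw [← Complex.coe_smul r y, map_smulₛₗ, Complex.conj_ofReal,
        Complex.coe_smul])).mkContinuous₂ 1 (fun x y => by simp)

theorem rankOneReal_apply (x y : H) : rankOneReal H x y = InnerProductSpace.rankOne ℂ x y := rfl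

/-- The conjugate-linear slot of the rank-one operator supplies conj ξ_j, so the white-noise
covariance δ_ij removes all off-diagonal terms. No independence and no value of E[ξ_i ξ_j] is
needed. -/
theorem integral_rankOne_randomTerm [CompleteSpace H] (hξ : IsWhiteNoise P ξ) (i j : ℕ) :
    ∫ w, rankOneReal H (randomTerm c ξ u i w) (randomTerm c ξ u j w) ∂P =
      if i = j then ((c j : ℂ) ^ 2) • InnerProductSpace.rankOne ℂ (u j) (u j) else 0 := by
  have h2 : ∀ w, rankOneReal H (randomTerm c ξ u i w) (randomTerm c ξ u j w) =
      (ξ i w * star (ξ j w)) • (((c i * c j : ℂ)) • InnerProductSpace.rankOne ℂ (u i) (u j)) := by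
    intro w
    ext z
    simp [rankOneReal_apply, randomTerm, InnerProductSpace.rankOne_apply,
      smul_smul]
    ring_nf
  simp only [h2]
  rw [integral_smul_const, hξ.covariance]
  split_ifs with h
  · subst h
    rw [one_smul, sq]
  · rw [zero_smul]

/-- The covariance operator of the sum of a series. -/
theorem exists_covariance [CompleteSpace H] (b : HilbertBasis ℕ ℂ H) (hξ : IsWhiteNoise P ξ)
    {S : Ω → H} (hS : MemLp S 2 P)
    (hl : Tendsto (fun N : ℕ =>
      eLpNorm (fun w => (∑ j ∈ Finset.range N, randomTerm c ξ b j w) - S w) 2 P) atTop (𝓝 0)) :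
    ∃ C : H →L[ℂ] H, HasCovarianceOperator S P C ∧ C.IsPositive ∧
      ∀ j, C (b j) = ((c j ^ 2 : ℝ) : ℂ) • b j := by
  have h1 := tendsto_integral_bilin (rankOneReal H) (memLp_sum_randomTerm hξ) hS
    (memLp_sum_randomTerm hξ) hS hl hl
  simp only [integral_bilin_sum _ hξ, integral_rankOne_randomTerm hξ, Finset.sum_ite_eq] at h1
  have hint : Integrable (fun w => InnerProductSpace.rankOne ℂ (S w) (S w)) P :=
    integrable_bilin (rankOneReal H) hS hS
  refine ⟨∫ w, InnerProductSpace.rankOne ℂ (S w) (S w) ∂P, ⟨hint, rfl⟩, ?_, fun j => ?_⟩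
  -- Positivity comes from ⟨x, Cx⟩ = E|⟨S, x⟩|².
  · rw [ContinuousLinearMap.isPositive_iff_complex]
    intro x
    have h3 : inner ℂ x ((∫ w, InnerProductSpace.rankOne ℂ (S w) (S w) ∂P) x) =
        ((∫ w, ‖inner ℂ (S w) x‖ ^ 2 ∂P : ℝ) : ℂ) := by
      have h4 := ((innerSL ℂ x).comp (ContinuousLinearMap.apply ℂ H x)).integral_comp_comm hint
      simp only [ContinuousLinearMap.comp_apply, ContinuousLinearMap.apply_apply,
        innerSL_apply_apply] at h4
      rw [← h4, ← integral_complex_ofReal]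
      refine integral_congr_ae (Eventually.of_forall fun w => ?_)
      simp only [InnerProductSpace.rankOne_apply, inner_smul_right]
      rw [← inner_conj_symm x, RCLike.mul_conj]
      norm_cast
    rw [← inner_conj_symm, h3, Complex.conj_ofReal]
    exact ⟨by simp, by
      simpa using integral_nonneg fun w => sq_nonneg ‖inner ℂ (S w) x‖⟩
  -- Applied to `b j`, the covariances of the partial sums are constant as soon as N > j.
  · have h2 := ((ContinuousLinearMap.apply ℂ H (b j)).continuous.tendsto _).comp h1
    refine tendsto_nhds_unique h2 (tendsto_const_nhds.congr' ?_)
    filter_upwards [eventually_gt_atTop j] with N hN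
    rw [Function.comp_apply, map_sum, Finset.sum_eq_single_of_mem j (Finset.mem_range.2 hN)]
    · simp [Finset.mem_range.2 hN, InnerProductSpace.rankOne_apply, b.orthonormal.1 j]
    · intro i hi hij
      simp [Finset.mem_range.1 hi, InnerProductSpace.rankOne_apply, b.orthonormal.2 hij]

/-- The partial sum is a real-linear image of the finite vector of the ξ_j. Joint Gaussianity is
what makes that vector Gaussian. -/
theorem hasGaussianLaw_sum_randomTerm [NormedSpace ℝ H] [MeasurableSpace H] [BorelSpace H]
    (hξ : IsWhiteNoise P ξ) (N : ℕ) :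
    HasGaussianLaw (fun w => ∑ j ∈ Finset.range N, randomTerm c ξ u j w) P := by
  let T : (Finset.range N → ℂ) →L[ℝ] H := ∑ j : Finset.range N,
    ((c j : ℂ) • (ContinuousLinearMap.toSpanSingleton ℂ (u j))).restrictScalars ℝ ∘L
      ContinuousLinearMap.proj j
  have h := (hξ.gaussian.hasGaussianLaw (Finset.range N)).map T
  refine h.congr (Eventually.of_forall fun w => ?_)
  simp only [T, Function.comp_apply, sum_apply]
  rw [← Finset.sum_coe_sort (Finset.range N)]
  rfl

theorem integral_eq_zero_of_tendsto [IsProbabilityMeasure P] [CompleteSpace H] [NormedSpace ℝ H]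
    (hξ : IsWhiteNoise P ξ)
    {S : Ω → H} (hS : MemLp S 2 P) (hl : Tendsto (fun N : ℕ =>
      eLpNorm (fun w => (∑ j ∈ Finset.range N, randomTerm c ξ u j w) - S w) 2 P) atTop (𝓝 0)) :
    ∫ w, S w ∂P = 0 := by
  have h1 := tendsto_integral_lipschitz (φ := fun x : H => x) (K := 1) (by simp)
    (memLp_sum_randomTerm hξ) hS hl
  refine tendsto_nhds_unique h1 (tendsto_const_nhds.congr fun N => ?_)
  rw [integral_finsetSum _ fun j _ => (memLp_randomTerm hξ j).integrable (by norm_num)]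
  refine (Finset.sum_eq_zero fun j _ => ?_).symm
  have := (((c j : ℂ) • (ContinuousLinearMap.toSpanSingleton ℂ (u j))).restrictScalars
    ℝ).integral_comp_comm ((hξ.memLp j).integrable (by norm_num))
  rw [hξ.centered, map_zero] at this
  exact this

end GaussianSeries

/-! ### Integration by parts on the slab and the weak form of the Maxwell operator -/

section SlabCalculus

variable {L a : ℝ}

/-- This is the divergence theorem on the closed box for a field with one nonzero component.
Opposite lateral faces cancel by periodicity; only the plate direction i = 2 needs a boundary
condition. -/
theorem integral_partial_eq_zero {ψ : Pt → ℂ} (hψ : ContDiff ℝ ∞ ψ) (hp : LateralPeriodic L ψ)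
    (i : Fin 3) (hb : i = 2 → ∀ x : Pt, x 2 = 0 ∨ x 2 = a → ψ x = 0) :
    ∫ x, fderiv ℝ ψ x (Pi.single i 1) ∂(slabMeasure L a) = 0 := by
  unfold slabMeasure
  rw [setIntegral_congr_set (slab_ae_eq_Icc L a)]
  by_cases hle : (0 : Pt) ≤ ![L, L, a]
  swap
  · rw [Set.Icc_eq_empty hle]
    simp
  have hface : ∀ y : Fin 2 → ℝ, ψ (i.insertNth ((![L, L, a] : Pt) i) y) =
      ψ (i.insertNth ((0 : Pt) i) y) := by
    intro y
    have hper : ∀ k : Fin 3, (k.insertNth L y : Pt) = k.insertNth 0 y + Pi.single k L := by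
      intro k
      ext m
      refine Fin.succAboveCases k ?_ (fun m => ?_) m <;> simp
    fin_cases i
    · change ψ ((0 : Fin 3).insertNth L y) = ψ ((0 : Fin 3).insertNth 0 y)
      rw [hper, (hp _).1]
    · change ψ ((1 : Fin 3).insertNth L y) = ψ ((1 : Fin 3).insertNth 0 y)
      rw [hper, (hp _).2]
    · change ψ ((2 : Fin 3).insertNth a y) = ψ ((2 : Fin 3).insertNth 0 y)
      rw [hb rfl _ (Or.inr (Fin.insertNth_apply_same _ _ _)),
        hb rfl _ (Or.inl (Fin.insertNth_apply_same _ _ _))]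
  have hcont : Continuous fun x => fderiv ℝ ψ x (Pi.single i 1) :=
    (hψ.continuous_fderiv (by simp)).clm_apply continuous_const
  have hsum : ∀ x : Pt, ∑ k : Fin 3,
      (if k = i then fderiv ℝ ψ else 0 : Pt → Pt →L[ℝ] ℂ) x (Pi.single k 1) =
        fderiv ℝ ψ x (Pi.single i 1) := by
    intro x
    rw [Finset.sum_eq_single i]
    · simp
    · intro k _ hk
      simp [hk]
    · simp
  have key := integral_divergence_of_hasFDerivAt_off_countable' (E := ℂ) (0 : Pt) ![L, L, a] hle
    (fun k => if k = i then ψ else 0) (fun k => if k = i then fderiv ℝ ψ else 0) ∅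
    Set.countable_empty
    (fun k => by
      split_ifs
      · exact hψ.continuous.continuousOn
      · exact continuousOn_const)
    (fun x _ k => by
      split_ifs
      · exact (hψ.differentiable (by simp) x).hasFDerivAt
      · exact hasFDerivAt_const _ _)
    (by
      simp only [hsum]
      exact hcont.continuousOn.integrableOn_compact isCompact_Icc)
  simp only [hsum] at key
  rw [key]
  refine Finset.sum_eq_zero fun k _ => ?_
  by_cases hk : k = i
  · subst hk
    simp only [if_true, hface, sub_self]
  · simp [hk]

theorem integrable_of_continuous (L a : ℝ) {ψ : Pt → ℂ} (hψ : Continuous ψ) :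
    Integrable ψ (slabMeasure L a) :=
  (hψ.continuousOn.integrableOn_compact isCompact_Icc).mono_set (slab_subset_Icc L a)

theorem fderiv_star_mul {f g : Pt → ℂ} (hf : ContDiff ℝ ∞ f) (hg : ContDiff ℝ ∞ g) (x v : Pt) :
    fderiv ℝ (fun y => star (f y) * g y) x v =
      star (fderiv ℝ f x v) * g x + star (f x) * fderiv ℝ g x v := by
  have h1 : HasFDerivAt (fun y => star (f y))
      (((starL' ℝ : ℂ ≃L[ℝ] ℂ) : ℂ →L[ℝ] ℂ).comp (fderiv ℝ f x)) x :=
    ((starL' ℝ : ℂ ≃L[ℝ] ℂ) : ℂ →L[ℝ] ℂ).hasFDerivAt.comp x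
      (hf.differentiable (by simp) x).hasFDerivAt
  have h2 := (h1.mul (hg.differentiable (by simp) x).hasFDerivAt).fderiv
  change fderiv ℝ ((fun y => star (f y)) * g) x v = _
  rw [h2]
  simp
  ring

theorem contDiff_star_mul {f g : Pt → ℂ} (hf : ContDiff ℝ ∞ f) (hg : ContDiff ℝ ∞ g) :
    ContDiff ℝ ∞ fun y => star (f y) * g y :=
  (((starL' ℝ : ℂ ≃L[ℝ] ℂ) : ℂ →L[ℝ] ℂ).contDiff.comp hf).mul hg

theorem contDiff_component {φ : Pt → C3} (hφ : ContDiff ℝ ∞ φ) (j : Fin 3) :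
    ContDiff ℝ ∞ fun x => φ x j :=
  ((EuclideanSpace.proj (𝕜 := ℂ) j).restrictScalars ℝ).contDiff.comp hφ

theorem fderiv_component {φ : Pt → C3} (hφ : ContDiff ℝ ∞ φ) (i j : Fin 3) (x : Pt) :
    fderiv ℝ (fun x => φ x j) x (Pi.single i 1) = pd i j φ x := by
  have := (((EuclideanSpace.proj (𝕜 := ℂ) j).restrictScalars ℝ).hasFDerivAt.comp x
    (hφ.differentiable (by simp) x).hasFDerivAt).fderiv
  unfold pd
  change fderiv ℝ (⇑((EuclideanSpace.proj (𝕜 := ℂ) j).restrictScalars ℝ) ∘ φ) x _ = _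
  rw [this]
  rfl

theorem lateralPeriodic_component {φ : Pt → C3} (hφ : LateralPeriodic L φ) (j : Fin 3) :
    LateralPeriodic L fun x => φ x j := fun x =>
  ⟨congrArg (fun v : C3 => v j) (hφ x).1, congrArg (fun v : C3 => v j) (hφ x).2⟩

theorem LateralPeriodic.star_mul {f g : Pt → ℂ} (hf : LateralPeriodic L f)
    (hg : LateralPeriodic L g) : LateralPeriodic L fun x => star (f x) * g x := fun x => by
  simp only [(hf x).1, (hf x).2, (hg x).1, (hg x).2, and_self]

theorem inner_toL2 {φ ψ : Pt → C3} (hφ : Continuous φ) (hψ : Continuous ψ) :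
    inner ℂ (toL2 L a φ hφ) (toL2 L a ψ hψ) =
      ∫ x, ∑ j, star (φ x j) * ψ x j ∂(slabMeasure L a) := by
  rw [L2.inner_def]
  refine integral_congr_ae ?_
  filter_upwards [(memLp_of_continuous L a hφ).coeFn_toLp,
    (memLp_of_continuous L a hψ).coeFn_toLp] with x h1 h2
  unfold toL2
  rw [h1, h2, PiLp.inner_apply]
  exact Finset.sum_congr rfl fun j _ => by rw [RCLike.inner_apply, mul_comm]; rfl

/-- Integration by parts in one variable. -/
theorem integral_star_mul_partial {f g : Pt → ℂ} (hf : ContDiff ℝ ∞ f) (hg : ContDiff ℝ ∞ g)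
    (hfp : LateralPeriodic L f) (hgp : LateralPeriodic L g) (i : Fin 3)
    (hb : i = 2 → ∀ x : Pt, x 2 = 0 ∨ x 2 = a → f x = 0 ∨ g x = 0) :
    ∫ x, star (fderiv ℝ f x (Pi.single i 1)) * g x ∂(slabMeasure L a) =
      - ∫ x, star (f x) * fderiv ℝ g x (Pi.single i 1) ∂(slabMeasure L a) := by
  have hc : ∀ {f : Pt → ℂ}, ContDiff ℝ ∞ f → Continuous fun x => fderiv ℝ f x (Pi.single i 1) :=
    fun h => (h.continuous_fderiv (by simp)).clm_apply continuous_const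
  have h := integral_partial_eq_zero (a := a) (contDiff_star_mul hf hg) (hfp.star_mul hgp) i
    (fun hi x hx => by rcases hb hi x hx with h | h <;> simp [h])
  simp only [fderiv_star_mul hf hg] at h
  exact eq_neg_of_add_eq_zero_left ((integral_add
    (integrable_of_continuous L a ((hc hf).star.mul hg.continuous))
    (integrable_of_continuous L a (hf.continuous.star.mul (hc hg)))).symm.trans h)

theorem integral_sum_three_sub {α : Type*} [MeasurableSpace α] {μ : Measure α}
    {f f' g g' h h' : α → ℂ} (hf : Integrable f μ) (hf' : Integrable f' μ) (hg : Integrable g μ)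
    (hg' : Integrable g' μ) (hh : Integrable h μ) (hh' : Integrable h' μ) :
    ∫ x, ((f x - f' x) + (g x - g' x) + (h x - h' x)) ∂μ =
      (∫ x, f x ∂μ - ∫ x, f' x ∂μ) + (∫ x, g x ∂μ - ∫ x, g' x ∂μ) +
        (∫ x, h x ∂μ - ∫ x, h' x ∂μ) := by
  rw [← integral_sub' hf hf', ← integral_sub' hg hg', ← integral_sub' hh hh',
    ← integral_add' (hf.sub hf') (hg.sub hg'), ← integral_add' ((hf.sub hf').add (hg.sub hg'))
    (hh.sub hh')]
  rfl

/-- Symmetry of the curl: `∫ conj (∇ × φ) · B = ∫ conj φ · (∇ × B)` if the tangential components of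
`φ` vanish on the plates. -/
theorem inner_curl_eq {φ B : Pt → C3} (hφ : IsSmoothPEC L a φ) (hB : ContDiff ℝ ∞ B)
    (hBp : LateralPeriodic L B) :
    inner ℂ (toL2 L a (curl φ) (continuous_curl hφ.smooth)) (toL2 L a B hB.continuous) =
      inner ℂ (toL2 L a φ hφ.smooth.continuous) (toL2 L a (curl B) (continuous_curl hB)) := by
  have hint : ∀ {ψ χ : Pt → C3} (i j k : Fin 3), ContDiff ℝ ∞ ψ → ContDiff ℝ ∞ χ →
      Integrable (fun x => star (pd i j ψ x) * χ x k) (slabMeasure L a) := fun i j k h1 h2 =>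
    integrable_of_continuous L a ((continuous_pd i j h1).star.mul (contDiff_component h2 k).continuous)
  have hint' : ∀ {ψ χ : Pt → C3} (i j k : Fin 3), ContDiff ℝ ∞ ψ → ContDiff ℝ ∞ χ →
      Integrable (fun x => star (χ x k) * pd i j ψ x) (slabMeasure L a) := fun i j k h1 h2 =>
    integrable_of_continuous L a ((contDiff_component h2 k).continuous.star.mul (continuous_pd i j h1))
  -- In the curl, ∂₂ acts on the tangential components alone, and those vanish on the plates. Hence
  -- nothing is required of B there.
  have hparts : ∀ i j k : Fin 3, (i = 2 → j ≠ 2) →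
      ∫ x, star (pd i j φ x) * B x k ∂(slabMeasure L a) =
        - ∫ x, star (φ x j) * pd i k B x ∂(slabMeasure L a) := by
    intro i j k hij
    have := integral_star_mul_partial (a := a) (contDiff_component hφ.smooth j)
      (contDiff_component hB k) (lateralPeriodic_component hφ.periodic j)
      (lateralPeriodic_component hBp k) i (fun hi x hx => Or.inl (by
        have ht := hφ.tangential x hx
        have hj := hij hi
        fin_cases j
        · exact ht.1
        · exact ht.2
        · exact absurd rfl hj))
    simpa only [fderiv_component hφ.smooth, fderiv_component hB] using this
  rw [inner_toL2, inner_toL2]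
  have e1 : ∀ x, ∑ j, star (curl φ x j) * B x j =
      (star (pd 1 2 φ x) * B x 0 - star (pd 2 1 φ x) * B x 0) +
      (star (pd 2 0 φ x) * B x 1 - star (pd 0 2 φ x) * B x 1) +
      (star (pd 0 1 φ x) * B x 2 - star (pd 1 0 φ x) * B x 2) := by
    intro x
    simp [Fin.sum_univ_three, curl]
    ring
  have e2 : ∀ x, ∑ j, star (φ x j) * curl B x j =
      (star (φ x 0) * pd 1 2 B x - star (φ x 0) * pd 2 1 B x) +
      (star (φ x 1) * pd 2 0 B x - star (φ x 1) * pd 0 2 B x) +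
      (star (φ x 2) * pd 0 1 B x - star (φ x 2) * pd 1 0 B x) := by
    intro x
    simp [Fin.sum_univ_three, curl]
    ring
  simp only [e1, e2]
  have i1 := fun i j k => hint (ψ := φ) (χ := B) i j k hφ.smooth hB
  have i2 := fun i j k => hint' (ψ := B) (χ := φ) i j k hB hφ.smooth
  refine (integral_sum_three_sub (i1 1 2 0) (i1 2 1 0) (i1 2 0 1) (i1 0 2 1) (i1 0 1 2)
    (i1 1 0 2)).trans (Eq.trans ?_ (integral_sum_three_sub (i2 1 2 0) (i2 2 1 0) (i2 2 0 1)
    (i2 0 2 1) (i2 0 1 2) (i2 1 0 2)).symm)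
  rw [hparts 1 2 0 (by decide), hparts 2 1 0 (by decide), hparts 2 0 1 (by decide),
    hparts 0 2 1 (by decide), hparts 0 1 2 (by decide), hparts 1 0 2 (by decide)]
  ring

/-- A smooth periodic field of zero divergence is orthogonal to the gradients of the functions that
vanish on the plates. -/
theorem inner_grad_eq_zero {φ : Pt → ℂ} {E : Pt → C3} (hφ : ContDiff ℝ ∞ φ)
    (hφp : LateralPeriodic L φ) (hφb : ∀ x : Pt, x 2 = 0 ∨ x 2 = a → φ x = 0)
    (hE : ContDiff ℝ ∞ E) (hEp : LateralPeriodic L E)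
    (hdiv : ∀ x, pd 0 0 E x + pd 1 1 E x + pd 2 2 E x = 0) :
    inner ℂ (toL2 L a (grad φ) (continuous_grad hφ)) (toL2 L a E hE.continuous) = 0 := by
  have hc : ∀ i, Continuous fun x => fderiv ℝ φ x (Pi.single i 1) :=
    fun i => (hφ.continuous_fderiv (by simp)).clm_apply continuous_const
  have i1 : ∀ i, Integrable (fun x => star (fderiv ℝ φ x (Pi.single i 1)) * E x i)
      (slabMeasure L a) := fun i =>
    integrable_of_continuous L a ((hc i).star.mul (contDiff_component hE i).continuous)
  have i2 : ∀ i, Integrable (fun x => star (φ x) * pd i i E x) (slabMeasure L a) := fun i =>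
    integrable_of_continuous L a (hφ.continuous.star.mul (continuous_pd i i hE))
  have hparts : ∀ i, ∫ x, star (fderiv ℝ φ x (Pi.single i 1)) * E x i ∂(slabMeasure L a) =
      - ∫ x, star (φ x) * pd i i E x ∂(slabMeasure L a) := by
    intro i
    have := integral_star_mul_partial (a := a) hφ (contDiff_component hE i) hφp
      (lateralPeriodic_component hEp i) i (fun _ x hx => Or.inl (hφb x hx))
    simpa only [fderiv_component hE] using this
  have e1 : ∀ x, ∑ j, star (grad φ x j) * E x j =
      star (fderiv ℝ φ x (Pi.single 0 1)) * E x 0 + star (fderiv ℝ φ x (Pi.single 1 1)) * E x 1 +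
        star (fderiv ℝ φ x (Pi.single 2 1)) * E x 2 := by
    intro x
    simp [Fin.sum_univ_three, grad]
  rw [inner_toL2]
  simp only [e1]
  refine (integral_add ((i1 0).add (i1 1)) (i1 2)).trans ?_
  refine (congrArg (· + _) (integral_add (i1 0) (i1 1))).trans ?_
  simp only []
  rw [hparts, hparts, hparts, ← neg_add, ← neg_add, ← integral_add (i2 0) (i2 1)]
  have h := (integral_add ((i2 0).add (i2 1)) (i2 2)).symm
  simp only [Pi.add_apply] at h
  rw [h]
  simp only [← mul_add, hdiv, mul_zero, integral_zero, neg_zero]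

theorem IsTest.isSmoothPEC {φ : Pt → C3} (h : IsTest L a φ) : IsSmoothPEC L a φ := by
  refine ⟨h.smooth, h.periodic, fun x hx => ?_⟩
  obtain ⟨δ, hδ, hs⟩ := h.compact
  have : φ x = 0 := by
    by_contra hne
    have := hs x hne
    rcases hx with hx | hx <;> rw [hx] at this <;> linarith
  simp [this]

theorem IsTest.eq_zero_of_plate {φ : Pt → ℂ} (h : IsTest L a φ) (x : Pt) (hx : x 2 = 0 ∨ x 2 = a) :
    φ x = 0 := by
  obtain ⟨δ, hδ, hs⟩ := h.compact
  by_contra hne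
  have := hs x hne
  rcases hx with hx | hx <;> rw [hx] at this <;> linarith

/-- Smooth divergence-free fields with vanishing tangential trace belong to `V_PEC`. -/
theorem IsSmoothPEC.mem_curlGraph {φ : Pt → C3} (h : IsSmoothPEC L a φ) :
    (toL2 L a φ h.smooth.continuous, toL2 L a (curl φ) (continuous_curl h.smooth)) ∈
      curlGraph L a := fun _ hψ =>
  inner_curl_eq hψ.isSmoothPEC h.smooth h.periodic

/-- The pair (φ, ∇ × φ) is itself one of the pairs whose closure defines H₀(curl). The weak
divergence vanishes by parts, the test functions being zero on the plates. -/
theorem IsSmoothPEC.mem_VPEC {φ : Pt → C3} (h : IsSmoothPEC L a φ)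
    (hdiv : ∀ x, pd 0 0 φ x + pd 1 1 φ x + pd 2 2 φ x = 0) :
    toL2 L a φ h.smooth.continuous ∈ VPEC L a := by
  refine ⟨⟨(toL2 L a φ h.smooth.continuous, toL2 L a (curl φ) (continuous_curl h.smooth)),
    ⟨h.mem_curlGraph, Submodule.le_topologicalClosure _ ⟨φ, h, rfl⟩⟩, rfl⟩, fun ψ hψ => ?_⟩
  exact inner_grad_eq_zero hψ.smooth hψ.periodic hψ.eq_zero_of_plate h.smooth h.periodic hdiv

theorem curlPhys_eq {E : Vphys L a} {G : L2Field L a}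
    (h : (((E : Hphys L a) : L2Field L a), G) ∈ curlGraph L a) : curlPhys L a E = G := by
  rw [← weakCurl_graph] at h
  obtain ⟨y, hy, hy'⟩ := (weakCurl L a).mem_graph_iff.1 h
  exact (congrArg (weakCurl L a) (Subtype.ext hy.symm)).trans hy'

/-- Membership in H₀(curl) provides some pair over F in the closure; single-valuedness of the weak
curl identifies its second entry with `curlPhys L a F`. -/
theorem exists_mem_closure_smoothCurlGraph (F : Vphys L a) :
    (((F : Hphys L a) : L2Field L a), curlPhys L a F) ∈
      (smoothCurlGraph L a).topologicalClosure := by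
  obtain ⟨⟨⟨p1, p2⟩, ⟨hp, hpc⟩, hpF⟩, -⟩ := F.2
  have hpF' : p1 = ((F : Hphys L a) : L2Field L a) := hpF
  subst hpF'
  rw [curlPhys_eq hp]
  exact hpc

/-- For fixed X and Y the identity is a closed condition on the pair. This carries integration by
parts from smooth fields to all of H₀(curl). -/
theorem inner_eq_of_mem_topologicalClosure {H : Type*} [NormedAddCommGroup H]
    [InnerProductSpace ℂ H] {S : Submodule ℂ (H × H)} {p : H × H} (hp : p ∈ S.topologicalClosure)
    (X Y : H) (h : ∀ q ∈ S, (inner ℂ q.2 X : ℂ) = inner ℂ q.1 Y) :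
    (inner ℂ p.2 X : ℂ) = inner ℂ p.1 Y :=
  closure_minimal (t := {q : H × H | (inner ℂ q.2 X : ℂ) = inner ℂ q.1 Y}) h
    (isClosed_eq (continuous_snd.inner continuous_const) (continuous_fst.inner continuous_const)) hp

/-- `∫ (∇ × F)‾ · B = ∫ F‾ · (∇ × B)` for `F ∈ V_phys` and `B` smooth periodic. -/
theorem inner_curlPhys (F : Vphys L a) {B : Pt → C3} (hB : ContDiff ℝ ∞ B)
    (hBp : LateralPeriodic L B) :
    inner ℂ (curlPhys L a F) (toL2 L a B hB.continuous) =
      inner ℂ ((F : Hphys L a) : L2Field L a) (toL2 L a (curl B) (continuous_curl hB)) := by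
  refine inner_eq_of_mem_topologicalClosure (exists_mem_closure_smoothCurlGraph F) _ _ ?_
  rintro _ ⟨φ, h, rfl⟩
  exact inner_curl_eq h hB hBp

theorem isSymmetricPMap_LMx (L a : ℝ) : IsSymmetricPMap (LMx L a) := by
  have hrep : ∀ x : (LMx L a).domain, ((x : Hphys L a), LMx L a x) ∈ maxwellGraph L a := by
    intro x
    rw [← LMx_graph]
    exact (LMx L a).mem_graph x
  intro x y
  obtain ⟨E, hE, hE'⟩ := hrep x
  obtain ⟨F, hF, hF'⟩ := hrep y
  simp only at hE hF hE' hF'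
  have h1 : starRingEnd ℂ (maxwellForm E F) = maxwellForm F E := inner_conj_symm _ _
  rw [hE', hF'] at h1
  rw [← hE, ← hF, ← h1]
  exact (inner_conj_symm (𝕜 := ℂ) (LMx L a x) (F : Hphys L a)).symm

/-- A smooth field `E ∈ V_phys` with `∇ × ∇ × E = λ E` is an eigenvector of the Maxwell operator. -/
theorem mem_eigenspaceAt_LMx {φ : Pt → C3} (h : IsSmoothPEC L a φ) {μ : ℝ} {E : Vphys L a}
    (hE : ((E : Hphys L a) : L2Field L a) = toL2 L a φ h.smooth.continuous)
    (hc : ContDiff ℝ ∞ (curl φ)) (hcp : LateralPeriodic L (curl φ))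
    (heig : curl (curl φ) = (μ : ℂ) • φ) : (E : Hphys L a) ∈ eigenspaceAt (LMx L a) μ := by
  have hg : ((E : Hphys L a), (μ : ℂ) • (E : Hphys L a)) ∈ (LMx L a).graph := by
    rw [LMx_graph]
    refine ⟨E, rfl, fun F => ?_⟩
    -- The form becomes ⟨∇ × F, ∇ × φ⟩ = ⟨F, ∇ × ∇ × φ⟩. The field ∇ × φ need only be smooth and
    -- periodic, as F carries the boundary condition.
    unfold maxwellForm
    rw [curlPhys_eq (E := E) (G := toL2 L a (curl φ) hc.continuous) (by
      rw [hE]; exact h.mem_curlGraph), inner_curlPhys F hc hcp]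
    have e : toL2 L a (curl (curl φ)) (continuous_curl hc) =
        (((μ : ℂ) • (E : Hphys L a) : Hphys L a) : L2Field L a) := by
      rw [Submodule.coe_smul, hE]
      simp only [heig]
      rfl
    rw [e]
    rfl
  obtain ⟨y, hy, hy'⟩ := (LMx L a).mem_graph_iff.1 hg
  exact ⟨y, hy, hy'⟩

end SlabCalculus

/-! ### Sine and cosine waves and the cavity fields -/

section Waves

variable {L a : ℝ}

/-- The lateral plane wave `exp (i (k₀ x₀ + k₁ x₁))`. -/
noncomputable def lateralWave (k x : Pt) : ℂ :=
  Complex.exp (((k 0 * x 0 + k 1 * x 1 : ℝ) : ℂ) * Complex.I)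

/-- `exp (i (k₀ x₀ + k₁ x₁)) sin (k₂ x₂)`. -/
noncomputable def sinWave (k x : Pt) : ℂ := lateralWave k x * (Real.sin (k 2 * x 2) : ℂ)

/-- `exp (i (k₀ x₀ + k₁ x₁)) cos (k₂ x₂)`. -/
noncomputable def cosWave (k x : Pt) : ℂ := lateralWave k x * (Real.cos (k 2 * x 2) : ℂ)

/-- Wave vectors compatible with the lateral periods and with the plates. -/
structure IsAdmissible (L a : ℝ) (k : Pt) : Prop where
  period_zero : Complex.exp (((k 0 * L : ℝ) : ℂ) * Complex.I) = 1
  period_one : Complex.exp (((k 1 * L : ℝ) : ℂ) * Complex.I) = 1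
  plate : Real.sin (k 2 * a) = 0

theorem contDiff_lateralWave (k : Pt) : ContDiff ℝ ∞ (lateralWave k) := by
  unfold lateralWave
  exact ContDiff.cexp (ContDiff.mul (Complex.ofRealCLM.contDiff.comp
    (show ContDiff ℝ ∞ fun x : Pt => k 0 * x 0 + k 1 * x 1 by fun_prop)) contDiff_const)

theorem contDiff_sinWave (k : Pt) : ContDiff ℝ ∞ (sinWave k) :=
  (contDiff_lateralWave k).mul (Complex.ofRealCLM.contDiff.comp
    (show ContDiff ℝ ∞ fun x : Pt => Real.sin (k 2 * x 2) by fun_prop))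

theorem contDiff_cosWave (k : Pt) : ContDiff ℝ ∞ (cosWave k) :=
  (contDiff_lateralWave k).mul (Complex.ofRealCLM.contDiff.comp
    (show ContDiff ℝ ∞ fun x : Pt => Real.cos (k 2 * x 2) by fun_prop))

theorem hasFDerivAt_lateralWave (k x : Pt) :
    HasFDerivAt (lateralWave k) (lateralWave k x • (Complex.I • Complex.ofRealCLM.comp
      (k 0 • ContinuousLinearMap.proj (R := ℝ) (φ := fun _ : Fin 3 => ℝ) 0 +
        k 1 • ContinuousLinearMap.proj (R := ℝ) (φ := fun _ : Fin 3 => ℝ) 1))) x := by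
  have e : lateralWave k = fun y => Complex.exp ((Complex.I • Complex.ofRealCLM.comp
      (k 0 • ContinuousLinearMap.proj (R := ℝ) (φ := fun _ : Fin 3 => ℝ) 0 +
        k 1 • ContinuousLinearMap.proj (R := ℝ) (φ := fun _ : Fin 3 => ℝ) 1)) y) := by
    funext y
    simp [lateralWave, mul_comm, mul_add]
  rw [e]
  exact (ContinuousLinearMap.hasFDerivAt _).cexp

theorem hasFDerivAt_plate (k x : Pt) : HasFDerivAt (fun x : Pt => k 2 * x 2)
    (k 2 • ContinuousLinearMap.proj (R := ℝ) (φ := fun _ : Fin 3 => ℝ) 2) x :=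
  (k 2 • ContinuousLinearMap.proj (R := ℝ) (φ := fun _ : Fin 3 => ℝ) 2).hasFDerivAt

/-- The logarithmic lateral derivatives of a wave, and `0` for the plate variable. -/
noncomputable def lateralFactor (k : Pt) : Fin 3 → ℂ := ![Complex.I * k 0, Complex.I * k 1, 0]

/-- `k₂` for the plate variable and `0` for the lateral ones. -/
noncomputable def plateFactor (k : Pt) : Fin 3 → ℂ := ![0, 0, k 2]

theorem fderiv_sinWave (k x : Pt) (i : Fin 3) : fderiv ℝ (sinWave k) x (Pi.single i 1) =
    lateralFactor k i * sinWave k x + plateFactor k i * cosWave k x := by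
  have h := ((hasFDerivAt_lateralWave k x).mul
    (Complex.ofRealCLM.hasFDerivAt.comp x (hasFDerivAt_plate k x).sin)).fderiv
  change fderiv ℝ (sinWave k) x = _ at h
  rw [h]
  fin_cases i <;> simp [sinWave, cosWave, lateralFactor, plateFactor] <;> ring

theorem fderiv_cosWave (k x : Pt) (i : Fin 3) : fderiv ℝ (cosWave k) x (Pi.single i 1) =
    lateralFactor k i * cosWave k x - plateFactor k i * sinWave k x := by
  have h := ((hasFDerivAt_lateralWave k x).mul
    (Complex.ofRealCLM.hasFDerivAt.comp x (hasFDerivAt_plate k x).cos)).fderiv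
  change fderiv ℝ (cosWave k) x = _ at h
  rw [h]
  fin_cases i <;> simp [sinWave, cosWave, lateralFactor, plateFactor] <;> ring

theorem IsAdmissible.lateralPeriodic_lateralWave {k : Pt} (hk : IsAdmissible L a k) :
    LateralPeriodic L (lateralWave k) := by
  intro x
  unfold lateralWave
  constructor
  · rw [← mul_one (Complex.exp (((k 0 * x 0 + k 1 * x 1 : ℝ) : ℂ) * Complex.I)), ← hk.period_zero,
      ← Complex.exp_add]
    congr 1
    simp
    ring
  · rw [← mul_one (Complex.exp (((k 0 * x 0 + k 1 * x 1 : ℝ) : ℂ) * Complex.I)), ← hk.period_one,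
      ← Complex.exp_add]
    congr 1
    simp
    ring

theorem IsAdmissible.lateralPeriodic_sinWave {k : Pt} (hk : IsAdmissible L a k) :
    LateralPeriodic L (sinWave k) := fun x => by
  unfold sinWave
  rw [(hk.lateralPeriodic_lateralWave x).1, (hk.lateralPeriodic_lateralWave x).2]
  simp

theorem IsAdmissible.lateralPeriodic_cosWave {k : Pt} (hk : IsAdmissible L a k) :
    LateralPeriodic L (cosWave k) := fun x => by
  unfold cosWave
  rw [(hk.lateralPeriodic_lateralWave x).1, (hk.lateralPeriodic_lateralWave x).2]
  simp

theorem IsAdmissible.sinWave_eq_zero {k : Pt} (hk : IsAdmissible L a k) (x : Pt)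
    (hx : x 2 = 0 ∨ x 2 = a) : sinWave k x = 0 := by
  rcases hx with hx | hx <;> simp [sinWave, hx, hk.plate]

/-- The electric cavity field `(v₀ S, v₁ S, v₂ C)`, with `S` and `C` the sine and cosine waves. -/
noncomputable def electricMode (k : Pt) (v : C3) (x : Pt) : C3 :=
  !₂[v 0 * sinWave k x, v 1 * sinWave k x, v 2 * cosWave k x]

/-- The magnetic cavity field `(w₀ C, w₁ C, w₂ S)`. -/
noncomputable def magneticMode (k : Pt) (w : C3) (x : Pt) : C3 :=
  !₂[w 0 * cosWave k x, w 1 * cosWave k x, w 2 * sinWave k x]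

theorem contDiff_toLp_three {f g h : Pt → ℂ} (hf : ContDiff ℝ ∞ f) (hg : ContDiff ℝ ∞ g)
    (hh : ContDiff ℝ ∞ h) : ContDiff ℝ ∞ fun x => (!₂[f x, g x, h x] : C3) := by
  refine (PiLp.continuousLinearEquiv 2 ℝ fun _ : Fin 3 => ℂ).symm.contDiff.comp
    (contDiff_pi.2 fun i => ?_)
  fin_cases i
  · exact hf
  · exact hg
  · exact hh

theorem contDiff_electricMode (k : Pt) (v : C3) : ContDiff ℝ ∞ (electricMode k v) :=
  contDiff_toLp_three (contDiff_const.mul (contDiff_sinWave k))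
    (contDiff_const.mul (contDiff_sinWave k)) (contDiff_const.mul (contDiff_cosWave k))

theorem contDiff_magneticMode (k : Pt) (v : C3) : ContDiff ℝ ∞ (magneticMode k v) :=
  contDiff_toLp_three (contDiff_const.mul (contDiff_cosWave k))
    (contDiff_const.mul (contDiff_cosWave k)) (contDiff_const.mul (contDiff_sinWave k))

theorem pd_electricMode (k : Pt) (v : C3) (i : Fin 3) (x : Pt) :
    pd i 0 (electricMode k v) x =
      v 0 * (lateralFactor k i * sinWave k x + plateFactor k i * cosWave k x) ∧
    pd i 1 (electricMode k v) x =
      v 1 * (lateralFactor k i * sinWave k x + plateFactor k i * cosWave k x) ∧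
    pd i 2 (electricMode k v) x =
      v 2 * (lateralFactor k i * cosWave k x - plateFactor k i * sinWave k x) := by
  have hs : ∀ c : ℂ, fderiv ℝ (fun y => c * sinWave k y) x (Pi.single i 1) =
      c * (lateralFactor k i * sinWave k x + plateFactor k i * cosWave k x) := fun c => by
    rw [fderiv_const_mul ((contDiff_sinWave k).differentiable (by simp) x), smul_apply,
      fderiv_sinWave, smul_eq_mul]
  have hc : ∀ c : ℂ, fderiv ℝ (fun y => c * cosWave k y) x (Pi.single i 1) =
      c * (lateralFactor k i * cosWave k x - plateFactor k i * sinWave k x) := fun c => by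
    rw [fderiv_const_mul ((contDiff_cosWave k).differentiable (by simp) x), smul_apply,
      fderiv_cosWave, smul_eq_mul]
  simp only [← fderiv_component (contDiff_electricMode k v)]
  exact ⟨hs _, hs _, hc _⟩

theorem pd_magneticMode (k : Pt) (v : C3) (i : Fin 3) (x : Pt) :
    pd i 0 (magneticMode k v) x =
      v 0 * (lateralFactor k i * cosWave k x - plateFactor k i * sinWave k x) ∧
    pd i 1 (magneticMode k v) x =
      v 1 * (lateralFactor k i * cosWave k x - plateFactor k i * sinWave k x) ∧
    pd i 2 (magneticMode k v) x =
      v 2 * (lateralFactor k i * sinWave k x + plateFactor k i * cosWave k x) := by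
  have hs : ∀ c : ℂ, fderiv ℝ (fun y => c * sinWave k y) x (Pi.single i 1) =
      c * (lateralFactor k i * sinWave k x + plateFactor k i * cosWave k x) := fun c => by
    rw [fderiv_const_mul ((contDiff_sinWave k).differentiable (by simp) x), smul_apply,
      fderiv_sinWave, smul_eq_mul]
  have hc : ∀ c : ℂ, fderiv ℝ (fun y => c * cosWave k y) x (Pi.single i 1) =
      c * (lateralFactor k i * cosWave k x - plateFactor k i * sinWave k x) := fun c => by
    rw [fderiv_const_mul ((contDiff_cosWave k).differentiable (by simp) x), smul_apply,
      fderiv_cosWave, smul_eq_mul]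
  simp only [← fderiv_component (contDiff_magneticMode k v)]
  exact ⟨hc _, hc _, hs _⟩

/-- A plate derivative exchanges sine and cosine while a lateral one multiplies by i k₀ or i k₁, so
the curl exchanges the electric and magnetic families and acts on amplitudes by algebra in ℂ³. -/
theorem curl_electricMode (k : Pt) (v : C3) : curl (electricMode k v) = magneticMode k
    !₂[Complex.I * k 1 * v 2 - k 2 * v 1, k 2 * v 0 - Complex.I * k 0 * v 2,
      Complex.I * k 0 * v 1 - Complex.I * k 1 * v 0] := by
  funext x
  ext j
  fin_cases j <;> simp [curl, magneticMode, pd_electricMode k v, lateralFactor, plateFactor] <;>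
    ring

theorem curl_magneticMode (k : Pt) (w : C3) : curl (magneticMode k w) = electricMode k
    !₂[Complex.I * k 1 * w 2 + k 2 * w 1, -(k 2 * w 0) - Complex.I * k 0 * w 2,
      Complex.I * k 0 * w 1 - Complex.I * k 1 * w 0] := by
  funext x
  ext j
  fin_cases j <;> simp [curl, electricMode, pd_magneticMode k w, lateralFactor, plateFactor] <;>
    ring

/-- The transversality condition `i k₀ v₀ + i k₁ v₁ - k₂ v₂ = 0`, i.e. zero divergence. -/
def IsTransverse (k : Pt) (v : C3) : Prop :=
  Complex.I * k 0 * v 0 + Complex.I * k 1 * v 1 - k 2 * v 2 = 0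

/-- This is ∇ × ∇ × = ∇(∇·) − Δ at the level of amplitudes: transversality removes the gradient
term, and i² = −1 supplies the sign in the lateral part of −Δ. -/
theorem IsTransverse.curl_curl {k : Pt} {v : C3} (h : IsTransverse k v) :
    curl (curl (electricMode k v)) =
      ((k 0 ^ 2 + k 1 ^ 2 + k 2 ^ 2 : ℝ) : ℂ) • electricMode k v := by
  have hI := Complex.I_sq
  rw [curl_electricMode, curl_magneticMode]
  unfold IsTransverse at h
  funext x
  ext j
  fin_cases j <;> simp [electricMode]
  · linear_combination (sinWave k x) * (Complex.I * k 0 * h -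
      (k 0 ^ 2 * v 0 + k 1 ^ 2 * v 0) * hI)
  · linear_combination (sinWave k x) * (Complex.I * k 1 * h -
      (k 0 ^ 2 * v 1 + k 1 ^ 2 * v 1) * hI)
  · linear_combination (cosWave k x) * ((k 2 : ℂ) * h -
      (k 0 ^ 2 * v 2 + k 1 ^ 2 * v 2) * hI)

theorem IsTransverse.div_eq_zero {k : Pt} {v : C3} (h : IsTransverse k v) (x : Pt) :
    pd 0 0 (electricMode k v) x + pd 1 1 (electricMode k v) x +
      pd 2 2 (electricMode k v) x = 0 := by
  rw [(pd_electricMode k v 0 x).1, (pd_electricMode k v 1 x).2.1, (pd_electricMode k v 2 x).2.2]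
  unfold IsTransverse at h
  simp [lateralFactor, plateFactor]
  linear_combination sinWave k x * h

theorem IsAdmissible.isSmoothPEC_electricMode {k : Pt} (hk : IsAdmissible L a k) (v : C3) :
    IsSmoothPEC L a (electricMode k v) := by
  refine ⟨contDiff_electricMode k v, fun x => ?_, fun x hx => ?_⟩
  · simp only [electricMode, (hk.lateralPeriodic_sinWave x).1, (hk.lateralPeriodic_sinWave x).2,
      (hk.lateralPeriodic_cosWave x).1, (hk.lateralPeriodic_cosWave x).2, and_self]
  · simp [electricMode, hk.sinWave_eq_zero x hx]

theorem IsAdmissible.lateralPeriodic_magneticMode {k : Pt} (hk : IsAdmissible L a k) (v : C3) :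
    LateralPeriodic L (magneticMode k v) := fun x => by
  simp only [magneticMode, (hk.lateralPeriodic_sinWave x).1, (hk.lateralPeriodic_sinWave x).2,
      (hk.lateralPeriodic_cosWave x).1, (hk.lateralPeriodic_cosWave x).2, and_self]

/-! ### Inner products of waves -/

/-- `∫ conj f · g` over the slab. -/
noncomputable def slabInner (L a : ℝ) (f g : Pt → ℂ) : ℂ := ∫ x, star (f x) * g x ∂(slabMeasure L a)

theorem star_lateralFactor (k : Pt) (i : Fin 3) : star (lateralFactor k i) = -lateralFactor k i := by
  fin_cases i <;> simp [lateralFactor]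

/-- Lateral derivatives are skew-adjoint on periodic functions, so two eigenfunctions are orthogonal
unless their eigenvalues satisfy `star α = -β`. -/
theorem slabInner_lateral {f g : Pt → ℂ} (hf : ContDiff ℝ ∞ f) (hg : ContDiff ℝ ∞ g)
    (hfp : LateralPeriodic L f) (hgp : LateralPeriodic L g) (i : Fin 3) (hi : i ≠ 2) {α β : ℂ}
    (hf' : ∀ x, fderiv ℝ f x (Pi.single i 1) = α * f x)
    (hg' : ∀ x, fderiv ℝ g x (Pi.single i 1) = β * g x) (h : star α ≠ -β) :
    slabInner L a f g = 0 := by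
  have := integral_star_mul_partial (a := a) hf hg hfp hgp i (fun h => absurd h hi)
  simp only [hf', hg', star_mul', mul_assoc] at this
  have e : ∀ x, star (f x) * (β * g x) = β * (star (f x) * g x) := fun x => by ring
  simp only [e, integral_const_mul] at this
  have h2 : (star α + β) * slabInner L a f g = 0 := by
    unfold slabInner
    linear_combination this
  exact (mul_eq_zero.1 h2).resolve_left fun h3 => h (eq_neg_of_add_eq_zero_left h3)

/-- Integrate ∂₂S_k = k₂C_k by parts against C_l, using ∂₂C_l = −l₂S_l; the boundary term contains
the sine, which vanishes on the plates. Used in place of explicit trigonometric integrals. -/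
theorem IsAdmissible.plate_relation {k l : Pt} (hk : IsAdmissible L a k)
    (hl : IsAdmissible L a l) :
    k 2 * slabInner L a (cosWave k) (cosWave l) = l 2 * slabInner L a (sinWave k) (sinWave l) := by
  have := integral_star_mul_partial (a := a) (contDiff_sinWave k) (contDiff_cosWave l)
    hk.lateralPeriodic_sinWave hl.lateralPeriodic_cosWave 2
    (fun _ x hx => Or.inl (hk.sinWave_eq_zero x hx))
  simp only [fderiv_sinWave, fderiv_cosWave, lateralFactor, plateFactor, Matrix.cons_val] at this
  have e1 : ∀ x, star (0 * sinWave k x + (k 2 : ℂ) * cosWave k x) * cosWave l x =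
      k 2 * (star (cosWave k x) * cosWave l x) := fun x => by simp; ring
  have e2 : ∀ x, star (sinWave k x) * (0 * cosWave l x - (l 2 : ℂ) * sinWave l x) =
      -l 2 * (star (sinWave k x) * sinWave l x) := fun x => by simp; ring
  simp only [e1, e2, integral_const_mul] at this
  unfold slabInner
  rw [this]
  ring

theorem slabInner_star (f g : Pt → ℂ) : star (slabInner L a f g) = slabInner L a g f := by
  unfold slabInner
  rw [← starRingEnd_apply, ← integral_conj]
  refine integral_congr_ae (Eventually.of_forall fun x => ?_)
  simp [mul_comm]

/-- If a lateral component differs, the lateral derivative separates the waves. Otherwise the plate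
relation and its version with k and l exchanged form a homogeneous 2 × 2 system with determinant
±(k₂² − l₂²); nonnegativity of k₂ and l₂ makes this nonzero. -/
theorem IsAdmissible.slabInner_eq_zero {k l : Pt} (hk : IsAdmissible L a k)
    (hl : IsAdmissible L a l) (hk2 : 0 ≤ k 2) (hl2 : 0 ≤ l 2) (h : k ≠ l) :
    slabInner L a (sinWave k) (sinWave l) = 0 ∧ slabInner L a (cosWave k) (cosWave l) = 0 := by
  have hlat : ∀ i : Fin 3, i ≠ 2 → k i ≠ l i →
      slabInner L a (sinWave k) (sinWave l) = 0 ∧ slabInner L a (cosWave k) (cosWave l) = 0 := by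
    intro i hi hne
    have hp : ∀ k : Pt, plateFactor k i = 0 := by
      intro k
      fin_cases i
      · rfl
      · rfl
      · exact absurd rfl hi
    have hf : star (lateralFactor k i) ≠ -lateralFactor l i := by
      rw [star_lateralFactor, Ne, neg_inj]
      fin_cases i
      · simpa [lateralFactor] using hne
      · simpa [lateralFactor] using hne
      · exact absurd rfl hi
    refine ⟨slabInner_lateral (contDiff_sinWave k) (contDiff_sinWave l) hk.lateralPeriodic_sinWave
      hl.lateralPeriodic_sinWave i hi (fun x => ?_) (fun x => ?_) hf,
      slabInner_lateral (contDiff_cosWave k) (contDiff_cosWave l) hk.lateralPeriodic_cosWave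
      hl.lateralPeriodic_cosWave i hi (fun x => ?_) (fun x => ?_) hf⟩
    · rw [fderiv_sinWave, hp, zero_mul, add_zero]
    · rw [fderiv_sinWave, hp, zero_mul, add_zero]
    · rw [fderiv_cosWave, hp, zero_mul, sub_zero]
    · rw [fderiv_cosWave, hp, zero_mul, sub_zero]
  by_cases h0 : k 0 = l 0
  swap
  · exact hlat 0 (by decide) h0
  by_cases h1 : k 1 = l 1
  swap
  · exact hlat 1 (by decide) h1
  have h2 : k 2 ≠ l 2 := by
    intro h2
    refine h (funext fun i => ?_)
    fin_cases i
    · exact h0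
    · exact h1
    · exact h2
  have r1 := hk.plate_relation hl
  have r2 := congrArg star (hl.plate_relation hk)
  simp only [star_mul', slabInner_star] at r2
  simp only [Complex.star_def, Complex.conj_ofReal] at r2
  have hd : ((k 2 : ℂ) ^ 2 - l 2 ^ 2) ≠ 0 := by
    rw [sub_ne_zero]
    norm_cast
    exact fun h => h2 ((sq_eq_sq₀ hk2 hl2).1 h)
  constructor
  · refine (mul_eq_zero.1 (?_ : ((k 2 : ℂ) ^ 2 - l 2 ^ 2) * _ = 0)).resolve_left hd
    linear_combination l 2 * r1 - k 2 * r2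
  · refine (mul_eq_zero.1 (?_ : ((k 2 : ℂ) ^ 2 - l 2 ^ 2) * _ = 0)).resolve_left hd
    linear_combination k 2 * r1 - l 2 * r2

theorem star_lateralWave_mul_self (k x : Pt) : star (lateralWave k x) * lateralWave k x = 1 := by
  unfold lateralWave
  rw [Complex.star_def, Complex.conj_mul', Complex.norm_exp_ofReal_mul_I]
  simp

theorem volume_slab_pos (hL : 0 < L) (ha : 0 < a) : 0 < (slabMeasure L a).real Set.univ := by
  have := isFiniteMeasure_slab L a
  have hne : (slab L a).Nonempty :=
    ⟨![L / 2, L / 2, a / 2], by simp [slab]; constructor <;> linarith⟩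
  have h := (isOpen_slab L a).measure_pos volume hne
  rw [measureReal_def, ENNReal.toReal_pos_iff]
  exact ⟨by simpa [slabMeasure] using h, measure_lt_top _ _⟩

/-- For `k₂ ≠ 0` the sine and the cosine wave have the same norm, the square of which is half of the
volume. -/
theorem IsAdmissible.slabInner_self {k : Pt} (hk : IsAdmissible L a k) (hk2 : k 2 ≠ 0) :
    slabInner L a (sinWave k) (sinWave k) = (((slabMeasure L a).real Set.univ / 2 : ℝ) : ℂ) ∧
    slabInner L a (cosWave k) (cosWave k) = (((slabMeasure L a).real Set.univ / 2 : ℝ) : ℂ) := by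
  have := isFiniteMeasure_slab L a
  -- The plate relation with k = l gives equality of the two norms after division by k₂; their sum
  -- is the volume because sin² + cos² = 1.
  have h1 : slabInner L a (cosWave k) (cosWave k) = slabInner L a (sinWave k) (sinWave k) :=
    mul_left_cancel₀ (Complex.ofReal_ne_zero.2 hk2) (hk.plate_relation hk)
  have h2 : slabInner L a (sinWave k) (sinWave k) + slabInner L a (cosWave k) (cosWave k) =
      (((slabMeasure L a).real Set.univ : ℝ) : ℂ) := by
    refine (integral_add (integrable_of_continuous L a
      ((contDiff_sinWave k).continuous.star.mul (contDiff_sinWave k).continuous))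
      (integrable_of_continuous L a
      ((contDiff_cosWave k).continuous.star.mul (contDiff_cosWave k).continuous))).symm.trans ?_
    have e : ∀ x, star (sinWave k x) * sinWave k x + star (cosWave k x) * cosWave k x = 1 := by
      intro x
      have h := star_lateralWave_mul_self k x
      have h' : (Real.sin (k 2 * x 2) : ℂ) ^ 2 + (Real.cos (k 2 * x 2) : ℂ) ^ 2 = 1 := by
        exact_mod_cast Real.sin_sq_add_cos_sq (k 2 * x 2)
      simp only [sinWave, cosWave, star_mul', Complex.star_def, Complex.conj_ofReal] at h ⊢
      linear_combination ((Real.sin (k 2 * x 2) : ℂ) ^ 2 + (Real.cos (k 2 * x 2) : ℂ) ^ 2) * h + h'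
    refine (integral_congr_ae (Eventually.of_forall e)).trans ?_
    simp [integral_const]
  push_cast
  constructor
  · linear_combination (h2 - h1) / 2
  · linear_combination (h2 + h1) / 2

theorem slabInner_cosWave_self_of_eq_zero {k : Pt} (hk2 : k 2 = 0) :
    slabInner L a (cosWave k) (cosWave k) = (((slabMeasure L a).real Set.univ : ℝ) : ℂ) := by
  have e : ∀ x, star (cosWave k x) * cosWave k x = 1 := by
    intro x
    simpa [cosWave, hk2] using star_lateralWave_mul_self k x
  unfold slabInner
  simp only [e]
  simp [integral_const]

theorem inner_electricMode (k l : Pt) (v w : C3) :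
    inner ℂ (toL2 L a (electricMode k v) (contDiff_electricMode k v).continuous)
      (toL2 L a (electricMode l w) (contDiff_electricMode l w).continuous) =
      (star (v 0) * w 0 + star (v 1) * w 1) * slabInner L a (sinWave k) (sinWave l) +
        star (v 2) * w 2 * slabInner L a (cosWave k) (cosWave l) := by
  rw [inner_toL2]
  have e : ∀ x, ∑ j, star (electricMode k v x j) * electricMode l w x j =
      (star (v 0) * w 0 + star (v 1) * w 1) * (star (sinWave k x) * sinWave l x) +
        star (v 2) * w 2 * (star (cosWave k x) * cosWave l x) := by
    intro x
    simp [Fin.sum_univ_three, electricMode]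
    ring
  simp only [e]
  rw [integral_add, integral_const_mul, integral_const_mul]
  · rfl
  · exact (integrable_of_continuous L a
      ((contDiff_sinWave k).continuous.star.mul (contDiff_sinWave l).continuous)).const_mul _
  · exact (integrable_of_continuous L a
      ((contDiff_cosWave k).continuous.star.mul (contDiff_cosWave l).continuous)).const_mul _

end Waves

/-! ### Totality of the waves, by reflection to a torus -/

section Totality

variable {L a : ℝ}

/-- The wave vector `(2π n₀ / L, 2π n₁ / L, π n₂ / a)`. -/
noncomputable def waveVector (L a : ℝ) (n : Fin 3 → ℤ) : Pt :=
  ![2 * Real.pi * n 0 / L, 2 * Real.pi * n 1 / L, Real.pi * n 2 / a]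

theorem isAdmissible_waveVector (hL : 0 < L) (ha : 0 < a) (n : Fin 3 → ℤ) :
    IsAdmissible L a (waveVector L a n) := by
  have h : ∀ m : ℤ, Complex.exp (((2 * Real.pi * m / L * L : ℝ) : ℂ) * Complex.I) = 1 := by
    intro m
    rw [div_mul_cancel₀ _ hL.ne', ← Complex.exp_int_mul_two_pi_mul_I m]
    push_cast
    ring_nf
  refine ⟨h _, h _, ?_⟩
  change Real.sin (Real.pi * n 2 / a * a) = 0
  rw [div_mul_cancel₀ _ ha.ne', mul_comm]
  exact Real.sin_int_mul_pi _

/-- The periods of the torus obtained from the slab by reflection in a plate. -/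
noncomputable def torusPeriod (L a : ℝ) : Pt := ![L, L, 2 * a]

/-- The projection of `ℝ³` onto the unit torus, after rescaling by the periods. -/
noncomputable def torusProj (L a : ℝ) (x : Pt) : UnitAddTorus (Fin 3) :=
  fun i => ((x i / torusPeriod L a i : ℝ) : UnitAddCircle)

theorem continuous_torusProj (L a : ℝ) : Continuous (torusProj L a) :=
  continuous_pi fun i => (AddCircle.continuous_mk' 1).comp ((continuous_apply i).div_const _)

/-- The reflection in the plate `x₂ = 0`. -/
def plateReflection (x : Pt) : Pt := ![x 0, x 1, -x 2]

theorem continuous_plateReflection : Continuous plateReflection := by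
  refine continuous_pi fun i => ?_
  fin_cases i
  · exact continuous_apply 0
  · exact continuous_apply 1
  · exact (continuous_apply 2).neg

/-- With plate period 2a, a character is C + iS. Reflection fixes C and reverses S, so symmetrized
characters are cosine waves and antisymmetrized ones sine waves, up to constants. -/
theorem mFourier_torusProj (hL : 0 < L) (ha : 0 < a) (n : Fin 3 → ℤ) (x : Pt) :
    UnitAddTorus.mFourier n (torusProj L a x) =
      cosWave (waveVector L a n) x + Complex.I * sinWave (waveVector L a n) x := by
  have hLc : (L : ℂ) ≠ 0 := Complex.ofReal_ne_zero.2 hL.ne'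
  have hac : (a : ℂ) ≠ 0 := Complex.ofReal_ne_zero.2 ha.ne'
  have h1 : cosWave (waveVector L a n) x + Complex.I * sinWave (waveVector L a n) x =
      lateralWave (waveVector L a n) x *
        Complex.exp (((Real.pi * n 2 / a * x 2 : ℝ) : ℂ) * Complex.I) := by
    rw [Complex.exp_mul_I, ← Complex.ofReal_cos, ← Complex.ofReal_sin]
    simp only [cosWave, sinWave, waveVector, Matrix.cons_val]
    ring
  rw [h1]
  simp only [UnitAddTorus.mFourier, ContinuousMap.coe_mk, torusProj, fourier_coe_apply,
    Fin.prod_univ_three, lateralWave, ← Complex.exp_add]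
  congr 1
  simp only [waveVector, torusPeriod, Matrix.cons_val]
  push_cast
  field_simp

theorem cosWave_plateReflection (k x : Pt) : cosWave k (plateReflection x) = cosWave k x := by
  simp [cosWave, lateralWave, plateReflection]

theorem sinWave_plateReflection (k x : Pt) : sinWave k (plateReflection x) = -sinWave k x := by
  simp [sinWave, lateralWave, plateReflection]

theorem periodic_lattice {q : Pt → ℝ} {p : Pt}
    (hq : ∀ (i : Fin 3) (x : Pt), q (x + Pi.single i (p i)) = q x) (n : Fin 3 → ℤ) (x : Pt) :
    q (x + fun i => n i * p i) = q x := by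
  have h : ∀ i, Function.Periodic q (n i • Pi.single i (p i)) := fun i =>
    Function.Periodic.zsmul (hq i) (n i)
  have e : (fun i => n i * p i : Pt) =
      n 0 • Pi.single 0 (p 0) + n 1 • Pi.single 1 (p 1) + n 2 • Pi.single 2 (p 2) := by
    ext i
    fin_cases i <;> simp
  rw [e]
  exact ((h 0).add_period (h 1)).add_period (h 2) x

/-- A continuous function with the periods of the torus descends to it. -/
theorem exists_torus_lift (hL : 0 < L) (ha : 0 < a) {q : Pt → ℝ} (hq : Continuous q)
    (hp : ∀ (i : Fin 3) (x : Pt), q (x + Pi.single i (torusPeriod L a i)) = q x) :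
    ∃ G : C(UnitAddTorus (Fin 3), ℂ), ∀ x, G (torusProj L a x) = q x := by
  have hper : ∀ i, torusPeriod L a i ≠ 0 := by
    intro i
    fin_cases i
    · exact hL.ne'
    · exact hL.ne'
    · exact (mul_pos two_pos ha).ne'
  -- A product of quotient maps need not be a quotient map; openness of ℝ → ℝ/ℤ makes it one here.
  have hquot : IsOpenQuotientMap (Pi.map fun (_ : Fin 3) (t : ℝ) => (t : UnitAddCircle)) :=
    IsOpenQuotientMap.piMap fun _ => QuotientAddGroup.isOpenQuotientMap_mk
  let π : C(Pt, UnitAddTorus (Fin 3)) := ⟨_, hquot.continuous⟩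
  let g : C(Pt, ℂ) := ⟨fun t => q (fun i => t i * torusPeriod L a i), by fun_prop⟩
  have hπ : IsQuotientMap π := hquot.isQuotientMap
  have hg : ∀ s t, π s = π t → g s = g t := by
    intro s t hst
    have h1 : ∀ i, ∃ n : ℤ, s i = t i + n := by
      intro i
      have h2 : ((s i : ℝ) : UnitAddCircle) = ((t i : ℝ) : UnitAddCircle) := congrFun hst i
      have h3 : ((s i - t i : ℝ) : UnitAddCircle) = 0 := by
        rw [AddCircle.coe_sub, h2, sub_self]
      obtain ⟨n, hn⟩ := (AddCircle.coe_eq_zero_iff _).1 h3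
      refine ⟨n, ?_⟩
      rw [zsmul_one] at hn
      linarith
    choose n hn using h1
    have h3 := periodic_lattice hp n (fun i => t i * torusPeriod L a i)
    change ((q _ : ℝ) : ℂ) = ((q _ : ℝ) : ℂ)
    rw [← h3]
    congr 2
    funext i
    simp [hn i, add_mul]
  refine ⟨hπ.lift g hg, fun x => ?_⟩
  have h4 : torusProj L a x = π fun i => x i / torusPeriod L a i := rfl
  have h5 := ContinuousMap.congr_fun (hπ.lift_comp g hg) (fun i => x i / torusPeriod L a i)
  rw [h4]
  refine h5.trans ?_
  change ((q _ : ℝ) : ℂ) = _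
  congr 2
  funext i
  exact div_mul_cancel₀ _ (hper i)

/-- If the integrals of `f` against all symmetrized (antisymmetrized) characters of the torus vanish,
so do those against all symmetrized (antisymmetrized) continuous functions. -/
theorem integral_symmetrized_eq_zero {f : Pt → ℂ} (hf : Integrable f (slabMeasure L a)) {s : ℂ}
    (hs : ‖s‖ ≤ 1)
    (h : ∀ n : Fin 3 → ℤ, ∫ x, f x * (UnitAddTorus.mFourier n (torusProj L a x) +
      s * UnitAddTorus.mFourier n (torusProj L a (plateReflection x))) ∂(slabMeasure L a) = 0)
    (G : C(UnitAddTorus (Fin 3), ℂ)) :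
    ∫ x, f x * (G (torusProj L a x) + s * G (torusProj L a (plateReflection x)))
      ∂(slabMeasure L a) = 0 := by
  have hb : ∀ (G : C(UnitAddTorus (Fin 3), ℂ)) (x : Pt),
      ‖G (torusProj L a x) + s * G (torusProj L a (plateReflection x))‖ ≤ 2 * ‖G‖ := by
    intro G x
    refine (norm_add_le _ _).trans ?_
    rw [norm_mul]
    have h1 := G.norm_coe_le_norm (torusProj L a x)
    have h2 := G.norm_coe_le_norm (torusProj L a (plateReflection x))
    nlinarith [norm_nonneg s, norm_nonneg (G (torusProj L a (plateReflection x)))]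
  have hint : ∀ G : C(UnitAddTorus (Fin 3), ℂ), Integrable (fun x => f x * (G (torusProj L a x) +
      s * G (torusProj L a (plateReflection x)))) (slabMeasure L a) := by
    intro G
    refine hf.mul_bdd (c := 2 * ‖G‖) ?_ (Eventually.of_forall (hb G))
    have h1 := G.continuous.comp (continuous_torusProj L a)
    have h2 := h1.comp continuous_plateReflection
    exact (h1.add (continuous_const.mul h2)).aestronglyMeasurable
  let Λ : C(UnitAddTorus (Fin 3), ℂ) →L[ℂ] ℂ := LinearMap.mkContinuous
    { toFun := fun G => ∫ x, f x * (G (torusProj L a x) +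
        s * G (torusProj L a (plateReflection x))) ∂(slabMeasure L a)
      map_add' := fun G G' => by
        rw [← integral_add (hint G) (hint G')]
        refine integral_congr_ae (Eventually.of_forall fun x => ?_)
        simp only [ContinuousMap.add_apply]
        ring
      map_smul' := fun c G => by
        rw [RingHom.id_apply, smul_eq_mul, ← integral_const_mul]
        refine integral_congr_ae (Eventually.of_forall fun x => ?_)
        simp only [ContinuousMap.smul_apply, smul_eq_mul]
        ring }
    (∫ x, ‖f x‖ * 2 ∂(slabMeasure L a)) (fun G => by
      refine (norm_integral_le_integral_norm _).trans ?_
      rw [← integral_mul_const]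
      refine integral_mono (hint G).norm ((hf.norm.mul_const 2).mul_const _) fun x => ?_
      simp only [norm_mul, mul_assoc]
      exact mul_le_mul_of_nonneg_left (hb G x) (norm_nonneg _))
  -- Λ is continuous for the sup norm and vanishes on the characters, whose span is dense in the
  -- continuous functions on the torus.
  have hΛ : Λ = 0 := by
    refine ContinuousLinearMap.ext_on (s := Set.range UnitAddTorus.mFourier)
      ((Submodule.dense_iff_topologicalClosure_eq_top).2
        UnitAddTorus.span_mFourier_closure_eq_top) ?_
    rintro _ ⟨n, rfl⟩
    exact h n
  exact congrArg (fun T : C(UnitAddTorus (Fin 3), ℂ) →L[ℂ] ℂ => T G) hΛ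

/-- Extending g by zero to the reflected half before periodizing makes the symmetrization of G on
the slab, with either sign, equal to g alone. Hence each parity class by itself detects every bump
function in the slab. -/
theorem exists_torus_extension (hL : 0 < L) (ha : 0 < a) {g : Pt → ℝ} (hg : ContDiff ℝ ∞ g)
    {δ : ℝ} (hδ : 0 < δ)
    (hs : ∀ x, g x ≠ 0 → (0 < x 0 ∧ x 0 < L) ∧ (0 < x 1 ∧ x 1 < L) ∧ (δ ≤ x 2 ∧ x 2 ≤ a - δ)) :
    ∃ G : C(UnitAddTorus (Fin 3), ℂ), ∀ x ∈ slab L a, G (torusProj L a x) = g x ∧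
      G (torusProj L a (plateReflection x)) = 0 := by
  obtain ⟨p, hp, hpg⟩ := exists_test (a := a) hL hg hδ hs
  obtain ⟨ε, hε, hps⟩ := hp.compact
  have h2a : 0 < 2 * a := by positivity
  have hq : ContDiff ℝ ∞ (periodize (2 * a) 2 p) := periodize_smooth h2a hp.smooth fun x hx => by
    have := hps x hx
    constructor <;> linarith
  have hper : ∀ (i : Fin 3) (x : Pt), periodize (2 * a) 2 p (x + Pi.single i (torusPeriod L a i)) =
      periodize (2 * a) 2 p x := by
    intro i x
    fin_cases i
    · exact periodize_other (by decide) (fun x => (hp.periodic x).1) x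
    · exact periodize_other (by decide) (fun x => (hp.periodic x).2) x
    · exact periodize_periodic h2a 2 p x
  obtain ⟨G, hG⟩ := exists_torus_lift hL ha hq.continuous hper
  refine ⟨G, fun x hx => ⟨?_, ?_⟩⟩
  · rw [hG, periodize_eq h2a hx.2.2.1.le (by linarith [hx.2.2.2, hx.2.2.1]), hpg x hx]
  · obtain ⟨-, -, h0, h1⟩ := hx
    -- Modulo the period 2a the reflected point has height 2a − x₂ in (a, 2a), outside the support
    -- of p.
    have e2 : (plateReflection x + Pi.single 2 (2 * a) : Pt) 2 = 2 * a - x 2 := by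
      simp [plateReflection]
      ring
    rw [hG, ← periodize_periodic h2a 2 p, periodize_eq h2a (by rw [e2]; linarith)
      (by rw [e2]; linarith), Complex.ofReal_eq_zero]
    by_contra hne
    have := (hps _ hne).2
    rw [e2] at this
    linarith

/-- The sign s selects the parity: s = 1 tests against cosine waves, s = −1 against sine waves.
Either family suffices on the half torus that the slab represents. -/
theorem ae_eq_zero_of_symmetrized (hL : 0 < L) (ha : 0 < a) {f : Pt → ℂ}
    (hf : Integrable f (slabMeasure L a)) {s : ℂ} (hs : ‖s‖ ≤ 1)
    (h : ∀ n : Fin 3 → ℤ, ∫ x, f x * (UnitAddTorus.mFourier n (torusProj L a x) +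
      s * UnitAddTorus.mFourier n (torusProj L a (plateReflection x))) ∂(slabMeasure L a) = 0) :
    ∀ᵐ x ∂(slabMeasure L a), f x = 0 := by
  have key : ∀ᵐ x ∂(slabMeasure L a), x ∈ slab L a → f x = 0 := by
    refine (isOpen_slab L a).ae_eq_zero_of_integral_contDiff_smul_eq_zero
      (hf.locallyIntegrable.locallyIntegrableOn _) fun g hg hgc hgs => ?_
    obtain ⟨δ, hδ, hδ'⟩ : ∃ δ : ℝ, 0 < δ ∧ ∀ x ∈ tsupport g, δ ≤ min (x 2) (a - x 2) := by
      refine hgc.isCompact.exists_forall_le' (by fun_prop) fun x hx => ?_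
      obtain ⟨-, -, h2, h2'⟩ := hgs hx
      exact lt_min h2 (by linarith)
    obtain ⟨G, hG⟩ := exists_torus_extension hL ha hg hδ fun x hx => by
      have hx' := subset_tsupport g hx
      obtain ⟨h0, h1, -⟩ := hgs hx'
      have := le_min_iff.1 (hδ' x hx')
      exact ⟨h0, h1, this.1, by linarith [this.2]⟩
    rw [← integral_symmetrized_eq_zero hf hs h G]
    refine integral_congr_ae ?_
    filter_upwards [(ae_restrict_mem (measurableSet_slab L a) :
      ∀ᵐ x ∂(slabMeasure L a), x ∈ slab L a)] with x hx
    rw [(hG x hx).1, (hG x hx).2, mul_zero, add_zero, mul_comm, Complex.real_smul]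
  filter_upwards [key, (ae_restrict_mem (measurableSet_slab L a) :
      ∀ᵐ x ∂(slabMeasure L a), x ∈ slab L a)] with x h1 h2
  exact h1 h2

theorem star_lateralWave (k l x : Pt) (h0 : l 0 = -k 0) (h1 : l 1 = -k 1) :
    star (lateralWave l x) = lateralWave k x := by
  unfold lateralWave
  rw [Complex.star_def, ← Complex.exp_conj]
  congr 1
  simp [h0, h1]
  ring

/-- Each wave is, up to sign, the conjugate of a wave with `n₂ ≥ 0`. -/
theorem exists_wave_eq_star (n : Fin 3 → ℤ) : ∃ m : Fin 3 → ℤ, 0 ≤ m 2 ∧ ∃ ε : ℂ, ∀ x : Pt,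
    sinWave (waveVector L a n) x = ε * star (sinWave (waveVector L a m) x) ∧
    cosWave (waveVector L a n) x = star (cosWave (waveVector L a m) x) := by
  have h0 : ∀ (m : ℤ), waveVector L a ![-n 0, -n 1, m] 0 = -waveVector L a n 0 := fun m => by
    simp [waveVector]
    ring
  have h1 : ∀ (m : ℤ), waveVector L a ![-n 0, -n 1, m] 1 = -waveVector L a n 1 := fun m => by
    simp [waveVector]
    ring
  rcases le_total 0 (n 2) with h | h
  · have h2 : waveVector L a ![-n 0, -n 1, n 2] 2 = waveVector L a n 2 := rfl
    refine ⟨![-n 0, -n 1, n 2], h, 1, fun x => ⟨?_, ?_⟩⟩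
    · rw [sinWave, sinWave, star_mul', star_lateralWave _ _ x (h0 (n 2)) (h1 (n 2)), h2,
        Complex.star_def, Complex.conj_ofReal, one_mul]
    · rw [cosWave, cosWave, star_mul', star_lateralWave _ _ x (h0 (n 2)) (h1 (n 2)), h2,
        Complex.star_def, Complex.conj_ofReal]
  · have h2 : waveVector L a ![-n 0, -n 1, -n 2] 2 = -waveVector L a n 2 := by
      simp [waveVector]
      ring
    refine ⟨![-n 0, -n 1, -n 2], by simpa using h, -1, fun x => ⟨?_, ?_⟩⟩
    · rw [sinWave, sinWave, star_mul', star_lateralWave _ _ x (h0 (-n 2)) (h1 (-n 2)), h2,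
        Complex.star_def, Complex.conj_ofReal, neg_mul (waveVector L a n 2), Real.sin_neg]
      push_cast
      ring
    · rw [cosWave, cosWave, star_mul', star_lateralWave _ _ x (h0 (-n 2)) (h1 (-n 2)), h2,
        Complex.star_def, Complex.conj_ofReal, neg_mul, Real.cos_neg]

/-- The cavity fields `(v₀ S, v₁ S, v₂ C)`, without the transversality condition, are total. -/
theorem eq_zero_of_forall_electricMode (hL : 0 < L) (ha : 0 < a) (F : L2Field L a)
    (h : ∀ n : Fin 3 → ℤ, 0 ≤ n 2 → ∀ v : C3,
      inner ℂ (toL2 L a (electricMode (waveVector L a n) v)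
        (contDiff_electricMode (waveVector L a n) v).continuous) F = 0) : F = 0 := by
  have := isFiniteMeasure_slab L a
  have hint : ∀ j, Integrable (fun x => F x j) (slabMeasure L a) := fun j =>
    (EuclideanSpace.proj (𝕜 := ℂ) j).integrable_comp ((Lp.memLp F).integrable (by norm_num))
  have hinner : ∀ n : Fin 3 → ℤ, 0 ≤ n 2 → ∀ v : C3, ∫ x, ∑ j,
      F x j * star (electricMode (waveVector L a n) v x j) ∂(slabMeasure L a) = 0 := by
    intro n hn v
    rw [← h n hn v, L2.inner_def]
    refine integral_congr_ae ?_
    filter_upwards [(memLp_of_continuous L a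
      (contDiff_electricMode (waveVector L a n) v).continuous).coeFn_toLp] with x hx
    unfold toL2
    rw [hx, PiLp.inner_apply]
    exact Finset.sum_congr rfl fun j _ => by rw [RCLike.inner_apply]; rfl
  have hsin : ∀ j : Fin 3, j ≠ 2 → ∀ n : Fin 3 → ℤ,
      ∫ x, F x j * sinWave (waveVector L a n) x ∂(slabMeasure L a) = 0 := by
    intro j hj n
    obtain ⟨m, hm, ε, hε⟩ := exists_wave_eq_star (L := L) (a := a) n
    have h1 := hinner m hm (EuclideanSpace.single j 1)
    have e : ∀ x, F x j * sinWave (waveVector L a n) x = ε * ∑ i, F x i *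
        star (electricMode (waveVector L a m) (EuclideanSpace.single j 1) x i) := by
      intro x
      rw [(hε x).1]
      fin_cases j
      · simp [Fin.sum_univ_three, electricMode]
        ring
      · simp [Fin.sum_univ_three, electricMode]
        ring
      · exact absurd rfl hj
    simp only [e, integral_const_mul, h1, mul_zero]
  have hcos : ∀ n : Fin 3 → ℤ,
      ∫ x, F x 2 * cosWave (waveVector L a n) x ∂(slabMeasure L a) = 0 := by
    intro n
    obtain ⟨m, hm, ε, hε⟩ := exists_wave_eq_star (L := L) (a := a) n
    have h1 := hinner m hm (EuclideanSpace.single 2 1)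
    have e : ∀ x, F x 2 * cosWave (waveVector L a n) x = ∑ i, F x i *
        star (electricMode (waveVector L a m) (EuclideanSpace.single 2 1) x i) := by
      intro x
      rw [(hε x).2]
      simp [Fin.sum_univ_three, electricMode]
    simp only [e, h1]
  have hz : ∀ j : Fin 3, j ≠ 2 → ∀ᵐ x ∂(slabMeasure L a), F x j = 0 := by
    intro j hj
    -- Tangential components are tested by sine waves, the antisymmetrized characters divided by 2i.
    refine ae_eq_zero_of_symmetrized hL ha (hint j) (s := -1) (by simp) fun n => ?_
    have e : ∀ x, F x j * (UnitAddTorus.mFourier n (torusProj L a x) +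
        -1 * UnitAddTorus.mFourier n (torusProj L a (plateReflection x))) =
        (2 * Complex.I) * (F x j * sinWave (waveVector L a n) x) := by
      intro x
      rw [mFourier_torusProj hL ha, mFourier_torusProj hL ha, cosWave_plateReflection,
        sinWave_plateReflection]
      ring
    simp only [e, integral_const_mul, hsin j hj, mul_zero]
  have hz2 : ∀ᵐ x ∂(slabMeasure L a), F x 2 = 0 := by
    refine ae_eq_zero_of_symmetrized hL ha (hint 2) (s := 1) (by simp) fun n => ?_
    have e : ∀ x, F x 2 * (UnitAddTorus.mFourier n (torusProj L a x) +
        1 * UnitAddTorus.mFourier n (torusProj L a (plateReflection x))) =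
        2 * (F x 2 * cosWave (waveVector L a n) x) := by
      intro x
      rw [mFourier_torusProj hL ha, mFourier_torusProj hL ha, cosWave_plateReflection,
        sinWave_plateReflection]
      ring
    simp only [e, integral_const_mul, hcos, mul_zero]
  apply Lp.ext
  filter_upwards [hz 0 (by decide), hz 1 (by decide), hz2, Lp.coeFn_zero C3 2 (slabMeasure L a)]
    with x h0 h1 h2 hx
  rw [hx]
  ext j
  fin_cases j
  · exact h0
  · exact h1
  · exact h2

end Totality

/-! ### Cutoff near the plates and gradients of sine waves -/

section Cutoff

variable {L a : ℝ}

/-- The derivative is continuous and zero beyond 1, so a bound on [−1, 1] suffices. The weight s + 1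
becomes n·y under the substitution s = n·y − 1 of the cutoff. -/
theorem exists_deriv_smoothTransition_bound : ∃ C : ℝ, 0 ≤ C ∧ ∀ s : ℝ, -1 ≤ s →
    (s + 1) * |deriv Real.smoothTransition s| ≤ C := by
  have hc : Continuous (deriv Real.smoothTransition) :=
    (Real.smoothTransition.contDiff (n := 1)).continuous_deriv le_rfl
  obtain ⟨C, hC⟩ := (isCompact_Icc (a := (-1 : ℝ)) (b := 1)).exists_bound_of_continuousOn
    (f := fun s => (s + 1) * |deriv Real.smoothTransition s|) (by fun_prop)
  refine ⟨max C 0, le_max_right _ _, fun s hs => ?_⟩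
  rcases le_or_gt s 1 with h | h
  · exact (le_abs_self _).trans ((hC s ⟨hs, h⟩).trans (le_max_left _ _))
  · have : deriv Real.smoothTransition s = 0 := by
      have he : Real.smoothTransition =ᶠ[𝓝 s] fun _ => (1 : ℝ) := by
        filter_upwards [lt_mem_nhds h] with t ht
        exact Real.smoothTransition.one_of_one_le ht.le
      rw [he.deriv_eq, deriv_const]
    rw [this, abs_zero, mul_zero]
    exact le_max_right _ _

/-- A cutoff in the plate variable that vanishes for `z ≤ 1/n` and for `z ≥ a - 1/n`. -/
noncomputable def plateCutoff (a : ℝ) (n : ℕ) (z : ℝ) : ℝ :=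
  Real.smoothTransition (n * z - 1) * Real.smoothTransition (n * (a - z) - 1)

theorem contDiff_plateCutoff (a : ℝ) (n : ℕ) : ContDiff ℝ ∞ (plateCutoff a n) := by
  unfold plateCutoff
  exact (Real.smoothTransition.contDiff.comp (by fun_prop)).mul
    (Real.smoothTransition.contDiff.comp (by fun_prop))

theorem plateCutoff_nonneg (a : ℝ) (n : ℕ) (z : ℝ) : 0 ≤ plateCutoff a n z :=
  mul_nonneg (Real.smoothTransition.nonneg _) (Real.smoothTransition.nonneg _)

theorem plateCutoff_le_one (a : ℝ) (n : ℕ) (z : ℝ) : plateCutoff a n z ≤ 1 :=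
  mul_le_one₀ (Real.smoothTransition.le_one _) (Real.smoothTransition.nonneg _)
    (Real.smoothTransition.le_one _)

theorem plateCutoff_support {n : ℕ} (hn : 0 < n) {z : ℝ} (hz : plateCutoff a n z ≠ 0) :
    (n : ℝ)⁻¹ ≤ z ∧ z ≤ a - (n : ℝ)⁻¹ := by
  have hn' : (0 : ℝ) < n := by exact_mod_cast hn
  have h1 : 0 < (n : ℝ) * z - 1 := by
    by_contra h
    exact hz (by rw [plateCutoff, Real.smoothTransition.zero_of_nonpos (not_lt.1 h), zero_mul])
  have h2 : 0 < (n : ℝ) * (a - z) - 1 := by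
    by_contra h
    exact hz (by rw [plateCutoff, Real.smoothTransition.zero_of_nonpos (not_lt.1 h), mul_zero])
  constructor
  · rw [inv_le_iff_one_le_mul₀' hn']
    linarith
  · have : (n : ℝ)⁻¹ ≤ a - z := by
      rw [inv_le_iff_one_le_mul₀' hn']
      linarith
    linarith

/-- Equality on a neighbourhood, rather than at the point, makes the derivatives agree as well. -/
theorem plateCutoff_eventually_eq {z : ℝ} (h0 : 0 < z) (h1 : z < a) :
    ∀ᶠ n : ℕ in atTop, ∀ᶠ y in 𝓝 z, plateCutoff a n y = 1 := by
  have e1 : ∀ᶠ n : ℕ in atTop, 2 < (n : ℝ) * z :=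
    (tendsto_natCast_atTop_atTop.atTop_mul_const h0).eventually_gt_atTop 2
  have e2 : ∀ᶠ n : ℕ in atTop, 2 < (n : ℝ) * (a - z) :=
    (tendsto_natCast_atTop_atTop.atTop_mul_const (sub_pos.2 h1)).eventually_gt_atTop 2
  filter_upwards [e1, e2] with n hn1 hn2
  have c1 : ContinuousAt (fun y : ℝ => (n : ℝ) * y) z := by fun_prop
  have c2 : ContinuousAt (fun y : ℝ => (n : ℝ) * (a - y)) z := by fun_prop
  filter_upwards [c1.eventually (lt_mem_nhds hn1), c2.eventually (lt_mem_nhds hn2)] with y h1 h2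
  rw [plateCutoff, Real.smoothTransition.one_of_one_le (by linarith),
    Real.smoothTransition.one_of_one_le (by linarith), mul_one]

theorem deriv_plateCutoff (a : ℝ) (n : ℕ) (z : ℝ) : deriv (plateCutoff a n) z =
    n * deriv Real.smoothTransition (n * z - 1) * Real.smoothTransition (n * (a - z) - 1) -
      Real.smoothTransition (n * z - 1) *
        (n * deriv Real.smoothTransition (n * (a - z) - 1)) := by
  have hd : ∀ s, HasDerivAt Real.smoothTransition (deriv Real.smoothTransition s) s := fun s =>
    ((Real.smoothTransition.contDiff (n := 1)).differentiable (by simp) s).hasDerivAt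
  have h1 : HasDerivAt (fun z : ℝ => (n : ℝ) * z - 1) n z := by
    simpa using ((hasDerivAt_id z).const_mul (n : ℝ)).sub_const 1
  have h2 : HasDerivAt (fun z : ℝ => (n : ℝ) * (a - z) - 1) (-n) z := by
    simpa using (((hasDerivAt_id z).const_sub a).const_mul (n : ℝ)).sub_const 1
  have h := (((hd _).comp z h1).mul ((hd _).comp z h2)).deriv
  refine Eq.trans ?_ (h.trans ?_)
  · rfl
  · simp only [Function.comp_apply]
    ring

/-- `|χ_n'(z)| min(z, a - z)` is bounded uniformly in `n`. -/
theorem exists_plateCutoff_bound (a : ℝ) : ∃ C : ℝ, 0 ≤ C ∧ ∀ (n : ℕ) (z b : ℝ), 0 ≤ b → b ≤ z →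
    b ≤ a - z → b * |deriv (plateCutoff a n) z| ≤ C := by
  obtain ⟨C, hC, h⟩ := exists_deriv_smoothTransition_bound
  refine ⟨2 * C, by positivity, fun n z b hb hz haz => ?_⟩
  have hn : (0 : ℝ) ≤ n := Nat.cast_nonneg n
  have key : ∀ y, b ≤ y → b * (n * |deriv Real.smoothTransition (n * y - 1)|) ≤ C := by
    intro y hy
    refine le_trans ?_ (h (n * y - 1) (by nlinarith))
    rw [sub_add_cancel, ← mul_assoc, mul_comm b]
    gcongr
  have hT : ∀ s, |Real.smoothTransition s| ≤ 1 := fun s => by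
    rw [abs_of_nonneg (Real.smoothTransition.nonneg s)]
    exact Real.smoothTransition.le_one s
  have h3 : |deriv (plateCutoff a n) z| ≤ n * |deriv Real.smoothTransition (n * z - 1)| +
      n * |deriv Real.smoothTransition (n * (a - z) - 1)| := by
    rw [deriv_plateCutoff]
    refine (abs_sub _ _).trans (add_le_add ?_ ?_)
    · rw [abs_mul, abs_mul, Nat.abs_cast]
      exact mul_le_of_le_one_right (by positivity) (hT _)
    · rw [abs_mul, abs_mul, Nat.abs_cast]
      exact mul_le_of_le_one_left (by positivity) (hT _)
  calc b * |deriv (plateCutoff a n) z| ≤ b * (n * |deriv Real.smoothTransition (n * z - 1)| +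
      n * |deriv Real.smoothTransition (n * (a - z) - 1)|) := by gcongr
    _ ≤ 2 * C := by
      rw [mul_add, two_mul]
      exact add_le_add (key z hz) (key (a - z) haz)

/-- The sine wave cut off near the plates. -/
noncomputable def cutoffWave (a : ℝ) (k : Pt) (n : ℕ) (x : Pt) : ℂ :=
  sinWave k x * (plateCutoff a n (x 2) : ℂ)

theorem isTest_cutoffWave {k : Pt} (hk : IsAdmissible L a k) {n : ℕ} (hn : 0 < n) :
    IsTest L a (cutoffWave a k n) := by
  refine ⟨?_, fun x => ⟨?_, ?_⟩, (n : ℝ)⁻¹, by positivity, fun x hx => ?_⟩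
  · exact (contDiff_sinWave k).mul (Complex.ofRealCLM.contDiff.comp
      ((contDiff_plateCutoff a n).comp (contDiff_apply ℝ ℝ (2 : Fin 3))))
  · simp [cutoffWave, (hk.lateralPeriodic_sinWave x).1]
  · simp [cutoffWave, (hk.lateralPeriodic_sinWave x).2]
  · refine plateCutoff_support hn fun h => hx ?_
    rw [cutoffWave, h, Complex.ofReal_zero, mul_zero]

theorem fderiv_cutoffWave (a : ℝ) (k : Pt) (n : ℕ) (x : Pt) (i : Fin 3) :
    fderiv ℝ (cutoffWave a k n) x (Pi.single i 1) =
      fderiv ℝ (sinWave k) x (Pi.single i 1) * (plateCutoff a n (x 2) : ℂ) +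
        sinWave k x * ((deriv (plateCutoff a n) (x 2) * (Pi.single i 1 : Pt) 2 : ℝ) : ℂ) := by
  have h1 : HasDerivAt (plateCutoff a n) (deriv (plateCutoff a n) (x 2)) (x 2) :=
    ((contDiff_plateCutoff a n).differentiable (by simp) _).hasDerivAt
  have h2 : HasFDerivAt (fun x : Pt => plateCutoff a n (x 2)) (deriv (plateCutoff a n) (x 2) •
      ContinuousLinearMap.proj (R := ℝ) (φ := fun _ : Fin 3 => ℝ) 2) x :=
    HasDerivAt.comp_hasFDerivAt (h₂ := plateCutoff a n)
      (f := ContinuousLinearMap.proj (R := ℝ) (φ := fun _ : Fin 3 => ℝ) 2) x h1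
      (ContinuousLinearMap.hasFDerivAt _)
  have h := (((contDiff_sinWave k).differentiable (by simp) x).hasFDerivAt.mul
    (Complex.ofRealCLM.hasFDerivAt.comp x h2)).fderiv
  change fderiv ℝ (cutoffWave a k n) x = _ at h
  rw [h]
  simp
  ring

theorem norm_sinWave_le (k x : Pt) : ‖sinWave k x‖ ≤ |k 2| * |x 2| := by
  unfold sinWave lateralWave
  rw [norm_mul, Complex.norm_exp_ofReal_mul_I, one_mul, Complex.norm_real, Real.norm_eq_abs,
    ← abs_mul]
  exact Real.abs_sin_le_abs

/-- Since sin(k₂a) = 0, sin(k₂x₂) is −cos(k₂a) sin(k₂(a − x₂)), so the sine wave also vanishes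
linearly at the upper plate. -/
theorem IsAdmissible.norm_sinWave_le {k : Pt} (hk : IsAdmissible L a k) (x : Pt) :
    ‖sinWave k x‖ ≤ |k 2| * |a - x 2| := by
  unfold sinWave lateralWave
  rw [norm_mul, Complex.norm_exp_ofReal_mul_I, one_mul, Complex.norm_real, Real.norm_eq_abs,
    ← abs_mul]
  have h1 : Real.sin (k 2 * x 2) = -Real.cos (k 2 * a) * Real.sin (k 2 * (a - x 2)) := by
    have h2 : k 2 * x 2 = k 2 * a - k 2 * (a - x 2) := by ring
    rw [h2, Real.sin_sub, hk.plate]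
    ring
  rw [h1, abs_mul, abs_neg]
  exact (mul_le_of_le_one_left (abs_nonneg _) (Real.abs_cos_le_one _)).trans Real.abs_sin_le_abs

theorem norm_C3_le_sum (v : C3) : ‖v‖ ≤ ‖v 0‖ + ‖v 1‖ + ‖v 2‖ := by
  rw [EuclideanSpace.norm_eq, Fin.sum_univ_three]
  refine Real.sqrt_le_iff.2 ⟨by positivity, ?_⟩
  nlinarith [norm_nonneg (v 0), norm_nonneg (v 1), norm_nonneg (v 2),
    mul_nonneg (norm_nonneg (v 0)) (norm_nonneg (v 1)),
    mul_nonneg (norm_nonneg (v 0)) (norm_nonneg (v 2)),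
    mul_nonneg (norm_nonneg (v 1)) (norm_nonneg (v 2))]

/-- The cutoff derivative grows like the inverse distance to the plates, and linear vanishing of the
sine wave compensates it. The bound is uniform in n, as dominated convergence demands. -/
theorem IsAdmissible.norm_sinWave_mul_deriv_le {k : Pt} (hk : IsAdmissible L a k) {C : ℝ}
    (hC : ∀ (n : ℕ) (z b : ℝ), 0 ≤ b → b ≤ z → b ≤ a - z →
      b * |deriv (plateCutoff a n) z| ≤ C) (n : ℕ) {x : Pt} (hx : x ∈ slab L a) :
    ‖sinWave k x‖ * |deriv (plateCutoff a n) (x 2)| ≤ |k 2| * C := by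
  obtain ⟨-, -, h0, h1⟩ := hx
  have h2 : ‖sinWave k x‖ ≤ |k 2| * min (x 2) (a - x 2) := by
    rcases min_choice (x 2) (a - x 2) with h | h
    · rw [h, ← abs_of_pos h0, abs_of_pos h0]
      simpa [abs_of_pos h0] using _root_.norm_sinWave_le k x
    · rw [h]
      simpa [abs_of_pos (sub_pos.2 h1)] using hk.norm_sinWave_le x
  refine (mul_le_mul_of_nonneg_right h2 (abs_nonneg _)).trans ?_
  rw [mul_assoc]
  exact mul_le_mul_of_nonneg_left (hC n (x 2) _ (le_min h0.le (sub_pos.2 h1).le) (min_le_left _ _)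
    (min_le_right _ _)) (abs_nonneg _)

/-- A divergence-free field is orthogonal to the gradients of the sine waves, although these do not
vanish near the plates. -/
theorem IsDivFree.inner_grad_sinWave {F : L2Field L a} (hF : IsDivFree F) {k : Pt}
    (hk : IsAdmissible L a k) :
    inner ℂ (toL2 L a (grad (sinWave k)) (continuous_grad (contDiff_sinWave k))) F = 0 := by
  have := isFiniteMeasure_slab L a
  have hslab : ∀ᵐ x ∂(slabMeasure L a), x ∈ slab L a := ae_restrict_mem (measurableSet_slab L a)
  have hinner : ∀ {φ : Pt → ℂ} (hφ : ContDiff ℝ ∞ φ),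
      inner ℂ (toL2 L a (grad φ) (continuous_grad hφ)) F =
        ∫ x, inner ℂ (grad φ x) (F x) ∂(slabMeasure L a) := by
    intro φ hφ
    rw [L2.inner_def]
    refine integral_congr_ae ?_
    filter_upwards [(memLp_of_continuous L a (continuous_grad hφ)).coeFn_toLp] with x hx
    unfold toL2
    rw [hx]
  have hcut : ∀ n : ℕ, 0 < n → ContDiff ℝ ∞ (cutoffWave a k n) := fun n hn =>
    (isTest_cutoffWave hk hn).smooth
  obtain ⟨C, hC0, hC⟩ := exists_plateCutoff_bound a
  obtain ⟨M, hM⟩ := (isCompact_Icc (a := (0 : Pt)) (b := ![L, L, a])).exists_bound_of_continuousOn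
    (continuous_grad (contDiff_sinWave k)).continuousOn
  have hlim : Tendsto (fun n : ℕ => ∫ x, inner ℂ (grad (cutoffWave a k (n + 1)) x) (F x)
      ∂(slabMeasure L a)) atTop
      (𝓝 (∫ x, inner ℂ (grad (sinWave k) x) (F x) ∂(slabMeasure L a))) := by
    -- Each of the three components of χ∇S contributes M, and the extra term Sχ' contributes |k₂|C.
    -- The index n + 1 avoids n = 0, for which the cutoff lemma gives no test function.
    refine tendsto_integral_of_dominated_convergence (fun x => (3 * M + |k 2| * C) * ‖F x‖) ?_ ?_ ?_ ?_
    · exact fun n => (continuous_grad (hcut _ n.succ_pos)).aestronglyMeasurable.inner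
        (Lp.aestronglyMeasurable F)
    · exact ((Lp.memLp F).integrable (by norm_num)).norm.const_mul _
    · intro n
      filter_upwards [hslab] with x hx
      refine (norm_inner_le_norm _ _).trans ?_
      gcongr
      have hMx := hM x (slab_subset_Icc L a hx)
      have hcomp : ∀ i, ‖fderiv ℝ (sinWave k) x (Pi.single i 1)‖ ≤ M := by
        intro i
        refine le_trans ?_ hMx
        have := PiLp.norm_apply_le (grad (sinWave k) x) i
        fin_cases i <;> exact this
      have hχ : ‖(plateCutoff a (n + 1) (x 2) : ℂ)‖ ≤ 1 := by
        rw [Complex.norm_real, Real.norm_eq_abs, abs_of_nonneg (plateCutoff_nonneg _ _ _)]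
        exact plateCutoff_le_one _ _ _
      have hprod : ∀ i, ‖fderiv ℝ (sinWave k) x (Pi.single i 1) *
          (plateCutoff a (n + 1) (x 2) : ℂ)‖ ≤ M := by
        intro i
        rw [norm_mul]
        exact (mul_le_of_le_one_right (norm_nonneg _) hχ).trans (hcomp i)
      have hlast := hk.norm_sinWave_mul_deriv_le hC (n + 1) hx
      refine (norm_C3_le_sum _).trans ?_
      have g0 : grad (cutoffWave a k (n + 1)) x 0 = fderiv ℝ (sinWave k) x (Pi.single 0 1) *
          (plateCutoff a (n + 1) (x 2) : ℂ) := by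
        change fderiv ℝ _ x (Pi.single 0 1) = _
        rw [fderiv_cutoffWave]
        simp
      have g1 : grad (cutoffWave a k (n + 1)) x 1 = fderiv ℝ (sinWave k) x (Pi.single 1 1) *
          (plateCutoff a (n + 1) (x 2) : ℂ) := by
        change fderiv ℝ _ x (Pi.single 1 1) = _
        rw [fderiv_cutoffWave]
        simp
      have g2 : grad (cutoffWave a k (n + 1)) x 2 = fderiv ℝ (sinWave k) x (Pi.single 2 1) *
          (plateCutoff a (n + 1) (x 2) : ℂ) +
          sinWave k x * ((deriv (plateCutoff a (n + 1)) (x 2) : ℝ) : ℂ) := by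
        change fderiv ℝ _ x (Pi.single 2 1) = _
        rw [fderiv_cutoffWave]
        simp
      have h2 : ‖grad (cutoffWave a k (n + 1)) x 2‖ ≤ M + |k 2| * C := by
        rw [g2]
        refine (norm_add_le _ _).trans (add_le_add (hprod 2) ?_)
        rwa [norm_mul, Complex.norm_real, Real.norm_eq_abs]
      rw [g0, g1]
      linarith [hprod 0, hprod 1]
    · filter_upwards [hslab] with x hx
      have h1 := (tendsto_add_atTop_nat 1).eventually
        (plateCutoff_eventually_eq hx.2.2.1 hx.2.2.2)
      refine tendsto_const_nhds.congr' ?_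
      filter_upwards [h1] with n hn
      have h2 : cutoffWave a k (n + 1) =ᶠ[𝓝 x] sinWave k := by
        filter_upwards [(continuous_apply (2 : Fin 3)).continuousAt.eventually hn] with y hy
        rw [cutoffWave, hy, Complex.ofReal_one, mul_one]
      unfold grad
      rw [h2.fderiv_eq]
  rw [hinner (contDiff_sinWave k)]
  refine tendsto_nhds_unique hlim (tendsto_const_nhds.congr fun n => ?_)
  rw [← hinner (hcut _ n.succ_pos)]
  exact (hF _ (isTest_cutoffWave hk n.succ_pos)).symm

/-- Orthogonality to a fixed gradient is a closed condition, so it survives the L² closure of V_PEC.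
-/
theorem isDivFree_of_mem_HPEC {F : L2Field L a} (hF : F ∈ HPEC L a) : IsDivFree F := by
  intro φ h
  refine closure_minimal (t := {F : L2Field L a |
    inner ℂ (toL2 L a (grad φ) (continuous_grad h.smooth)) F = 0}) (fun G hG => hG.2 φ h) ?_ hF
  exact isClosed_eq (continuous_const.inner continuous_id) continuous_const

end Cutoff

/-! ### The orthonormal basis of cavity modes -/

section CavityModes

variable {L a : ℝ}

/-- The cavity field of a given wave vector, as a linear function of its amplitude. -/
noncomputable def electricLinear (L a : ℝ) (k : Pt) : C3 →ₗ[ℂ] L2Field L a where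
  toFun v := toL2 L a (electricMode k v) (contDiff_electricMode k v).continuous
  map_add' v w := by
    have h : electricMode k (v + w) = electricMode k v + electricMode k w := by
      funext x
      ext j
      fin_cases j <;> simp [electricMode, add_mul]
    simp only [h]
    rfl
  map_smul' c v := by
    have h : electricMode k (c • v) = c • electricMode k v := by
      funext x
      ext j
      fin_cases j <;> simp [electricMode, mul_assoc]
    simp only [h]
    rfl

theorem electricLinear_apply (k : Pt) (v : C3) : electricLinear L a k v =
    toL2 L a (electricMode k v) (contDiff_electricMode k v).continuous := rfl

/-- Seen as the cavity field with k = 0, the static mode is orthogonal to all others by the general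
orthogonality of waves, and completeness can treat it as one more amplitude. -/
theorem hzero_eq (L a : ℝ) : hzero L a = electricLinear L a 0
    ((((L ^ 2 * a) ^ (-(1 / 2) : ℝ) : ℝ) : ℂ) • EuclideanSpace.single 2 1) := by
  have h : electricMode 0 ((((L ^ 2 * a) ^ (-(1 / 2) : ℝ) : ℝ) : ℂ) • EuclideanSpace.single 2 1) =
      fun _ => !₂[0, 0, (((L ^ 2 * a) ^ (-(1 / 2) : ℝ) : ℝ) : ℂ)] := by
    funext x
    ext j
    fin_cases j <;> simp [electricMode, sinWave, cosWave, lateralWave]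
  rw [electricLinear_apply]
  simp only [h]
  rfl

theorem isAdmissible_zero (L a : ℝ) : IsAdmissible L a 0 := ⟨by simp, by simp, by simp⟩

theorem IsAdmissible.inner_electricLinear_of_ne {k l : Pt} (hk : IsAdmissible L a k)
    (hl : IsAdmissible L a l) (hk2 : 0 ≤ k 2) (hl2 : 0 ≤ l 2) (h : k ≠ l) (v w : C3) :
    inner ℂ (electricLinear L a k v) (electricLinear L a l w) = 0 := by
  obtain ⟨h1, h2⟩ := hk.slabInner_eq_zero hl hk2 hl2 h
  rw [electricLinear_apply, electricLinear_apply, inner_electricMode, h1, h2, mul_zero, mul_zero,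
    add_zero]

theorem IsAdmissible.inner_electricLinear_self {k : Pt} (hk : IsAdmissible L a k) (hk2 : k 2 ≠ 0)
    (v w : C3) : inner ℂ (electricLinear L a k v) (electricLinear L a k w) =
      (((slabMeasure L a).real Set.univ / 2 : ℝ) : ℂ) * inner ℂ v w := by
  obtain ⟨h1, h2⟩ := hk.slabInner_self hk2
  rw [electricLinear_apply, electricLinear_apply, inner_electricMode, h1, h2, PiLp.inner_apply,
    Fin.sum_univ_three]
  simp only [RCLike.inner_apply, starRingEnd_apply]
  ring

theorem inner_electricLinear_of_eq_zero {k : Pt} (hk2 : k 2 = 0) (c d : ℂ) :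
    inner ℂ (electricLinear L a k (c • EuclideanSpace.single 2 1))
      (electricLinear L a k (d • EuclideanSpace.single 2 1)) =
      star c * d * (((slabMeasure L a).real Set.univ : ℝ) : ℂ) := by
  rw [electricLinear_apply, electricLinear_apply, inner_electricMode,
    slabInner_cosWave_self_of_eq_zero hk2]
  simp

/-- The transverse cavity fields belong to `H_phys`. -/
theorem IsAdmissible.electricLinear_mem_Hphys {k : Pt} (hk : IsAdmissible L a k) (hk2 : 0 ≤ k 2)
    (hk0 : k ≠ 0) {v : C3} (hv : IsTransverse k v) : electricLinear L a k v ∈ Hphys L a := by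
  refine ⟨(VPEC L a).le_topologicalClosure
    ((hk.isSmoothPEC_electricMode v).mem_VPEC hv.div_eq_zero), ?_⟩
  rw [SetLike.mem_coe, Submodule.mem_orthogonal_singleton_iff_inner_right, hzero_eq]
  exact (isAdmissible_zero L a).inner_electricLinear_of_ne hk le_rfl hk2 hk0.symm _ _

theorem IsAdmissible.electricLinear_mem_eigenspaceAt {k : Pt} (hk : IsAdmissible L a k)
    {v : C3} (hv : IsTransverse k v) (hmem : electricLinear L a k v ∈ Hphys L a) :
    (⟨electricLinear L a k v, hmem⟩ : Hphys L a) ∈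
      eigenspaceAt (LMx L a) (k 0 ^ 2 + k 1 ^ 2 + k 2 ^ 2) := by
  have h := hk.isSmoothPEC_electricMode v
  have hc : ContDiff ℝ ∞ (curl (electricMode k v)) := by
    rw [curl_electricMode]
    exact contDiff_magneticMode k _
  refine mem_eigenspaceAt_LMx h (E := ⟨⟨electricLinear L a k v, hmem⟩, h.mem_VPEC hv.div_eq_zero⟩)
    rfl hc ?_ hv.curl_curl
  rw [curl_electricMode]
  exact hk.lateralPeriodic_magneticMode _

/-- The longitudinal amplitude, that of the gradient of a sine wave. -/
noncomputable def longitudinal (k : Pt) : C3 := !₂[Complex.I * k 0, Complex.I * k 1, (k 2 : ℂ)]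

theorem longitudinal_ne_zero {k : Pt} (hk2 : k 2 ≠ 0) : longitudinal k ≠ 0 := by
  intro h
  have := congrArg (fun v : C3 => v 2) h
  simp [longitudinal] at this
  exact hk2 this

/-- Conjugation in the inner product turns (ik₀, ik₁, k₂) into (−ik₀, −ik₁, k₂), so orthogonality is
the transversality condition up to sign. -/
theorem isTransverse_of_mem_orthogonal {k : Pt} {v : C3} (hv : v ∈ (ℂ ∙ longitudinal k)ᗮ) :
    IsTransverse k v := by
  rw [Submodule.mem_orthogonal_singleton_iff_inner_right, PiLp.inner_apply,
    Fin.sum_univ_three] at hv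
  simp [longitudinal] at hv
  unfold IsTransverse
  linear_combination -hv

/-- The longitudinal field is exactly the gradient of the sine wave. -/
theorem IsDivFree.inner_electricLinear_longitudinal {F : L2Field L a} (hF : IsDivFree F) {k : Pt}
    (hk : IsAdmissible L a k) : inner ℂ (electricLinear L a k (longitudinal k)) F = 0 := by
  have h : electricMode k (longitudinal k) = grad (sinWave k) := by
    funext x
    ext j
    fin_cases j <;>
      simp [electricMode, grad, fderiv_sinWave, lateralFactor, plateFactor, longitudinal]
  rw [← hF.inner_grad_sinWave hk, electricLinear_apply]
  simp only [h]

instance factFinrankC3 : Fact (Module.finrank ℂ C3 = 2 + 1) := ⟨by simp⟩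

/-- An orthonormal basis of the transverse amplitudes. -/
noncomputable def polarization (k : Pt) (hk2 : k 2 ≠ 0) :
    OrthonormalBasis (Fin 2) ℂ (ℂ ∙ longitudinal k)ᗮ :=
  OrthonormalBasis.fromOrthogonalSpanSingleton 2 (longitudinal_ne_zero hk2)

/-- Labels of the physical cavity modes: the two polarizations for each wave vector with
`n₂ = m + 1`, and the single mode for each nonzero lateral wave vector with `n₂ = 0`. -/
abbrev ModeIndex : Type := (ℤ × ℤ × ℕ) × Fin 2 ⊕ {p : ℤ × ℤ // p ≠ 0}

/-- The integers `n` of a mode. -/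
def modeNumber : ModeIndex → Fin 3 → ℤ
  | Sum.inl ((p, q, m), _) => ![p, q, m + 1]
  | Sum.inr ⟨(p, q), _⟩ => ![p, q, 0]

theorem waveVector_injective (hL : 0 < L) (ha : 0 < a) :
    Function.Injective (waveVector L a) := by
  intro m n h
  have hπ := Real.pi_pos
  have h0 : 2 * Real.pi * m 0 / L = 2 * Real.pi * n 0 / L := congrFun h 0
  have h1 : 2 * Real.pi * m 1 / L = 2 * Real.pi * n 1 / L := congrFun h 1
  have h2 : Real.pi * m 2 / a = Real.pi * n 2 / a := congrFun h 2
  field_simp at h0 h1 h2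
  funext i
  fin_cases i
  · exact_mod_cast h0
  · exact_mod_cast h1
  · exact_mod_cast h2

theorem waveVector_two_nonneg (ha : 0 < a) {n : Fin 3 → ℤ} (hn : 0 ≤ n 2) :
    0 ≤ waveVector L a n 2 := by
  have : (0 : ℝ) ≤ n 2 := by exact_mod_cast hn
  change 0 ≤ Real.pi * n 2 / a
  positivity

theorem waveVector_two_ne_zero (ha : 0 < a) {n : Fin 3 → ℤ} (hn : n 2 ≠ 0) :
    waveVector L a n 2 ≠ 0 := by
  have : (n 2 : ℝ) ≠ 0 := by exact_mod_cast hn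
  change Real.pi * n 2 / a ≠ 0
  positivity

theorem transverseNumber_two_ne_zero (p q : ℤ) (m : ℕ) :
    (![p, q, (m : ℤ) + 1] : Fin 3 → ℤ) 2 ≠ 0 := by
  change (m : ℤ) + 1 ≠ 0
  omega

theorem modeNumber_two_nonneg (i : ModeIndex) : 0 ≤ modeNumber i 2 := by
  rcases i with ⟨⟨p, q, m⟩, s⟩ | ⟨⟨p, q⟩, h⟩
  · change (0 : ℤ) ≤ m + 1
    positivity
  · exact le_rfl

theorem modeNumber_ne_zero (i : ModeIndex) : modeNumber i ≠ 0 := by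
  rcases i with ⟨⟨p, q, m⟩, s⟩ | ⟨⟨p, q⟩, h⟩
  · intro h0
    have : (m : ℤ) + 1 = 0 := congrFun h0 2
    omega
  · intro h0
    have h1 : p = 0 := congrFun h0 0
    have h2 : q = 0 := congrFun h0 1
    exact h (by rw [h1, h2]; rfl)

theorem waveVector_zero (L a : ℝ) : waveVector L a 0 = 0 := by
  funext i
  fin_cases i <;> simp [waveVector]

theorem modeVector_ne_zero (hL : 0 < L) (ha : 0 < a) (i : ModeIndex) :
    waveVector L a (modeNumber i) ≠ 0 := by
  rw [← waveVector_zero L a]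
  exact (waveVector_injective hL ha).ne (modeNumber_ne_zero i)

/-- The normalized amplitude of a mode. -/
noncomputable def modeAmplitude (ha : 0 < a) : ModeIndex → C3
  | Sum.inl ((p, q, m), s) => ((√((slabMeasure L a).real Set.univ / 2))⁻¹ : ℂ) •
      (polarization (waveVector L a ![p, q, m + 1])
        (waveVector_two_ne_zero ha (transverseNumber_two_ne_zero p q m)) s : C3)
  -- For n₂ = 0 the sine wave vanishes and the cosine wave has modulus one: there is a single
  -- vertical polarization, and the norm involves the full volume instead of half.
  | Sum.inr _ => ((√((slabMeasure L a).real Set.univ))⁻¹ : ℂ) • EuclideanSpace.single 2 1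

theorem isTransverse_modeAmplitude (ha : 0 < a) (i : ModeIndex) :
    IsTransverse (waveVector L a (modeNumber i)) (modeAmplitude (L := L) ha i) := by
  rcases i with ⟨⟨p, q, m⟩, s⟩ | ⟨⟨p, q⟩, h⟩
  · exact isTransverse_of_mem_orthogonal (Submodule.smul_mem _ _ (Subtype.mem _))
  · simp [IsTransverse, modeAmplitude, waveVector, modeNumber]

/-- The explicit normal modes of the slab. -/
noncomputable def cavityMode (hL : 0 < L) (ha : 0 < a) (i : ModeIndex) : Hphys L a :=
  ⟨electricLinear L a (waveVector L a (modeNumber i)) (modeAmplitude ha i),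
    (isAdmissible_waveVector hL ha _).electricLinear_mem_Hphys
      (waveVector_two_nonneg ha (modeNumber_two_nonneg i)) (modeVector_ne_zero hL ha i)
      (isTransverse_modeAmplitude ha i)⟩

/-- The eigenvalue `|k|²` of a mode. -/
noncomputable def modeEigenvalue (L a : ℝ) (i : ModeIndex) : ℝ :=
  waveVector L a (modeNumber i) 0 ^ 2 + waveVector L a (modeNumber i) 1 ^ 2 +
    waveVector L a (modeNumber i) 2 ^ 2

theorem modeEigenvalue_pos (hL : 0 < L) (ha : 0 < a) (i : ModeIndex) :
    0 < modeEigenvalue L a i := by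
  refine lt_of_le_of_ne (by unfold modeEigenvalue; positivity) fun h => ?_
  refine modeVector_ne_zero hL ha i (funext fun j => ?_)
  unfold modeEigenvalue at h
  have h0 := sq_nonneg (waveVector L a (modeNumber i) 0)
  have h1 := sq_nonneg (waveVector L a (modeNumber i) 1)
  have h2 := sq_nonneg (waveVector L a (modeNumber i) 2)
  have e : ∀ j, waveVector L a (modeNumber i) j ^ 2 = 0 →
      waveVector L a (modeNumber i) j = 0 := fun j => pow_eq_zero_iff two_ne_zero |>.1
  fin_cases j
  · exact e 0 (by linarith)
  · exact e 1 (by linarith)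
  · exact e 2 (by linarith)

theorem cavityMode_mem_eigenspaceAt (hL : 0 < L) (ha : 0 < a) (i : ModeIndex) :
    cavityMode hL ha i ∈ eigenspaceAt (LMx L a) (modeEigenvalue L a i) :=
  (isAdmissible_waveVector hL ha _).electricLinear_mem_eigenspaceAt
    (isTransverse_modeAmplitude ha i) _

/-- Distinct mode numbers give orthogonal waves. For equal ones the inner product reduces to that of
the amplitudes, and labels of different kinds cannot meet because m + 1 ≠ 0. -/
theorem inner_cavityMode (hL : 0 < L) (ha : 0 < a) (i j : ModeIndex) :
    inner ℂ (cavityMode hL ha i) (cavityMode hL ha j) = if i = j then (1 : ℂ) else 0 := by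
  have hV := volume_slab_pos hL ha
  change inner ℂ (electricLinear L a _ _) (electricLinear L a _ _) = _
  by_cases hn : modeNumber i = modeNumber j
  swap
  · rw [if_neg fun h => hn (congrArg _ h)]
    exact (isAdmissible_waveVector hL ha _).inner_electricLinear_of_ne
      (isAdmissible_waveVector hL ha _) (waveVector_two_nonneg ha (modeNumber_two_nonneg i))
      (waveVector_two_nonneg ha (modeNumber_two_nonneg j))
      ((waveVector_injective hL ha).ne hn) _ _
  have hsq : ∀ {r : ℝ}, 0 < r → (star ((√r)⁻¹ : ℂ)) * ((√r)⁻¹ : ℂ) * (r : ℂ) = 1 := by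
    intro r hr
    have h1 : (√r) ^ 2 = r := Real.sq_sqrt hr.le
    have h2 : (√r : ℂ) ≠ 0 := Complex.ofReal_ne_zero.2 (Real.sqrt_pos.2 hr).ne'
    have h3 : star ((√r)⁻¹ : ℂ) = ((√r)⁻¹ : ℂ) := by simp
    rw [h3]
    nth_rewrite 3 [← h1]
    push_cast
    field_simp
  rcases i with ⟨⟨p, q, m⟩, s⟩ | ⟨⟨p, q⟩, h⟩ <;> rcases j with ⟨⟨p', q', m'⟩, s'⟩ | ⟨⟨p', q'⟩, h'⟩
  · obtain rfl : p = p' := congrFun hn 0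
    obtain rfl : q = q' := congrFun hn 1
    have hm : (m : ℤ) + 1 = m' + 1 := congrFun hn 2
    obtain rfl : m = m' := by omega
    have hk2 := waveVector_two_ne_zero (L := L) ha (n := ![p, q, m + 1])
      (transverseNumber_two_ne_zero p q m)
    have hpol := orthonormal_iff_ite.1 (polarization (waveVector L a ![p, q, m + 1]) hk2).orthonormal
      s s'
    refine ((isAdmissible_waveVector hL ha _).inner_electricLinear_self hk2 _ _).trans ?_
    simp only [modeAmplitude]
    rw [inner_smul_left, inner_smul_right]
    rw [Submodule.coe_inner] at hpol
    rw [hpol]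
    by_cases hs : s = s'
    · subst hs
      have := hsq (half_pos hV)
      simp only [if_true, starRingEnd_apply]
      linear_combination this
    · simp [hs]
  · have : (m : ℤ) + 1 = 0 := congrFun hn 2
    omega
  · have : (0 : ℤ) = m' + 1 := congrFun hn 2
    omega
  · obtain rfl : p = p' := congrFun hn 0
    obtain rfl : q = q' := congrFun hn 1
    rw [if_pos rfl]
    simp only [modeAmplitude]
    rw [inner_electricLinear_of_eq_zero (by simp [waveVector, modeNumber])]
    exact hsq hV

theorem orthonormal_cavityMode (hL : 0 < L) (ha : 0 < a) :
    Orthonormal ℂ (cavityMode hL ha) :=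
  orthonormal_iff_ite.2 (inner_cavityMode hL ha)

/-- The normal modes are complete in `H_phys`. -/
theorem eq_zero_of_forall_cavityMode (hL : 0 < L) (ha : 0 < a) (F : Hphys L a)
    (h : ∀ i, inner ℂ (cavityMode hL ha i) F = 0) : F = 0 := by
  have hV := volume_slab_pos hL ha
  have hi : ∀ i, inner ℂ (electricLinear L a (waveVector L a (modeNumber i))
    (modeAmplitude ha i)) (F : L2Field L a) = 0 := h
  have hnormal : ∀ {r : ℝ}, 0 < r → ((√r)⁻¹ : ℂ) ≠ 0 := fun hr =>
    inv_ne_zero (Complex.ofReal_ne_zero.2 (Real.sqrt_pos.2 hr).ne')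
  refine Subtype.ext (eq_zero_of_forall_electricMode hL ha _ fun n hn v => ?_)
  change inner ℂ (electricLinear L a (waveVector L a n) v) (F : L2Field L a) = 0
  -- K collects the amplitudes whose field at this wave vector is orthogonal to F; the claim becomes
  -- that every v lies in K.
  let K : Submodule ℂ C3 := ((ℂ ∙ (F : L2Field L a))ᗮ).comap (electricLinear L a (waveVector L a n))
  have hK : ∀ v, v ∈ K ↔
      inner ℂ (electricLinear L a (waveVector L a n) v) (F : L2Field L a) = 0 := fun v =>
    Submodule.mem_orthogonal_singleton_iff_inner_left
  rw [← hK]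
  rcases hn.eq_or_lt with hn0 | hn0
  · have hk2 : waveVector L a n 2 = 0 := by simp [waveVector, ← hn0]
    have he : EuclideanSpace.single 2 (1 : ℂ) ∈ K := by
      by_cases hp : (n 0, n 1) = 0
      -- At n = 0 no cavity mode is available; orthogonality to h₀, built into H_phys, takes its
      -- place.
      · have hn' : n = 0 := by
          funext i
          fin_cases i
          · exact congrArg Prod.fst hp
          · exact congrArg Prod.snd hp
          · exact hn0.symm
        have h1 := Submodule.mem_orthogonal_singleton_iff_inner_right.1 F.2.2
        rw [hzero_eq] at h1
        have h2 : (((L ^ 2 * a) ^ (-(1 / 2) : ℝ) : ℝ) : ℂ) ≠ 0 :=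
          Complex.ofReal_ne_zero.2 (Real.rpow_pos_of_pos (by positivity) _).ne'
        refine (K.smul_mem_iff h2).1 ((hK _).2 ?_)
        rw [hn', waveVector_zero]
        exact h1
      · have h1 := hi (Sum.inr ⟨(n 0, n 1), hp⟩)
        have hn' : modeNumber (Sum.inr ⟨(n 0, n 1), hp⟩) = n := by
          funext i
          fin_cases i
          · rfl
          · rfl
          · exact hn0
        rw [hn'] at h1
        exact (K.smul_mem_iff (hnormal hV)).1 ((hK _).2 h1)
    have hv : electricLinear L a (waveVector L a n) v =
        electricLinear L a (waveVector L a n) (v 2 • EuclideanSpace.single 2 (1 : ℂ)) := by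
      have : electricMode (waveVector L a n) v =
          electricMode (waveVector L a n) (v 2 • EuclideanSpace.single 2 (1 : ℂ)) := by
        funext x
        ext j
        fin_cases j <;> simp [electricMode, sinWave, hk2]
      rw [electricLinear_apply, electricLinear_apply]
      simp only [this]
    rw [hK, hv, ← hK]
    exact K.smul_mem _ he
  · have hk2 := waveVector_two_ne_zero (L := L) ha hn0.ne'
    -- For n₂ > 0, K contains the longitudinal line because F is divergence-free and its orthogonal
    -- complement because F is orthogonal to both polarizations.
    have hq : longitudinal (waveVector L a n) ∈ K := (hK _).2
      ((isDivFree_of_mem_HPEC F.2.1).inner_electricLinear_longitudinal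
        (isAdmissible_waveVector hL ha n))
    obtain ⟨m, hm⟩ : ∃ m : ℕ, n 2 = m + 1 := ⟨(n 2 - 1).toNat, by omega⟩
    have hn' : n = ![n 0, n 1, (m : ℤ) + 1] := by
      funext i
      fin_cases i
      · rfl
      · rfl
      · exact hm
    have hpol : ∀ s, (polarization (waveVector L a n) hk2 s : C3) ∈ K := by
      intro s
      have h1 := hi (Sum.inl ((n 0, n 1, m), s))
      -- `polarization` depends on a proof about its wave vector, so the equation for n is
      -- eliminated with n' a variable.
      have key : ∀ (n' : Fin 3 → ℤ) (hn2 : n = n') (hk' : waveVector L a n' 2 ≠ 0),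
          inner ℂ (electricLinear L a (waveVector L a n')
            (((√((slabMeasure L a).real Set.univ / 2))⁻¹ : ℂ) •
              (polarization (waveVector L a n') hk' s : C3))) (F : L2Field L a) = 0 →
          (polarization (waveVector L a n) hk2 s : C3) ∈ K := by
        rintro _ rfl hk' h2
        exact (K.smul_mem_iff (hnormal (half_pos hV))).1 ((hK _).2 h2)
      exact key _ hn' _ h1
    have h1 : (ℂ ∙ longitudinal (waveVector L a n))ᗮ ≤ K := by
      intro w hw
      have h2 := (polarization (waveVector L a n) hk2).sum_repr ⟨w, hw⟩
      have h3 := congrArg (Subtype.val) h2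
      change (⟨w, hw⟩ : ((ℂ ∙ longitudinal (waveVector L a n))ᗮ : Submodule ℂ C3)).1 ∈ K
      rw [← h3, Submodule.coe_sum]
      exact K.sum_mem fun s _ => K.smul_mem _ (hpol s)
    have h2 : (ℂ ∙ longitudinal (waveVector L a n)) ≤ K :=
      (Submodule.span_singleton_le_iff_mem _ _).2 hq
    have h3 : (⊤ : Submodule ℂ C3) ≤ K := by
      rw [← Submodule.sup_orthogonal_of_hasOrthogonalProjection
        (K := ℂ ∙ longitudinal (waveVector L a n))]
      exact sup_le h2 h1
    exact h3 trivial

/-- The orthonormal basis of `H_phys` formed by the normal modes. -/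
noncomputable def cavityBasis (hL : 0 < L) (ha : 0 < a) : HilbertBasis ModeIndex ℂ (Hphys L a) :=
  HilbertBasis.mkOfOrthogonalEqBot (orthonormal_cavityMode hL ha) (by
    rw [Submodule.eq_bot_iff]
    intro F hF
    exact eq_zero_of_forall_cavityMode hL ha F fun i => hF _ (Submodule.subset_span ⟨i, rfl⟩))

theorem cavityBasis_apply (hL : 0 < L) (ha : 0 < a) (i : ModeIndex) :
    cavityBasis hL ha i = cavityMode hL ha i := by
  simp [cavityBasis]

end CavityModes

/-! ### Finiteness of the heat trace and transfer to any eigenbasis -/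

section HeatTrace

variable {L a : ℝ}

theorem summable_pow_natAbs {r : ℝ} (h0 : 0 ≤ r) (h1 : r < 1) :
    Summable fun p : ℤ => r ^ p.natAbs :=
  Summable.of_nat_of_neg (by simpa using summable_geometric_of_lt_one h0 h1)
    (by simpa using summable_geometric_of_lt_one h0 h1)

theorem summable_lattice {r : ℝ} (h0 : 0 ≤ r) (h1 : r < 1) :
    Summable fun x : (ℤ × ℤ × ℕ) × Fin 2 =>
      r ^ x.1.1.natAbs * (r ^ x.1.2.1.natAbs * r ^ x.1.2.2) * (1 : ℝ) := by
  have hZ := summable_pow_natAbs h0 h1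
  have hn : ∀ k : ℕ, 0 ≤ r ^ k := fun k => pow_nonneg h0 k
  have h2 := hZ.mul_of_nonneg (summable_geometric_of_lt_one h0 h1) (fun _ => hn _) fun _ => hn _
  have h3 := hZ.mul_of_nonneg h2 (fun _ => hn _) fun _ => mul_nonneg (hn _) (hn _)
  exact h3.mul_of_nonneg (g := fun _ : Fin 2 => (1 : ℝ)) (Summable.of_finite)
    (fun _ => mul_nonneg (hn _) (mul_nonneg (hn _) (hn _))) fun _ => zero_le_one

/-- The embedding of the mode labels into a product. -/
def modeLabel : ModeIndex → (ℤ × ℤ × ℕ) × Fin 2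
  | Sum.inl ((p, q, m), s) => ((p, q, m + 1), s)
  | Sum.inr ⟨(p, q), _⟩ => ((p, q, 0), 0)

/-- Third entries m + 1 and 0 keep the two kinds of modes apart, so the default polarization 0 for
n₂ = 0 causes no collision. -/
theorem modeLabel_injective : Function.Injective modeLabel := by
  rintro (⟨⟨p, q, m⟩, s⟩ | ⟨⟨p, q⟩, h⟩) (⟨⟨p', q', m'⟩, s'⟩ | ⟨⟨p', q'⟩, h'⟩) hl <;>
    simp_all [modeLabel]

theorem natAbs_le_sq (p : ℤ) : (p.natAbs : ℝ) ≤ (p : ℝ) ^ 2 := by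
  have h : ((p.natAbs : ℤ) : ℝ) ≤ ((p ^ 2 : ℤ) : ℝ) :=
    Int.cast_le.2 (by
      rw [← Int.natAbs_sq]
      exact_mod_cast Nat.le_self_pow two_ne_zero _)
  rw [Int.cast_pow, Int.cast_natCast] at h
  exact h

/-- Since |p| ≤ p² on the integers, the quadratic form dominates a linear one, and a product of
geometric series can majorize the heat trace. -/
theorem exists_le_modeEigenvalue (hL : 0 < L) (ha : 0 < a) :
    ∃ b : ℝ, 0 < b ∧ ∀ i : ModeIndex, b * ((modeLabel i).1.1.natAbs +
      ((modeLabel i).1.2.1.natAbs + (modeLabel i).1.2.2)) ≤ modeEigenvalue L a i := by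
  have hπ := Real.pi_pos
  refine ⟨min ((2 * Real.pi / L) ^ 2) ((Real.pi / a) ^ 2), by positivity, fun i => ?_⟩
  have key : ∀ (p q : ℤ) (m : ℕ), min ((2 * Real.pi / L) ^ 2) ((Real.pi / a) ^ 2) *
      ((p.natAbs : ℝ) + (q.natAbs + m)) ≤ (2 * Real.pi * p / L) ^ 2 +
        (2 * Real.pi * q / L) ^ 2 + (Real.pi * m / a) ^ 2 := by
    intro p q m
    have hp := mul_le_mul (min_le_left ((2 * Real.pi / L) ^ 2) ((Real.pi / a) ^ 2))
      (natAbs_le_sq p) (Nat.cast_nonneg _) (by positivity)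
    have hq := mul_le_mul (min_le_left ((2 * Real.pi / L) ^ 2) ((Real.pi / a) ^ 2))
      (natAbs_le_sq q) (Nat.cast_nonneg _) (by positivity)
    have hm := mul_le_mul (min_le_right ((2 * Real.pi / L) ^ 2) ((Real.pi / a) ^ 2))
      (natAbs_le_sq m) (Nat.cast_nonneg _) (by positivity)
    simp only [Int.natAbs_natCast, Int.cast_natCast] at hm
    calc _ ≤ (2 * Real.pi / L) ^ 2 * (p : ℝ) ^ 2 + (2 * Real.pi / L) ^ 2 * (q : ℝ) ^ 2 +
          (Real.pi / a) ^ 2 * (m : ℝ) ^ 2 := by linarith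
      _ = _ := by ring
  rcases i with ⟨⟨p, q, m⟩, s⟩ | ⟨⟨p, q⟩, h⟩
  · have := key p q (m + 1)
    simpa [modeLabel, modeEigenvalue, waveVector, modeNumber] using this
  · have := key p q 0
    simpa [modeLabel, modeEigenvalue, waveVector, modeNumber] using this

theorem summable_exp_modeEigenvalue (hL : 0 < L) (ha : 0 < a) {t : ℝ} (ht : 0 < t) :
    Summable fun i : ModeIndex => Real.exp (-t * modeEigenvalue L a i) := by
  obtain ⟨b, hb, hle⟩ := exists_le_modeEigenvalue hL ha
  have htb : 0 < t * b := mul_pos ht hb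
  have hs := (summable_lattice (Real.exp_pos (-(t * b))).le
    (by rw [← Real.exp_zero]; exact Real.exp_lt_exp.2 (neg_lt_zero.2 htb))).comp_injective modeLabel_injective
  refine hs.of_nonneg_of_le (fun i => (Real.exp_pos _).le) fun i => ?_
  simp only [Function.comp_apply, mul_one, ← Real.exp_nat_mul, ← Real.exp_add]
  refine Real.exp_le_exp.2 ?_
  nlinarith [mul_le_mul_of_nonneg_left (hle i) ht.le]

theorem rpow_le_one_add_sq {x p : ℝ} (hx : 0 ≤ x) (hp : 0 ≤ p) (hp2 : p ≤ 2) :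
    x ^ p ≤ 1 + x ^ 2 := by
  rcases le_total x 1 with h | h
  · exact (Real.rpow_le_one hx h hp).trans (by nlinarith [sq_nonneg x])
  · refine (Real.rpow_le_rpow_of_exponent_le h hp2).trans ?_
    rw [Real.rpow_two]
    linarith

theorem rpow_mul_exp_le {x p t : ℝ} (hx : 0 ≤ x) (hp : 0 ≤ p) (hp2 : p ≤ 2) (ht : 0 < t) :
    x ^ p * Real.exp (-t * x) ≤ (1 + 8 / t ^ 2) * Real.exp (-(t / 2) * x) := by
  have h1 := Real.quadratic_le_exp_of_nonneg (x := t / 2 * x) (by positivity)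
  -- The quadratic Taylor term of exp at tx/2 is t²x²/8, whence the constant 8/t². Half of the
  -- exponential decay is spent on the power of x.
  have h2 : 1 + x ^ 2 ≤ (1 + 8 / t ^ 2) * Real.exp (t / 2 * x) := by
    calc 1 + x ^ 2 ≤ (1 + 8 / t ^ 2) * (1 + (t / 2 * x) ^ 2 / 2) := by
          have : (1 + 8 / t ^ 2) * (1 + (t / 2 * x) ^ 2 / 2) =
              1 + x ^ 2 + (8 / t ^ 2 + (t / 2 * x) ^ 2 / 2) := by
            field_simp
            ring
          rw [this]
          have : 0 ≤ 8 / t ^ 2 + (t / 2 * x) ^ 2 / 2 := by positivity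
          linarith
      _ ≤ _ := by
          refine mul_le_mul_of_nonneg_left ?_ (by positivity)
          have : 0 ≤ t / 2 * x := by positivity
          linarith
  calc x ^ p * Real.exp (-t * x)
      ≤ (1 + 8 / t ^ 2) * Real.exp (t / 2 * x) * Real.exp (-t * x) :=
        mul_le_mul_of_nonneg_right ((rpow_le_one_add_sq hx hp hp2).trans h2) (Real.exp_pos _).le
    _ = _ := by
        rw [mul_assoc, ← Real.exp_add]
        ring_nf

theorem summable_rpow_mul_exp_modeEigenvalue (hL : 0 < L) (ha : 0 < a) {p t : ℝ} (hp : 0 ≤ p)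
    (hp2 : p ≤ 2) (ht : 0 < t) :
    Summable fun i : ModeIndex =>
      modeEigenvalue L a i ^ p * Real.exp (-t * modeEigenvalue L a i) := by
  have hpos := modeEigenvalue_pos hL ha
  refine ((summable_exp_modeEigenvalue hL ha (half_pos ht)).mul_left (1 + 8 / t ^ 2)).of_nonneg_of_le
    (fun i => mul_nonneg (Real.rpow_nonneg (hpos i).le _) (Real.exp_pos _).le) fun i => ?_
  exact rpow_mul_exp_le (hpos i).le hp hp2 ht

theorem isMaxwellEigenbasis_iff {u : HilbertBasis ℕ ℂ (Hphys L a)} {lam : ℕ → ℝ} :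
    IsMaxwellEigenbasis u lam ↔ ∀ j, u j ∈ eigenspaceAt (LMx L a) (lam j) := by
  refine forall_congr' fun j => ⟨fun ⟨h, e⟩ => ⟨⟨u j, h⟩, rfl, e⟩, ?_⟩
  rintro ⟨⟨y, hy⟩, rfl, e⟩
  exact ⟨hy, e⟩

theorem cavityBasis_mem_eigenspaceAt (hL : 0 < L) (ha : 0 < a) (i : ModeIndex) :
    cavityBasis hL ha i ∈ eigenspaceAt (LMx L a) (modeEigenvalue L a i) := by
  rw [cavityBasis_apply]
  exact cavityMode_mem_eigenspaceAt hL ha i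

/-- An eigenvector whose eigenvalue differed from all |k|² would be orthogonal to the whole cavity
basis. -/
theorem IsMaxwellEigenbasis.pos (hL : 0 < L) (ha : 0 < a) {u : HilbertBasis ℕ ℂ (Hphys L a)}
    {lam : ℕ → ℝ} (h : IsMaxwellEigenbasis u lam) (j : ℕ) : 0 < lam j := by
  obtain ⟨i, hi⟩ := (isSymmetricPMap_LMx L a).exists_eigenvalue_eq (cavityBasis hL ha)
    (cavityBasis_mem_eigenspaceAt hL ha) (u.orthonormal.ne_zero j)
    (isMaxwellEigenbasis_iff.1 h j)
  rw [← hi]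
  exact modeEigenvalue_pos hL ha i

/-- The sum over the given basis equals that over the cavity basis in `ENNReal`, where it is finite;
positivity of the eigenvalues allows the return to real summability. -/
theorem IsMaxwellEigenbasis.summable_rpow_mul_exp (hL : 0 < L) (ha : 0 < a)
    {u : HilbertBasis ℕ ℂ (Hphys L a)} {lam : ℕ → ℝ} (h : IsMaxwellEigenbasis u lam) {p t : ℝ}
    (hp : 0 ≤ p) (hp2 : p ≤ 2) (ht : 0 < t) :
    Summable fun j => lam j ^ p * Real.exp (-t * lam j) := by
  have hnn : ∀ j, 0 ≤ lam j ^ p * Real.exp (-t * lam j) := fun j =>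
    mul_nonneg (Real.rpow_nonneg (h.pos hL ha j).le _) (Real.exp_pos _).le
  have hs := summable_rpow_mul_exp_modeEigenvalue hL ha hp hp2 ht
  have ht' := (isSymmetricPMap_LMx L a).tsum_eigenvalues_eq u (cavityBasis hL ha)
    (isMaxwellEigenbasis_iff.1 h) (cavityBasis_mem_eigenspaceAt hL ha)
    fun x => ENNReal.ofReal (x ^ p * Real.exp (-t * x))
  have hne := hs.tsum_ofReal_ne_top
  rw [← ht'] at hne
  refine (ENNReal.summable_toReal hne).congr fun j => ?_
  exact ENNReal.toReal_ofReal (hnn j)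

theorem exists_isMaxwellEigenbasis (hL : 0 < L) (ha : 0 < a) :
    ∃ (u : HilbertBasis ℕ ℂ (Hphys L a)) (lam : ℕ → ℝ), IsMaxwellEigenbasis u lam := by
  obtain ⟨hd⟩ := nonempty_denumerable ModeIndex
  let e := (Denumerable.eqv ModeIndex).symm
  have hv : Orthonormal ℂ (cavityMode hL ha ∘ e) := (orthonormal_cavityMode hL ha).comp e e.injective
  let u : HilbertBasis ℕ ℂ (Hphys L a) := HilbertBasis.mkOfOrthogonalEqBot hv (by
    rw [Submodule.eq_bot_iff]
    intro F hF
    refine eq_zero_of_forall_cavityMode hL ha F fun i =>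
      hF _ (Submodule.subset_span ⟨e.symm i, by simp⟩))
  refine ⟨u, fun j => modeEigenvalue L a (e j), isMaxwellEigenbasis_iff.2 fun j => ?_⟩
  have : u j = cavityMode hL ha (e j) := by simp [u]
  rw [this]
  exact cavityMode_mem_eigenspaceAt hL ha (e j)

/-- Dividing C by r ≠ 0 gives an operator with eigenvalues f(λ_j), so the functional calculus
applies and the factor is restored afterwards. -/
theorem IsSymmetricPMap.toPMap_eq_smul_spectralFunction {H : Type*} [NormedAddCommGroup H]
    [InnerProductSpace ℂ H] [CompleteSpace H] {ι : Type*} {A : H →ₗ.[ℂ] H}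
    (hA : IsSymmetricPMap A) (u : HilbertBasis ι ℂ H) {lam : ι → ℝ}
    (hu : ∀ j, u j ∈ eigenspaceAt A (lam j)) {f : ℝ → ℝ} (hf : Summable fun j => f (lam j))
    {r : ℝ} (hr : r ≠ 0) {C : H →L[ℂ] H}
    (hC : ∀ j, C (u j) = ((r * f (lam j) : ℝ) : ℂ) • u j) :
    (C : H →ₗ[ℂ] H).toPMap ⊤ = (r : ℂ) • spectralFunction A f := by
  have hrc : (r : ℂ) ≠ 0 := Complex.ofReal_ne_zero.2 hr
  rw [hA.spectralFunction_eq u hu hf (T := (r : ℂ)⁻¹ • C) fun j => by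
    rw [smul_apply, hC, Complex.ofReal_mul, mul_smul, inv_smul_smul₀ hrc]]
  exact LinearPMap.ext rfl fun x _ _ => (smul_inv_smul₀ hrc (C x)).symm

end HeatTrace

/-! ### The source field and its covariance -/

theorem proposition4p4 (L a : ℝ) (hL : 0 < L) (ha : 0 < a)
    (hbar c g : ℝ) (h_hbar : 0 < hbar) (hc : 0 < c) (hg : 0 < g) (τ : ℝ) (hτ : 0 < τ)
    {Ω : Type*} [MeasurableSpace Ω] (P : Measure Ω) [IsProbabilityMeasure P]
    (ξ : ℕ → Ω → ℂ) (hξ : IsWhiteNoise P ξ) :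
    (∃ (u : HilbertBasis ℕ ℂ (Hphys L a)) (lam : ℕ → ℝ), IsMaxwellEigenbasis u lam) ∧
    ∀ (u : HilbertBasis ℕ ℂ (Hphys L a)) (lam : ℕ → ℝ), IsMaxwellEigenbasis u lam →
      (∀ j, 0 < lam j) ∧
      ∃ S : Ω → Hphys L a,
        -- the series converges to `S` in `L²(Ω; H_phys)`
        MemLp S 2 P ∧
        (∀ j, MemLp (sourceTerm hbar c g τ u lam ξ j) 2 P) ∧
        Tendsto
          (fun N : ℕ => eLpNorm
            (fun w => (∑ j ∈ Finset.range N, sourceTerm hbar c g τ u lam ξ j w) - S w) 2 P)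
          atTop (𝓝 0) ∧
        -- `S` is a centered Gaussian random variable with values in `H_phys`
        HasGaussianLaw S P ∧
        ∫ w, S w ∂P = 0 ∧
        ((∀ i j, ∫ w, ξ i w * ξ j w ∂P = 0) →
          ∀ x y : Hphys L a, ∫ w, inner ℂ x (S w) * inner ℂ y (S w) ∂P = 0) ∧
        -- its covariance operator is `(ħc/g) L_Mx^{3/2} e^{-τ L_Mx}`, positive and trace class
        ∃ C, HasCovarianceOperator S P C ∧
          (C : Hphys L a →ₗ[ℂ] Hphys L a).toPMap ⊤ =
            ((hbar * c / g : ℝ) : ℂ) • spectralFunction (LMx L a)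
              (fun μ => μ ^ (3 / 2 : ℝ) * Real.exp (-τ * μ)) ∧
          C.IsPositive ∧
          IsTraceClass C := by
  refine ⟨exists_isMaxwellEigenbasis hL ha, fun u lam hu => ?_⟩
  have hpos := hu.pos hL ha
  refine ⟨hpos, ?_⟩
  have hκ : 0 < hbar * c / g := by positivity
  let d : ℕ → ℝ := fun j =>
    (hbar * c / g) ^ (1 / 2 : ℝ) * lam j ^ (3 / 4 : ℝ) * Real.exp (-τ * lam j / 2)
  have hterm : ∀ j, sourceTerm hbar c g τ u lam ξ j = randomTerm d ξ u j := fun _ => rfl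
  simp only [hterm]
  -- The amplitudes carry the power 3/4 at the halved time τ/2; their squares carry 3/2 at time τ.
  have hd : Summable fun j => |d j| := by
    refine ((hu.summable_rpow_mul_exp hL ha (p := 3 / 4) (by norm_num) (by norm_num)
      (half_pos hτ)).mul_left ((hbar * c / g) ^ (1 / 2 : ℝ))).congr fun j => ?_
    have h0 := (hpos j).le
    rw [abs_of_nonneg (by positivity)]
    simp only [d]
    rw [mul_assoc]
    ring_nf
  have hd2 : ∀ j, d j ^ 2 =
      hbar * c / g * (lam j ^ (3 / 2 : ℝ) * Real.exp (-τ * lam j)) := by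
    intro j
    simp only [d]
    rw [mul_pow, mul_pow, ← Real.rpow_mul_natCast hκ.le, ← Real.rpow_mul_natCast (hpos j).le,
      ← Real.exp_nat_mul]
    norm_num
    ring_nf
  -- This summability serves both the spectral calculus and the trace.
  have hsum := hu.summable_rpow_mul_exp hL ha (p := 3 / 2) (by norm_num) (by norm_num) hτ
  obtain ⟨S, hS, hl⟩ := exists_sum_randomTerm hξ (u := u) (fun j => u.orthonormal.1 j) hd
  obtain ⟨C, hC, hCpos, hCu⟩ := exists_covariance u hξ hS hl
  refine ⟨S, hS, memLp_randomTerm hξ, hl,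
    hasGaussianLaw_of_tendsto (hasGaussianLaw_sum_randomTerm hξ) (memLp_sum_randomTerm hξ) hS hl,
    integral_eq_zero_of_tendsto hξ hS hl, circular_of_tendsto hξ hS hl, C, hC, ?_, hCpos,
    isTraceClass_of_diagonal u hCpos (c := fun j => d j ^ 2) ?_ hCu⟩
  · exact (isSymmetricPMap_LMx L a).toPMap_eq_smul_spectralFunction u
      (isMaxwellEigenbasis_iff.1 hu) hsum hκ.ne' fun j => by rw [hCu, hd2]
  · simp only [hd2]
    exact hsum.mul_left _
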